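/- Let $N\in\mathbb{Z}_{\ge 0}$ and $\mathbb{K}=\mathbb{Q}(\sqrt{-1})$. All categories below are $\mathbb{K}$-linear monoidal, with objects the words in letters $k\in\mathbb{Z}_{\ge 0}$, where $0=\mathbb{1}$ (strands of thickness $0$ are not drawn). Diagrams are read from bottom to top. *Type A webs.* Generators: merges $m_{k,l}\colon k\otimes l\to k+l$, splits $s_{k,l}\colon k+l\to k\otimes l$, crossings $x_{k,l}\colon k\otimes l\to l\otimes k$. Relations: $1_k=0$ for $k>N$; associativity of merges and coassociativity of splits; $m_{k,l}s_{k,l}=\binom{k+l}{k}1_{k+l}$; and, for $k+l=r+s$, $$s_{r,s}\,m_{k,l}=\sum_{\substack{0\le a\le k,\;0\le b\le l\\ k-a+b=r}}(-1)^{ab}\,(m_{k-a,b}\otimes m_{a,l-b})(1\otimes x_{a,b}\otimes 1)(s_{k-a,a}\otimes s_{b,l-b}).$$ *The orthogonal web category* $\mathbf{Web}_{\mathbb{K}}(\mathrm{O}(N))$ is generated by the type A generators and caps $\cap_k\colon k\otimes k\to\mathbb{1}$ and cups $\cup_k\colon\mathbb{1}\to k\otimes k$ for all $k$, subject to the type A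 relations and the following. (1) Pivotality with $k^*=k$: the zigzag relations for $\cap_k,\cup_k$; rotating $m_{k,l}$ by a half turn, in either direction, gives $s_{l,k}$; rotating a crossing by a quarter turn gives a crossing. (2) Circle removal $\cap_k\cup_k=\binom{N}{k}$, and the lollipop relations: for $a\ge 1$ the composites $(1_l\otimes\cap_a)(s_{l,a}\otimes 1_a)s_{l+a,a}$ and $(\cap_a\otimes 1_l)(1_a\otimes s_{a,l})s_{a,a+l}$ from $l+2a$ to $l$ vanish. (3) With $e^{(a)}=(m_{k,a}\otimes m_{a,l})(1_k\otimes\cup_a\otimes 1_l)$ and $f^{(b)}=(1_{k-b}\otimes\cap_b\otimes 1_{l-b})(s_{k-b,b}\otimes s_{b,l-b})$ on $k\otimes l$ (where $f^{(b)}=0$ on $k\otimes l$ if $b>\min(k,l)$), whenever $k+a-b,\,l+a-b\ge 0$: $$e^{(a)}f^{(b)}1_{k\otimes l}=\sum_{x=0}^{\min(a,b)}\binom{k+l-N+a-b}{x}f^{(b-x)}e^{(a-x)}1_{k\otimes l}.$$ *Sartori's dequantized orthogonal web category* $\mathbf{SWeb}_{\mathbb{K}}(\mathrm{O}(N))$ is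 generated by the type A generators and one thin cap $\cap\colon 1\otimes 1\to\mathbb{1}$ and one thin cup $\cup\colon\mathbb{1}\to 1\otimes 1$, subject to the type A relations and: circle removal $\cap\cup=N$; bubble removal $(1_1\otimes\cap)(s_{1,1}m_{1,1}\otimes 1_1)(1_1\otimes\cup)=(N-1)1_1$; the lollipop relations $\cap\, s_{1,1}=0$ and $m_{1,1}\cup=0$; strands of any thickness slide, via crossings, through $\cap$ and $\cup$; and merge-split sliding: on two nested thin cups (dually, caps), applying $s_{1,1}m_{1,1}$ to the two left strands equals applying it to the two right strands. In it, thick caps and cups are defined by explosion: $\cap_k$ is $\frac{1}{k!}$ times the composite that splits both strands of thickness $k$ into $k$ thin strands and closes these by $k$ nested thin caps, and dually for $\cup_k$. **Proposition.** With the braiding given by the crossings, the duality ($k^*=k$, $(X\otimes Y)^*=Y^*\otimes X^*$) given by nested caps and cups, and the twist given by the curl, both $\mathbf{Web}_{\mathbb{K}}(\mathrm{O}(N))$ and $\mathbf{SWeb}_{\mathbb{K}}(\mathrm{O}(N))$ are symmetric ribbon $\mathbb{K}$-linear categories. There is a strict symmetric ribbon $\mathbb{K}$-linear functor $F\colon\mathbf{SWeb}_{\mathbb{K}}(\mathrm{O}(N))\to\mathbf{Web}_{\mathbb{K}}(\mathrm{O}(N))$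 that is the identity on words and sends every generator to the web of the same name, and it is an equivalence. An inverse is the strict symmetric ribbon $\mathbb{K}$-linear functor that is the identity on words, sends merges, splits and crossings to the webs of the same name, and sends $\cap_k$ and $\cup_k$ to the thick caps and cups defined by explosion. -/

import Mathlib

open CategoryTheory MonoidalCategory

namespace OrthogonalWebs

/-! ### Linear monoidal categories given by generators and relations -/

/-- Words in the strands: `of m` is a strand of thickness `m + 1`.  Strands of thickness `0` are
the monoidal unit, see `ob`. -/
inductive Ob : Type
  | unit : Ob
  | of : ℕ → Ob
  | tensor : Ob → Ob → Ob

infixr:70 " ⊙ " => Ob.tensor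

/-- The object `k`, with `0 = 𝟙`. -/
def ob : ℕ → Ob
  | 0 => Ob.unit
  | m + 1 => Ob.of m

/-- Formal `𝕜`-linear combinations of formal composites and tensor products of generators `G`. -/
inductive Tm (𝕜 : Type) (G : Ob → Ob → Type) : Ob → Ob → Type
  | gen {X Y : Ob} (g : G X Y) : Tm 𝕜 G X Y
  | id (X : Ob) : Tm 𝕜 G X X
  | comp {X Y Z : Ob} (f : Tm 𝕜 G X Y) (g : Tm 𝕜 G Y Z) : Tm 𝕜 G X Z
  | tensor {X Y X' Y' : Ob} (f : Tm 𝕜 G X Y) (g : Tm 𝕜 G X' Y') : Tm 𝕜 G (X ⊙ X') (Y ⊙ Y')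
  | assoc (X Y Z : Ob) : Tm 𝕜 G ((X ⊙ Y) ⊙ Z) (X ⊙ (Y ⊙ Z))
  | assocInv (X Y Z : Ob) : Tm 𝕜 G (X ⊙ (Y ⊙ Z)) ((X ⊙ Y) ⊙ Z)
  | lUnit (X : Ob) : Tm 𝕜 G (Ob.unit ⊙ X) X
  | lUnitInv (X : Ob) : Tm 𝕜 G X (Ob.unit ⊙ X)
  | rUnit (X : Ob) : Tm 𝕜 G (X ⊙ Ob.unit) X
  | rUnitInv (X : Ob) : Tm 𝕜 G X (X ⊙ Ob.unit)
  | zero (X Y : Ob) : Tm 𝕜 G X Y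
  | add {X Y : Ob} (f g : Tm 𝕜 G X Y) : Tm 𝕜 G X Y
  | smul {X Y : Ob} (c : 𝕜) (f : Tm 𝕜 G X Y) : Tm 𝕜 G X Y

/- Composition in diagrammatic order: `f ⨟ g` is `f` at the bottom and `g` on top. -/
infixr:60 " ⨟ " => Tm.comp
infixr:70 " ⊠ " => Tm.tensor

/-- A presentation of a `𝕜`-linear monoidal category whose objects are the words in `Ob`. -/
structure Presentation (𝕜 : Type) where
  /-- generating morphisms -/
  Gen : Ob → Ob → Type
  /-- defining relations -/
  Rel : ∀ ⦃X Y : Ob⦄, Tm 𝕜 Gen X Y → Tm 𝕜 Gen X Y → Prop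

/-- The smallest congruence that contains the defining relations and makes the terms the
morphisms of a `𝕜`-linear monoidal category. -/
inductive Eqv {𝕜 : Type} [CommRing 𝕜] (P : Presentation 𝕜) :
    ∀ ⦃X Y : Ob⦄, Tm 𝕜 P.Gen X Y → Tm 𝕜 P.Gen X Y → Prop
  | rel {X Y} {f g : Tm 𝕜 P.Gen X Y} : P.Rel f g → Eqv P f g
  | refl {X Y} (f : Tm 𝕜 P.Gen X Y) : Eqv P f f
  | symm {X Y} {f g : Tm 𝕜 P.Gen X Y} : Eqv P f g → Eqv P g f
  | trans {X Y} {f g h : Tm 𝕜 P.Gen X Y} : Eqv P f g → Eqv P g h → Eqv P f h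
  | comp {X Y Z} {f f' : Tm 𝕜 P.Gen X Y} {g g' : Tm 𝕜 P.Gen Y Z} :
      Eqv P f f' → Eqv P g g' → Eqv P (f ⨟ g) (f' ⨟ g')
  | tensor {X Y X' Y'} {f f' : Tm 𝕜 P.Gen X Y} {g g' : Tm 𝕜 P.Gen X' Y'} :
      Eqv P f f' → Eqv P g g' → Eqv P (f ⊠ g) (f' ⊠ g')
  | add {X Y} {f f' g g' : Tm 𝕜 P.Gen X Y} :
      Eqv P f f' → Eqv P g g' → Eqv P (f.add g) (f'.add g')
  | smul {X Y} (c : 𝕜) {f f' : Tm 𝕜 P.Gen X Y} : Eqv P f f' → Eqv P (f.smul c) (f'.smul c)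
  | id_comp {X Y} (f : Tm 𝕜 P.Gen X Y) : Eqv P (Tm.id X ⨟ f) f
  | comp_id {X Y} (f : Tm 𝕜 P.Gen X Y) : Eqv P (f ⨟ Tm.id Y) f
  | comp_assoc {X Y Z W} (f : Tm 𝕜 P.Gen X Y) (g : Tm 𝕜 P.Gen Y Z) (h : Tm 𝕜 P.Gen Z W) :
      Eqv P ((f ⨟ g) ⨟ h) (f ⨟ (g ⨟ h))
  | add_assoc {X Y} (f g h : Tm 𝕜 P.Gen X Y) : Eqv P ((f.add g).add h) (f.add (g.add h))
  | add_comm {X Y} (f g : Tm 𝕜 P.Gen X Y) : Eqv P (f.add g) (g.add f)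
  | zero_add {X Y} (f : Tm 𝕜 P.Gen X Y) : Eqv P ((Tm.zero X Y).add f) f
  | one_smul {X Y} (f : Tm 𝕜 P.Gen X Y) : Eqv P (f.smul 1) f
  | mul_smul {X Y} (c d : 𝕜) (f : Tm 𝕜 P.Gen X Y) : Eqv P (f.smul (c * d)) ((f.smul d).smul c)
  | smul_add {X Y} (c : 𝕜) (f g : Tm 𝕜 P.Gen X Y) :
      Eqv P ((f.add g).smul c) ((f.smul c).add (g.smul c))
  | add_smul {X Y} (c d : 𝕜) (f : Tm 𝕜 P.Gen X Y) :
      Eqv P (f.smul (c + d)) ((f.smul c).add (f.smul d))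
  | zero_smul {X Y} (f : Tm 𝕜 P.Gen X Y) : Eqv P (f.smul 0) (Tm.zero X Y)
  | add_comp {X Y Z} (f g : Tm 𝕜 P.Gen X Y) (h : Tm 𝕜 P.Gen Y Z) :
      Eqv P (f.add g ⨟ h) ((f ⨟ h).add (g ⨟ h))
  | comp_add {X Y Z} (f : Tm 𝕜 P.Gen X Y) (g h : Tm 𝕜 P.Gen Y Z) :
      Eqv P (f ⨟ g.add h) ((f ⨟ g).add (f ⨟ h))
  | smul_comp {X Y Z} (c : 𝕜) (f : Tm 𝕜 P.Gen X Y) (g : Tm 𝕜 P.Gen Y Z) :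
      Eqv P (f.smul c ⨟ g) ((f ⨟ g).smul c)
  | comp_smul {X Y Z} (c : 𝕜) (f : Tm 𝕜 P.Gen X Y) (g : Tm 𝕜 P.Gen Y Z) :
      Eqv P (f ⨟ g.smul c) ((f ⨟ g).smul c)
  | add_tensor {X Y X' Y'} (f g : Tm 𝕜 P.Gen X Y) (h : Tm 𝕜 P.Gen X' Y') :
      Eqv P (f.add g ⊠ h) ((f ⊠ h).add (g ⊠ h))
  | tensor_add {X Y X' Y'} (f : Tm 𝕜 P.Gen X Y) (g h : Tm 𝕜 P.Gen X' Y') :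
      Eqv P (f ⊠ g.add h) ((f ⊠ g).add (f ⊠ h))
  | smul_tensor {X Y X' Y'} (c : 𝕜) (f : Tm 𝕜 P.Gen X Y) (g : Tm 𝕜 P.Gen X' Y') :
      Eqv P (f.smul c ⊠ g) ((f ⊠ g).smul c)
  | tensor_smul {X Y X' Y'} (c : 𝕜) (f : Tm 𝕜 P.Gen X Y) (g : Tm 𝕜 P.Gen X' Y') :
      Eqv P (f ⊠ g.smul c) ((f ⊠ g).smul c)
  | id_tensor_id (X Y) : Eqv P (Tm.id X ⊠ Tm.id Y) (Tm.id (X ⊙ Y))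
  | tensor_comp_tensor {X Y Z X' Y' Z'} (f : Tm 𝕜 P.Gen X Y) (f' : Tm 𝕜 P.Gen X' Y')
      (g : Tm 𝕜 P.Gen Y Z) (g' : Tm 𝕜 P.Gen Y' Z') :
      Eqv P ((f ⊠ f') ⨟ (g ⊠ g')) ((f ⨟ g) ⊠ (f' ⨟ g'))
  | assoc_assocInv (X Y Z) : Eqv P (Tm.assoc X Y Z ⨟ Tm.assocInv X Y Z) (Tm.id _)
  | assocInv_assoc (X Y Z) : Eqv P (Tm.assocInv X Y Z ⨟ Tm.assoc X Y Z) (Tm.id _)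
  | lUnit_lUnitInv (X) : Eqv P (Tm.lUnit X ⨟ Tm.lUnitInv X) (Tm.id _)
  | lUnitInv_lUnit (X) : Eqv P (Tm.lUnitInv X ⨟ Tm.lUnit X) (Tm.id _)
  | rUnit_rUnitInv (X) : Eqv P (Tm.rUnit X ⨟ Tm.rUnitInv X) (Tm.id _)
  | rUnitInv_rUnit (X) : Eqv P (Tm.rUnitInv X ⨟ Tm.rUnit X) (Tm.id _)
  | assoc_natural {X₁ X₂ X₃ Y₁ Y₂ Y₃} (f₁ : Tm 𝕜 P.Gen X₁ Y₁) (f₂ : Tm 𝕜 P.Gen X₂ Y₂)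
      (f₃ : Tm 𝕜 P.Gen X₃ Y₃) :
      Eqv P (((f₁ ⊠ f₂) ⊠ f₃) ⨟ Tm.assoc Y₁ Y₂ Y₃) (Tm.assoc X₁ X₂ X₃ ⨟ (f₁ ⊠ (f₂ ⊠ f₃)))
  | lUnit_natural {X Y} (f : Tm 𝕜 P.Gen X Y) :
      Eqv P ((Tm.id Ob.unit ⊠ f) ⨟ Tm.lUnit Y) (Tm.lUnit X ⨟ f)
  | rUnit_natural {X Y} (f : Tm 𝕜 P.Gen X Y) :
      Eqv P ((f ⊠ Tm.id Ob.unit) ⨟ Tm.rUnit Y) (Tm.rUnit X ⨟ f)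
  | pentagon (W X Y Z) :
      Eqv P ((Tm.assoc W X Y ⊠ Tm.id Z) ⨟ Tm.assoc W (X ⊙ Y) Z ⨟ (Tm.id W ⊠ Tm.assoc X Y Z))
        (Tm.assoc (W ⊙ X) Y Z ⨟ Tm.assoc W X (Y ⊙ Z))
  | triangle (X Y) :
      Eqv P (Tm.assoc X Ob.unit Y ⨟ (Tm.id X ⊠ Tm.lUnit Y)) (Tm.rUnit X ⊠ Tm.id Y)

/-- The `𝕜`-linear monoidal category presented by `P`. -/
structure Presented {𝕜 : Type} (P : Presentation 𝕜) : Type where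
  /-- the underlying word -/
  as : Ob

section Structure

variable {𝕜 : Type} [CommRing 𝕜] (P : Presentation 𝕜)

/-- Equality of morphisms of the presented category. -/
def eqvSetoid (X Y : Ob) : Setoid (Tm 𝕜 P.Gen X Y) :=
  ⟨fun f g => Eqv P f g, ⟨Eqv.refl, Eqv.symm, Eqv.trans⟩⟩

instance : Category (Presented P) where
  Hom X Y := Quotient (eqvSetoid P X.as Y.as)
  id X := Quotient.mk _ (Tm.id X.as)
  comp := Quotient.map₂ Tm.comp (fun _ _ hf _ _ hg => Eqv.comp hf hg)
  id_comp := by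
    rintro X Y ⟨f⟩
    exact Quotient.sound (Eqv.id_comp f)
  comp_id := by
    rintro X Y ⟨f⟩
    exact Quotient.sound (Eqv.comp_id f)
  assoc := by
    rintro X Y Z W ⟨f⟩ ⟨g⟩ ⟨h⟩
    exact Quotient.sound (Eqv.comp_assoc f g h)

variable {P} in
/-- The morphism represented by a term. -/
def Tm.mk {X Y : Ob} (f : Tm 𝕜 P.Gen X Y) : (⟨X⟩ : Presented P) ⟶ ⟨Y⟩ :=
  Quotient.mk (eqvSetoid P X Y) f

instance (X Y : Presented P) : Add (X ⟶ Y) :=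
  ⟨Quotient.map₂ Tm.add (fun _ _ hf _ _ hg => Eqv.add hf hg)⟩

instance (X Y : Presented P) : Zero (X ⟶ Y) :=
  ⟨Quotient.mk (eqvSetoid P X.as Y.as) (Tm.zero X.as Y.as)⟩

instance (X Y : Presented P) : Neg (X ⟶ Y) :=
  ⟨Quotient.map (Tm.smul (-1)) (fun _ _ h => Eqv.smul (-1) h)⟩

instance (X Y : Presented P) : AddCommGroup (X ⟶ Y) where
  nsmul := nsmulRec
  zsmul := zsmulRec
  add_assoc := by
    rintro ⟨f⟩ ⟨g⟩ ⟨h⟩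
    exact Quotient.sound (Eqv.add_assoc f g h)
  add_comm := by
    rintro ⟨f⟩ ⟨g⟩
    exact Quotient.sound (Eqv.add_comm f g)
  zero_add := by
    rintro ⟨f⟩
    exact Quotient.sound (Eqv.zero_add f)
  add_zero := by
    rintro ⟨f⟩
    exact Quotient.sound ((Eqv.add_comm _ _).trans (Eqv.zero_add f))
  neg_add_cancel := by
    rintro ⟨f⟩
    refine Quotient.sound (s := eqvSetoid P X.as Y.as) ?_
    have h := Eqv.add_smul (P := P) (-1) 1 f
    rw [neg_add_cancel] at h
    exact (Eqv.add (Eqv.refl _) (Eqv.one_smul f).symm).trans (h.symm.trans (Eqv.zero_smul f))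

instance (X Y : Presented P) : Module 𝕜 (X ⟶ Y) where
  smul c := Quotient.map (Tm.smul c) (fun _ _ h => Eqv.smul c h)
  one_smul := by
    rintro ⟨f⟩
    exact Quotient.sound (Eqv.one_smul f)
  mul_smul := by
    rintro c d ⟨f⟩
    exact Quotient.sound (Eqv.mul_smul c d f)
  smul_zero := by
    intro c
    refine Quotient.sound (s := eqvSetoid P X.as Y.as) ?_
    have h := Eqv.mul_smul (P := P) c 0 (Tm.zero X.as Y.as)
    rw [mul_zero] at h
    exact (Eqv.smul c (Eqv.zero_smul _).symm).trans (h.symm.trans (Eqv.zero_smul _))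
  smul_add := by
    rintro c ⟨f⟩ ⟨g⟩
    exact Quotient.sound (Eqv.smul_add c f g)
  add_smul := by
    rintro c d ⟨f⟩
    exact Quotient.sound (Eqv.add_smul c d f)
  zero_smul := by
    rintro ⟨f⟩
    exact Quotient.sound (Eqv.zero_smul f)

instance : Preadditive (Presented P) where
  add_comp := by
    rintro X Y Z ⟨f⟩ ⟨g⟩ ⟨h⟩
    exact Quotient.sound (Eqv.add_comp f g h)
  comp_add := by
    rintro X Y Z ⟨f⟩ ⟨g⟩ ⟨h⟩
    exact Quotient.sound (Eqv.comp_add f g h)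

instance : Linear 𝕜 (Presented P) where
  smul_comp := by
    rintro X Y Z c ⟨f⟩ ⟨g⟩
    exact Quotient.sound (Eqv.smul_comp c f g)
  comp_smul := by
    rintro X Y Z ⟨f⟩ c ⟨g⟩
    exact Quotient.sound (Eqv.comp_smul c f g)

instance : MonoidalCategoryStruct (Presented P) where
  tensorObj X Y := ⟨X.as ⊙ Y.as⟩
  tensorUnit := ⟨Ob.unit⟩
  tensorHom := Quotient.map₂ Tm.tensor (fun _ _ hf _ _ hg => Eqv.tensor hf hg)
  whiskerLeft X _ _ := Quotient.map (fun f => Tm.id X.as ⊠ f)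
    (fun _ _ h => Eqv.tensor (Eqv.refl _) h)
  whiskerRight f Y := Quotient.map (fun f => f ⊠ Tm.id Y.as)
    (fun _ _ h => Eqv.tensor h (Eqv.refl _)) f
  associator X Y Z := ⟨Tm.mk (Tm.assoc X.as Y.as Z.as), Tm.mk (Tm.assocInv X.as Y.as Z.as),
    Quotient.sound (Eqv.assoc_assocInv _ _ _), Quotient.sound (Eqv.assocInv_assoc _ _ _)⟩
  leftUnitor X := ⟨Tm.mk (Tm.lUnit X.as), Tm.mk (Tm.lUnitInv X.as),
    Quotient.sound (Eqv.lUnit_lUnitInv _), Quotient.sound (Eqv.lUnitInv_lUnit _)⟩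
  rightUnitor X := ⟨Tm.mk (Tm.rUnit X.as), Tm.mk (Tm.rUnitInv X.as),
    Quotient.sound (Eqv.rUnit_rUnitInv _), Quotient.sound (Eqv.rUnitInv_rUnit _)⟩

instance : MonoidalCategory (Presented P) :=
  MonoidalCategory.ofTensorHom
    (id_tensorHom_id := fun _ _ => Quotient.sound (Eqv.id_tensor_id _ _))
    (id_tensorHom := by
      rintro X Y Z ⟨f⟩
      rfl)
    (tensorHom_id := by
      rintro X Y ⟨f⟩ Z
      rfl)
    (tensorHom_comp_tensorHom := by
      rintro X₁ Y₁ Z₁ X₂ Y₂ Z₂ ⟨f₁⟩ ⟨f₂⟩ ⟨g₁⟩ ⟨g₂⟩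
      exact Quotient.sound (Eqv.tensor_comp_tensor f₁ f₂ g₁ g₂))
    (associator_naturality := by
      rintro X₁ X₂ X₃ Y₁ Y₂ Y₃ ⟨f₁⟩ ⟨f₂⟩ ⟨f₃⟩
      exact Quotient.sound (Eqv.assoc_natural f₁ f₂ f₃))
    (leftUnitor_naturality := by
      rintro X Y ⟨f⟩
      exact Quotient.sound (Eqv.lUnit_natural f))
    (rightUnitor_naturality := by
      rintro X Y ⟨f⟩
      exact Quotient.sound (Eqv.rUnit_natural f))
    (pentagon := fun _ _ _ _ => Quotient.sound (Eqv.pentagon _ _ _ _))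
    (triangle := fun _ _ => Quotient.sound (Eqv.triangle _ _))

instance : MonoidalPreadditive (Presented P) where
  whiskerLeft_zero {X Y Z} := by
    refine Quotient.sound (s := eqvSetoid P (X.as ⊙ Y.as) (X.as ⊙ Z.as)) ?_
    exact (Eqv.tensor (Eqv.refl _) (Eqv.zero_smul (Tm.zero _ _)).symm).trans
      ((Eqv.tensor_smul _ _ _).trans (Eqv.zero_smul _))
  zero_whiskerRight {X Y Z} := by
    refine Quotient.sound (s := eqvSetoid P (Y.as ⊙ X.as) (Z.as ⊙ X.as)) ?_
    exact (Eqv.tensor (Eqv.zero_smul (Tm.zero _ _)).symm (Eqv.refl _)).trans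
      ((Eqv.smul_tensor _ _ _).trans (Eqv.zero_smul _))
  whiskerLeft_add := by
    rintro X Y Z ⟨f⟩ ⟨g⟩
    exact Quotient.sound (Eqv.tensor_add _ f g)
  add_whiskerRight := by
    rintro X Y Z ⟨f⟩ ⟨g⟩
    exact Quotient.sound (Eqv.add_tensor f g _)

instance : MonoidalLinear 𝕜 (Presented P) where
  whiskerLeft_smul := by
    rintro X Y Z c ⟨f⟩
    exact Quotient.sound (Eqv.tensor_smul c _ f)
  smul_whiskerRight := by
    rintro c X Y ⟨f⟩ Z
    exact Quotient.sound (Eqv.smul_tensor c f _)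

end Structure

/-! ### Functors defined on generators -/

/-- The linear monoidal extension to terms of an assignment on generators. -/
def Tm.subst {𝕜 : Type} {G H : Ob → Ob → Type} (τ : ∀ ⦃X Y : Ob⦄, G X Y → Tm 𝕜 H X Y) :
    ∀ {X Y : Ob}, Tm 𝕜 G X Y → Tm 𝕜 H X Y
  | _, _, .gen g => τ g
  | _, _, .id X => .id X
  | _, _, .comp f g => .comp (f.subst τ) (g.subst τ)
  | _, _, .tensor f g => .tensor (f.subst τ) (g.subst τ)
  | _, _, .assoc X Y Z => .assoc X Y Z
  | _, _, .assocInv X Y Z => .assocInv X Y Z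
  | _, _, .lUnit X => .lUnit X
  | _, _, .lUnitInv X => .lUnitInv X
  | _, _, .rUnit X => .rUnit X
  | _, _, .rUnitInv X => .rUnitInv X
  | _, _, .zero X Y => .zero X Y
  | _, _, .add f g => .add (f.subst τ) (g.subst τ)
  | _, _, .smul c f => .smul c (f.subst τ)

/-- The assignment `τ` on generators sends the defining relations of `P` to identities between
morphisms of the category presented by `Q`. -/
def Respects {𝕜 : Type} [CommRing 𝕜] (P Q : Presentation 𝕜)
    (τ : ∀ ⦃X Y : Ob⦄, P.Gen X Y → Tm 𝕜 Q.Gen X Y) : Prop :=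
  ∀ ⦃X Y : Ob⦄ (f g : Tm 𝕜 P.Gen X Y), P.Rel f g → Eqv Q (f.subst τ) (g.subst τ)

section Functor

variable {𝕜 : Type} [CommRing 𝕜] {P Q : Presentation 𝕜}
  {τ : ∀ ⦃X Y : Ob⦄, P.Gen X Y → Tm 𝕜 Q.Gen X Y}

theorem Respects.eqv (hτ : Respects P Q τ) {X Y : Ob} {f g : Tm 𝕜 P.Gen X Y}
    (h : Eqv P f g) : Eqv Q (f.subst τ) (g.subst τ) := by
  induction h with
  | rel h => exact hτ _ _ h
  | refl => exact .refl _
  | symm _ ih => exact ih.symm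
  | trans _ _ ih₁ ih₂ => exact ih₁.trans ih₂
  | comp _ _ ih₁ ih₂ => exact .comp ih₁ ih₂
  | tensor _ _ ih₁ ih₂ => exact .tensor ih₁ ih₂
  | add _ _ ih₁ ih₂ => exact .add ih₁ ih₂
  | smul c _ ih => exact .smul c ih
  | id_comp => exact .id_comp _
  | comp_id => exact .comp_id _
  | comp_assoc => exact .comp_assoc _ _ _
  | add_assoc => exact .add_assoc _ _ _
  | add_comm => exact .add_comm _ _
  | zero_add => exact .zero_add _
  | one_smul => exact .one_smul _
  | mul_smul => exact .mul_smul _ _ _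
  | smul_add => exact .smul_add _ _ _
  | add_smul => exact .add_smul _ _ _
  | zero_smul => exact .zero_smul _
  | add_comp => exact .add_comp _ _ _
  | comp_add => exact .comp_add _ _ _
  | smul_comp => exact .smul_comp _ _ _
  | comp_smul => exact .comp_smul _ _ _
  | add_tensor => exact .add_tensor _ _ _
  | tensor_add => exact .tensor_add _ _ _
  | smul_tensor => exact .smul_tensor _ _ _
  | tensor_smul => exact .tensor_smul _ _ _
  | id_tensor_id => exact .id_tensor_id _ _
  | tensor_comp_tensor => exact .tensor_comp_tensor _ _ _ _
  | assoc_assocInv => exact .assoc_assocInv _ _ _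
  | assocInv_assoc => exact .assocInv_assoc _ _ _
  | lUnit_lUnitInv => exact .lUnit_lUnitInv _
  | lUnitInv_lUnit => exact .lUnitInv_lUnit _
  | rUnit_rUnitInv => exact .rUnit_rUnitInv _
  | rUnitInv_rUnit => exact .rUnitInv_rUnit _
  | assoc_natural => exact .assoc_natural _ _ _
  | lUnit_natural => exact .lUnit_natural _
  | rUnit_natural => exact .rUnit_natural _
  | pentagon => exact .pentagon _ _ _ _
  | triangle => exact .triangle _ _

/-- The functor, the identity on words, induced by an assignment on generators. -/
def inducedFunctor (hτ : Respects P Q τ) : Presented P ⥤ Presented Q where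
  obj X := ⟨X.as⟩
  map := Quotient.map (Tm.subst τ) (fun _ _ h => hτ.eqv h)
  map_id _ := rfl
  map_comp := by
    rintro X Y Z ⟨f⟩ ⟨g⟩
    rfl

/-- Induced functors are strict monoidal. -/
instance inducedFunctorMonoidal (hτ : Respects P Q τ) : (inducedFunctor hτ).Monoidal :=
  Functor.CoreMonoidal.toMonoidal
    { εIso := Iso.refl _
      μIso := fun _ _ => Iso.refl _
      μIso_hom_natural_left := by
        rintro X Y ⟨f⟩ Z
        exact (Category.comp_id _).trans (Category.id_comp _).symm
      μIso_hom_natural_right := by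
        rintro X Y Z ⟨f⟩
        exact (Category.comp_id _).trans (Category.id_comp _).symm
      associativity := fun X Y Z =>
        Quotient.sound (s := eqvSetoid Q ((X.as ⊙ Y.as) ⊙ Z.as) (X.as ⊙ (Y.as ⊙ Z.as)))
          (((Eqv.comp (Eqv.id_tensor_id _ _) (Eqv.id_comp _)).trans (Eqv.id_comp _)).trans
            ((Eqv.comp (Eqv.refl _) ((Eqv.comp_id _).trans (Eqv.id_tensor_id _ _))).trans
              (Eqv.comp_id _)).symm)
      left_unitality := fun X =>
        Quotient.sound (s := eqvSetoid Q (Ob.unit ⊙ X.as) X.as)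
          ((Eqv.comp (Eqv.id_tensor_id _ _) (Eqv.id_comp _)).trans (Eqv.id_comp _)).symm
      right_unitality := fun X =>
        Quotient.sound (s := eqvSetoid Q (X.as ⊙ Ob.unit) X.as)
          ((Eqv.comp (Eqv.id_tensor_id _ _) (Eqv.id_comp _)).trans (Eqv.id_comp _)).symm }

end Functor

/-! ### Symmetric ribbon linear categories and functors -/

/-- The data of a braided pivotal category: a candidate for the braiding, and for every object a
two-sided dual with its left and right (co)evaluations. -/
structure RibbonData (C : Type) [Category.{0} C] [MonoidalCategory C] where
  braid : ∀ X Y : C, X ⊗ Y ⟶ Y ⊗ X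
  dual : C → C
  ev : ∀ X : C, dual X ⊗ X ⟶ 𝟙_ C
  coev : ∀ X : C, 𝟙_ C ⟶ X ⊗ dual X
  ev' : ∀ X : C, X ⊗ dual X ⟶ 𝟙_ C
  coev' : ∀ X : C, 𝟙_ C ⟶ dual X ⊗ X

namespace RibbonData

variable {C : Type} [Category.{0} C] [MonoidalCategory C] (D : RibbonData C)

/-- The dual of a morphism, formed with `coev` and `ev`. -/
def mate {X Y : C} (f : X ⟶ Y) : D.dual Y ⟶ D.dual X :=
  (ρ_ (D.dual Y)).inv ≫ D.dual Y ◁ D.coev X ≫ D.dual Y ◁ (f ▷ D.dual X) ≫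
    (α_ (D.dual Y) Y (D.dual X)).inv ≫ D.ev Y ▷ D.dual X ≫ (λ_ (D.dual X)).hom

/-- The dual of a morphism, formed with `coev'` and `ev'`. -/
def mate' {X Y : C} (f : X ⟶ Y) : D.dual Y ⟶ D.dual X :=
  (λ_ (D.dual Y)).inv ≫ D.coev' X ▷ D.dual Y ≫ (D.dual X ◁ f) ▷ D.dual Y ≫
    (α_ (D.dual X) Y (D.dual Y)).hom ≫ D.dual X ◁ D.ev' Y ≫ (ρ_ (D.dual X)).hom

/-- The twist: the curl formed by the braiding and the pivotal structure. -/
def twist (X : C) : X ⟶ X :=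
  (ρ_ X).inv ≫ X ◁ D.coev X ≫ (α_ X X (D.dual X)).inv ≫ D.braid X X ▷ D.dual X ≫
    (α_ X X (D.dual X)).hom ≫ X ◁ D.ev' X ≫ (ρ_ X).hom

end RibbonData

/-- The data `D` make `C` a symmetric ribbon category: symmetric, pivotal, and with a twist
that is a ribbon structure. -/
structure IsSymmetricRibbon {C : Type} [Category.{0} C] [MonoidalCategory C]
    (D : RibbonData C) : Prop where
  symmetric : ∃ s : SymmetricCategory C, ∀ X Y : C, (s.braiding X Y).hom = D.braid X Y
  rightDual : ∀ X : C, ∃ e : ExactPairing X (D.dual X),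
    e.coevaluation' = D.coev X ∧ e.evaluation' = D.ev X
  leftDual : ∀ X : C, ∃ e : ExactPairing (D.dual X) X,
    e.coevaluation' = D.coev' X ∧ e.evaluation' = D.ev' X
  pivotal : ∀ {X Y : C} (f : X ⟶ Y), D.mate f = D.mate' f
  twist_isIso : ∀ X : C, IsIso (D.twist X)
  twist_natural : ∀ {X Y : C} (f : X ⟶ Y), f ≫ D.twist Y = D.twist X ≫ f
  twist_tensor : ∀ X Y : C,
    D.twist (X ⊗ Y) = (D.twist X ⊗ₘ D.twist Y) ≫ D.braid X Y ≫ D.braid Y X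
  twist_dual : ∀ X : C, D.mate (D.twist X) = D.twist (D.dual X)

/-- A monoidal functor is symmetric ribbon and `𝕜`-linear if it is `𝕜`-linear and preserves the
braiding and the twist (duals are preserved by every monoidal functor). -/
structure IsSymmetricRibbonFunctor (𝕜 : Type) [CommRing 𝕜] {C C' : Type} [Category.{0} C]
    [Category.{0} C'] [MonoidalCategory C] [MonoidalCategory C'] [Preadditive C] [Preadditive C']
    [Linear 𝕜 C] [Linear 𝕜 C'] (D : RibbonData C) (D' : RibbonData C') (F : C ⥤ C')
    [F.Monoidal] : Prop where
  additive : F.Additive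
  linear : F.Linear 𝕜
  map_braid : ∀ X Y : C, Functor.LaxMonoidal.μ F X Y ≫ F.map (D.braid X Y) =
    D'.braid (F.obj X) (F.obj Y) ≫ Functor.LaxMonoidal.μ F Y X
  map_twist : ∀ X : C, F.map (D.twist X) = D'.twist (F.obj X)

/-! ### Type A webs -/

/-- Merges `k ⊗ l → n` and splits `n → k ⊗ l` for `n = k + l`, and crossings
`k ⊗ l → l ⊗ k`. -/
inductive AGen : Ob → Ob → Type
  | merge (k l n : ℕ) (h : k + l = n) : AGen (ob k ⊙ ob l) (ob n)
  | split (k l n : ℕ) (h : k + l = n) : AGen (ob n) (ob k ⊙ ob l)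
  | cross (k l : ℕ) : AGen (ob k ⊙ ob l) (ob l ⊙ ob k)

section Terms

variable {𝕜 : Type} {G : Ob → Ob → Type}

/-- `∑_{x < n} f x`. -/
def Tm.sumRange {X Y : Ob} : ℕ → (ℕ → Tm 𝕜 G X Y) → Tm 𝕜 G X Y
  | 0, _ => Tm.zero X Y
  | n + 1, f => (Tm.sumRange n f).add (f n)

/-- Apply `f` to the two middle tensor factors. -/
def Tm.mid (A D : Ob) {B C E F : Ob} (f : Tm 𝕜 G (B ⊙ C) (E ⊙ F)) :
    Tm 𝕜 G ((A ⊙ B) ⊙ (C ⊙ D)) ((A ⊙ E) ⊙ (F ⊙ D)) :=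
  Tm.assoc A B (C ⊙ D) ⨟ (Tm.id A ⊠ (Tm.assocInv B C D ⨟ (f ⊠ Tm.id D) ⨟ Tm.assoc E F D)) ⨟
    Tm.assocInv A E (F ⊙ D)

/-- Create two middle tensor factors by `f`. -/
def Tm.insert (A D : Ob) {B C : Ob} (f : Tm 𝕜 G Ob.unit (B ⊙ C)) :
    Tm 𝕜 G (A ⊙ D) ((A ⊙ B) ⊙ (C ⊙ D)) :=
  (Tm.id A ⊠ (Tm.lUnitInv D ⨟ (f ⊠ Tm.id D) ⨟ Tm.assoc B C D)) ⨟ Tm.assocInv A B (C ⊙ D)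

/-- Annihilate the two middle tensor factors by `f`. -/
def Tm.contract (A D : Ob) {B C : Ob} (f : Tm 𝕜 G (B ⊙ C) Ob.unit) :
    Tm 𝕜 G ((A ⊙ B) ⊙ (C ⊙ D)) (A ⊙ D) :=
  Tm.assoc A B (C ⊙ D) ⨟ (Tm.id A ⊠ (Tm.assocInv B C D ⨟ (f ⊠ Tm.id D) ⨟ Tm.lUnit D))

variable (ι : ∀ ⦃X Y : Ob⦄, AGen X Y → G X Y)

/-- The merge `k ⊗ l → n`. -/
def merge (k l n : ℕ) (h : k + l = n) : Tm 𝕜 G (ob k ⊙ ob l) (ob n) :=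
  Tm.gen (ι (AGen.merge k l n h))

/-- The split `n → k ⊗ l`. -/
def split (k l n : ℕ) (h : k + l = n) : Tm 𝕜 G (ob n) (ob k ⊙ ob l) :=
  Tm.gen (ι (AGen.split k l n h))

/-- The crossing `k ⊗ l → l ⊗ k`. -/
def cross (k l : ℕ) : Tm 𝕜 G (ob k ⊙ ob l) (ob l ⊙ ob k) :=
  Tm.gen (ι (AGen.cross k l))

/-- The diagram `k ⊗ l → r ⊗ s` in which a strand of thickness `a` goes from the left to the right
and a strand of thickness `b` from the right to the left, crossing each other. -/
def crossedLadder (k l r s a b : ℕ) (ha : a ≤ k) (hb : b ≤ l) (hr : k + b = r + a)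
    (hs : k + l = r + s) : Tm 𝕜 G (ob k ⊙ ob l) (ob r ⊙ ob s) :=
  (split ι (k - a) a k (by omega) ⊠ split ι b (l - b) l (by omega)) ⨟
    Tm.mid (ob (k - a)) (ob (l - b)) (cross ι a b) ⨟
    (merge ι (k - a) b r (by omega) ⊠ merge ι a (l - b) s (by omega))

/-- The (exterior) type A web relations.  The first six say that strands of thickness `0` are
not drawn. -/
inductive TypeARel [CommRing 𝕜] (N : ℕ) :
    ∀ ⦃X Y : Ob⦄, Tm 𝕜 G X Y → Tm 𝕜 G X Y → Prop
  | merge_zero_left (l : ℕ) : TypeARel N (merge ι 0 l l (Nat.zero_add l)) (Tm.lUnit (ob l))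
  | merge_zero_right (k : ℕ) : TypeARel N (merge ι k 0 k rfl) (Tm.rUnit (ob k))
  | split_zero_left (l : ℕ) : TypeARel N (split ι 0 l l (Nat.zero_add l)) (Tm.lUnitInv (ob l))
  | split_zero_right (k : ℕ) : TypeARel N (split ι k 0 k rfl) (Tm.rUnitInv (ob k))
  | cross_zero_left (l : ℕ) :
      TypeARel N (cross ι 0 l) (Tm.lUnit (ob l) ⨟ Tm.rUnitInv (ob l))
  | cross_zero_right (k : ℕ) :
      TypeARel N (cross ι k 0) (Tm.rUnit (ob k) ⨟ Tm.lUnitInv (ob k))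
  | exterior (k : ℕ) (hk : N < k) : TypeARel N (Tm.id (ob k)) (Tm.zero (ob k) (ob k))
  | associativity (k l m p q n : ℕ) (hp : k + l = p) (hq : l + m = q) (h₁ : p + m = n)
      (h₂ : k + q = n) :
      TypeARel N ((merge ι k l p hp ⊠ Tm.id (ob m)) ⨟ merge ι p m n h₁)
        (Tm.assoc _ _ _ ⨟ (Tm.id (ob k) ⊠ merge ι l m q hq) ⨟ merge ι k q n h₂)
  | coassociativity (k l m p q n : ℕ) (hp : k + l = p) (hq : l + m = q) (h₁ : p + m = n)
      (h₂ : k + q = n) :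
      TypeARel N (split ι p m n h₁ ⨟ (split ι k l p hp ⊠ Tm.id (ob m)))
        (split ι k q n h₂ ⨟ (Tm.id (ob k) ⊠ split ι l m q hq) ⨟ Tm.assocInv _ _ _)
  | digon (k l n : ℕ) (h : k + l = n) :
      TypeARel N (split ι k l n h ⨟ merge ι k l n h) (Tm.smul (n.choose k : 𝕜) (Tm.id (ob n)))
  | schur (k l r s n : ℕ) (h : k + l = n) (h' : r + s = n) :
      TypeARel N (merge ι k l n h ⨟ split ι r s n h')
        (Tm.sumRange (k + 1) fun a => Tm.sumRange (l + 1) fun b =>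
          if H : a ≤ k ∧ b ≤ l ∧ k + b = r + a then
            Tm.smul ((-1) ^ (a * b))
              (crossedLadder ι k l r s a b H.1 H.2.1 H.2.2 (h.trans h'.symm))
          else Tm.zero _ _)

/-! Braidings and duals of words, from crossings, caps and cups of strands. -/

/-- A strand crosses over a word. -/
def braidStrand (m : ℕ) : ∀ Y : Ob, Tm 𝕜 G (Ob.of m ⊙ Y) (Y ⊙ Ob.of m)
  | .unit => Tm.rUnit _ ⨟ Tm.lUnitInv _
  | .of n => cross ι (m + 1) (n + 1)
  | .tensor Y Z => Tm.assocInv _ _ _ ⨟ (braidStrand m Y ⊠ Tm.id Z) ⨟ Tm.assoc _ _ _ ⨟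
      (Tm.id Y ⊠ braidStrand m Z) ⨟ Tm.assocInv _ _ _

/-- A word crosses over a word. -/
def braidWord : ∀ X Y : Ob, Tm 𝕜 G (X ⊙ Y) (Y ⊙ X)
  | .unit, _ => Tm.lUnit _ ⨟ Tm.rUnitInv _
  | .of m, Y => braidStrand ι m Y
  | .tensor X X', Y => Tm.assoc _ _ _ ⨟ (Tm.id X ⊠ braidWord X' Y) ⨟ Tm.assocInv _ _ _ ⨟
      (braidWord X Y ⊠ Tm.id X') ⨟ Tm.assoc _ _ _

/-- The dual of a word: `k* = k` and `(X ⊗ Y)* = Y* ⊗ X*`. -/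
def dualWord : Ob → Ob
  | .unit => .unit
  | .of m => .of m
  | .tensor X Y => dualWord Y ⊙ dualWord X

variable (cap : ∀ k : ℕ, Tm 𝕜 G (ob k ⊙ ob k) Ob.unit)
  (cup : ∀ k : ℕ, Tm 𝕜 G Ob.unit (ob k ⊙ ob k))

/-- Nested caps `X* ⊗ X → 𝟙`. -/
def evWord : ∀ X : Ob, Tm 𝕜 G (dualWord X ⊙ X) Ob.unit
  | .unit => Tm.lUnit _
  | .of m => cap (m + 1)
  | .tensor X Y => Tm.contract (dualWord Y) Y (evWord X) ⨟ evWord Y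

/-- Nested cups `𝟙 → X ⊗ X*`. -/
def coevWord : ∀ X : Ob, Tm 𝕜 G Ob.unit (X ⊙ dualWord X)
  | .unit => Tm.lUnitInv _
  | .of m => cup (m + 1)
  | .tensor X Y => coevWord X ⨟ Tm.insert X (dualWord X) (coevWord Y)

/-- Nested caps `X ⊗ X* → 𝟙`. -/
def evWord' : ∀ X : Ob, Tm 𝕜 G (X ⊙ dualWord X) Ob.unit
  | .unit => Tm.lUnit _
  | .of m => cap (m + 1)
  | .tensor X Y => Tm.contract X (dualWord X) (evWord' Y) ⨟ evWord' X

/-- Nested cups `𝟙 → X* ⊗ X`. -/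
def coevWord' : ∀ X : Ob, Tm 𝕜 G Ob.unit (dualWord X ⊙ X)
  | .unit => Tm.lUnitInv _
  | .of m => cup (m + 1)
  | .tensor X Y => coevWord' Y ⨟ Tm.insert (dualWord Y) Y (coevWord' X)

end Terms

/-- The braiding and the pivotal structure that are given by crossings, caps and cups. -/
def diagrammaticData {𝕜 : Type} [CommRing 𝕜] (P : Presentation 𝕜)
    (ι : ∀ ⦃X Y : Ob⦄, AGen X Y → P.Gen X Y)
    (cap : ∀ k : ℕ, Tm 𝕜 P.Gen (ob k ⊙ ob k) Ob.unit)
    (cup : ∀ k : ℕ, Tm 𝕜 P.Gen Ob.unit (ob k ⊙ ob k)) : RibbonData (Presented P) where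
  braid X Y := (braidWord ι X.as Y.as).mk
  dual X := ⟨dualWord X.as⟩
  ev X := (evWord cap X.as).mk
  coev X := (coevWord cup X.as).mk
  ev' X := (evWord' cap X.as).mk
  coev' X := (coevWord' cup X.as).mk

/-! ### Orthogonal webs -/

/-- Merges, splits and crossings, and the caps and cups of every thickness that display the
pivotal structure with `k* = k`. -/
inductive OGen : Ob → Ob → Type
  | typeA {X Y : Ob} (g : AGen X Y) : OGen X Y
  | cap (k : ℕ) : OGen (ob k ⊙ ob k) Ob.unit
  | cup (k : ℕ) : OGen Ob.unit (ob k ⊙ ob k)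

namespace OGen

variable {𝕜 : Type}

/-- Merges, splits and crossings as generators of orthogonal webs. -/
def ofA ⦃X Y : Ob⦄ (g : AGen X Y) : OGen X Y := OGen.typeA g

/-- The cap of thickness `k`. -/
def capTm (k : ℕ) : Tm 𝕜 OGen (ob k ⊙ ob k) Ob.unit := Tm.gen (OGen.cap k)

/-- The cup of thickness `k`. -/
def cupTm (k : ℕ) : Tm 𝕜 OGen Ob.unit (ob k ⊙ ob k) := Tm.gen (OGen.cup k)

/-- Half a turn of a merge, bending its top to the left and its bottom to the right. -/
def turnRight (k l n : ℕ) (h : k + l = n) : Tm 𝕜 OGen (ob n) (ob l ⊙ ob k) :=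
  Tm.rUnitInv _ ⨟ (Tm.id (ob n) ⊠ (cupTm k ⨟ Tm.insert (ob k) (ob k) (cupTm l))) ⨟
    (Tm.id (ob n) ⊠ (merge ofA k l n h ⊠ Tm.id (ob l ⊙ ob k))) ⨟
    Tm.assocInv _ _ _ ⨟ (capTm n ⊠ Tm.id (ob l ⊙ ob k)) ⨟ Tm.lUnit _

/-- Half a turn of a merge, bending its top to the right and its bottom to the left. -/
def turnLeft (k l n : ℕ) (h : k + l = n) : Tm 𝕜 OGen (ob n) (ob l ⊙ ob k) :=
  Tm.lUnitInv _ ⨟ ((cupTm l ⨟ Tm.insert (ob l) (ob l) (cupTm k)) ⊠ Tm.id (ob n)) ⨟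
    ((Tm.id (ob l ⊙ ob k) ⊠ merge ofA k l n h) ⊠ Tm.id (ob n)) ⨟
    Tm.assoc _ _ _ ⨟ (Tm.id (ob l ⊙ ob k) ⊠ capTm n) ⨟ Tm.rUnit _

/-- A quarter turn of the crossing `l ⊗ k → k ⊗ l`. -/
def quarterTurn (k l : ℕ) : Tm 𝕜 OGen (ob k ⊙ ob l) (ob l ⊙ ob k) :=
  Tm.rUnitInv _ ⨟ (Tm.id (ob k ⊙ ob l) ⊠ cupTm k) ⨟
    Tm.mid (ob k) (ob k) (cross ofA l k) ⨟ (capTm k ⊠ Tm.id (ob l ⊙ ob k)) ⨟ Tm.lUnit _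

/-- The ladder `e^{(a)} : k ⊗ l → p ⊗ q` for `p = k + a` and `q = l + a`. -/
def ladderE (a k l p q : ℕ) (hp : k + a = p) (hq : a + l = q) :
    Tm 𝕜 OGen (ob k ⊙ ob l) (ob p ⊙ ob q) :=
  Tm.insert (ob k) (ob l) (cupTm a) ⨟ (merge ofA k a p hp ⊠ merge ofA a l q hq)

/-- The ladder `f^{(b)} : k ⊗ l → p ⊗ q` for `k = p + b` and `l = q + b`. -/
def ladderF (b k l p q : ℕ) (hp : p + b = k) (hq : b + q = l) :
    Tm 𝕜 OGen (ob k ⊙ ob l) (ob p ⊙ ob q) :=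
  (split ofA p b k hp ⊠ split ofA b q l hq) ⨟ Tm.contract (ob p) (ob q) (capTm b)

/-- The defining relations of orthogonal webs. -/
inductive Rel [CommRing 𝕜] (N : ℕ) : ∀ ⦃X Y : Ob⦄, Tm 𝕜 OGen X Y → Tm 𝕜 OGen X Y → Prop
  | typeA {X Y : Ob} {f g : Tm 𝕜 OGen X Y} : TypeARel ofA N f g → Rel N f g
  -- caps and cups of thickness `0` are not drawn
  | cap_zero : Rel N (capTm 0) (Tm.lUnit Ob.unit)
  | cup_zero : Rel N (cupTm 0) (Tm.lUnitInv Ob.unit)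
  -- the pivotal structure: caps and cups straighten, and diagrams can be rotated
  | zigzag_left (k : ℕ) :
      Rel N (Tm.rUnitInv _ ⨟ (Tm.id (ob k) ⊠ cupTm k) ⨟ Tm.assocInv _ _ _ ⨟
        (capTm k ⊠ Tm.id (ob k)) ⨟ Tm.lUnit _) (Tm.id (ob k))
  | zigzag_right (k : ℕ) :
      Rel N (Tm.lUnitInv _ ⨟ (cupTm k ⊠ Tm.id (ob k)) ⨟ Tm.assoc _ _ _ ⨟
        (Tm.id (ob k) ⊠ capTm k) ⨟ Tm.rUnit _) (Tm.id (ob k))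
  | turn_right (k l n : ℕ) (h : k + l = n) :
      Rel N (turnRight k l n h) (split ofA l k n ((Nat.add_comm l k).trans h))
  | turn_left (k l n : ℕ) (h : k + l = n) :
      Rel N (turnLeft k l n h) (split ofA l k n ((Nat.add_comm l k).trans h))
  | turn_cross (k l : ℕ) : Rel N (quarterTurn k l) (cross ofA k l)
  -- circle removal and lollipop relations
  | circle (k : ℕ) : Rel N (cupTm k ⨟ capTm k) (Tm.smul (N.choose k : 𝕜) (Tm.id Ob.unit))
  | lollipop_right (a l p n : ℕ) (ha : 0 < a) (hp : l + a = p) (hn : p + a = n) :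
      Rel N (split ofA p a n hn ⨟ (split ofA l a p hp ⊠ Tm.id (ob a)) ⨟ Tm.assoc _ _ _ ⨟
        (Tm.id (ob l) ⊠ capTm a) ⨟ Tm.rUnit _) (Tm.zero (ob n) (ob l))
  | lollipop_left (a l p n : ℕ) (ha : 0 < a) (hp : a + l = p) (hn : a + p = n) :
      Rel N (split ofA a p n hn ⨟ (Tm.id (ob a) ⊠ split ofA a l p hp) ⨟ Tm.assocInv _ _ _ ⨟
        (capTm a ⊠ Tm.id (ob l)) ⨟ Tm.lUnit _) (Tm.zero (ob n) (ob l))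
  -- `e^{(a)} f^{(b)} 1_{(k,l)} = ∑ₓ (k+l-N+a-b choose x) f^{(b-x)} e^{(a-x)} 1_{(k,l)}`, where
  -- diagrams with a strand of negative thickness are zero
  | higherEF (k l a b p q : ℕ) (hp : k + a = p + b) (hq : l + a = q + b) :
      Rel N
        (if H : b ≤ k ∧ b ≤ l then
          ladderF b k l (k - b) (l - b) (by omega) (by omega) ⨟
            ladderE a (k - b) (l - b) p q (by omega) (by omega)
        else Tm.zero (ob k ⊙ ob l) (ob p ⊙ ob q))
        (Tm.sumRange (min a b + 1) fun x =>
          if H : x ≤ a ∧ x ≤ b then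
            Tm.smul ((Ring.choose ((k : ℤ) + l - N + a - b) x : ℤ) : 𝕜)
              (ladderE (a - x) k l (k + (a - x)) (l + (a - x)) rfl (by omega) ⨟
                ladderF (b - x) (k + (a - x)) (l + (a - x)) p q (by omega) (by omega))
          else Tm.zero _ _)

end OGen

/-- The presentation of the orthogonal web category. -/
def orthoPresentation (𝕜 : Type) [CommRing 𝕜] (N : ℕ) : Presentation 𝕜 where
  Gen := OGen
  Rel := OGen.Rel N

/-- The orthogonal web category of `O(N)` over `𝕜`. -/
abbrev OrthoWeb (𝕜 : Type) [CommRing 𝕜] (N : ℕ) : Type := Presented (orthoPresentation 𝕜 N)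

/-- The braiding by crossings and the pivotal structure by caps and cups. -/
def orthoRibbon (𝕜 : Type) [CommRing 𝕜] (N : ℕ) : RibbonData (OrthoWeb 𝕜 N) :=
  diagrammaticData (orthoPresentation 𝕜 N) OGen.ofA OGen.capTm OGen.cupTm

/-! ### Sartori's orthogonal webs, dequantized -/

/-- Merges, splits and crossings, and only the thin cap and the thin cup. -/
inductive SGen : Ob → Ob → Type
  | typeA {X Y : Ob} (g : AGen X Y) : SGen X Y
  | cap : SGen (ob 1 ⊙ ob 1) Ob.unit
  | cup : SGen Ob.unit (ob 1 ⊙ ob 1)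

namespace SGen

variable {𝕜 : Type}

/-- Merges, splits and crossings as generators. -/
def ofA ⦃X Y : Ob⦄ (g : AGen X Y) : SGen X Y := SGen.typeA g

/-- The thin cap. -/
def capTm : Tm 𝕜 SGen (ob 1 ⊙ ob 1) Ob.unit := Tm.gen SGen.cap

/-- The thin cup. -/
def cupTm : Tm 𝕜 SGen Ob.unit (ob 1 ⊙ ob 1) := Tm.gen SGen.cup

/-- Merge two thin strands and split again. -/
def mergeSplit : Tm 𝕜 SGen (ob 1 ⊙ ob 1) (ob 1 ⊙ ob 1) :=
  merge ofA 1 1 2 rfl ⨟ split ofA 1 1 2 rfl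

/-- A strand of thickness `l` crosses from the left to the right of two thin strands. -/
def passTwo (l : ℕ) : Tm 𝕜 SGen (ob l ⊙ (ob 1 ⊙ ob 1)) ((ob 1 ⊙ ob 1) ⊙ ob l) :=
  Tm.assocInv _ _ _ ⨟ (cross ofA l 1 ⊠ Tm.id (ob 1)) ⨟ Tm.assoc _ _ _ ⨟
    (Tm.id (ob 1) ⊠ cross ofA l 1) ⨟ Tm.assocInv _ _ _

/-- The defining relations, all of them for the thin cap and cup. -/
inductive Rel [CommRing 𝕜] (N : ℕ) : ∀ ⦃X Y : Ob⦄, Tm 𝕜 SGen X Y → Tm 𝕜 SGen X Y → Prop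
  | typeA {X Y : Ob} {f g : Tm 𝕜 SGen X Y} : TypeARel ofA N f g → Rel N f g
  -- circle removal
  | circle : Rel N (cupTm ⨟ capTm) (Tm.smul (N : 𝕜) (Tm.id Ob.unit))
  -- bubble removal (the thin sideways digon)
  | bubble :
      Rel N (Tm.rUnitInv _ ⨟ (Tm.id (ob 1) ⊠ cupTm) ⨟ Tm.assocInv _ _ _ ⨟
        (mergeSplit ⊠ Tm.id (ob 1)) ⨟ Tm.assoc _ _ _ ⨟ (Tm.id (ob 1) ⊠ capTm) ⨟ Tm.rUnit _)
        (Tm.smul ((N : 𝕜) - 1) (Tm.id (ob 1)))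
  -- lollipop relations
  | lollipop_cap : Rel N (split ofA 1 1 2 rfl ⨟ capTm) (Tm.zero (ob 2) Ob.unit)
  | lollipop_cup : Rel N (cupTm ⨟ merge ofA 1 1 2 rfl) (Tm.zero Ob.unit (ob 2))
  -- strands slide through caps and cups
  | slide_cap (l : ℕ) :
      Rel N (passTwo l ⨟ (capTm ⊠ Tm.id (ob l)) ⨟ Tm.lUnit _)
        ((Tm.id (ob l) ⊠ capTm) ⨟ Tm.rUnit _)
  | slide_cup (l : ℕ) :
      Rel N (Tm.rUnitInv _ ⨟ (Tm.id (ob l) ⊠ cupTm) ⨟ passTwo l)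
        (Tm.lUnitInv _ ⨟ (cupTm ⊠ Tm.id (ob l)))
  -- merge-split sliding along nested caps and cups
  | mergeSplit_cap :
      Rel N ((mergeSplit ⊠ Tm.id (ob 1 ⊙ ob 1)) ⨟ Tm.contract (ob 1) (ob 1) capTm ⨟ capTm)
        ((Tm.id (ob 1 ⊙ ob 1) ⊠ mergeSplit) ⨟ Tm.contract (ob 1) (ob 1) capTm ⨟ capTm)
  | mergeSplit_cup :
      Rel N (cupTm ⨟ Tm.insert (ob 1) (ob 1) cupTm ⨟ (mergeSplit ⊠ Tm.id (ob 1 ⊙ ob 1)))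
        (cupTm ⨟ Tm.insert (ob 1) (ob 1) cupTm ⨟ (Tm.id (ob 1 ⊙ ob 1) ⊠ mergeSplit))

/-- Explode two strands of thickness `k` into thin ones and close these by nested thin caps. -/
def nestedCap : ∀ k : ℕ, Tm 𝕜 SGen (ob k ⊙ ob k) Ob.unit
  | 0 => Tm.lUnit Ob.unit
  | k + 1 => (split ofA 1 k (k + 1) (Nat.add_comm 1 k) ⊠ split ofA k 1 (k + 1) rfl) ⨟
      Tm.contract (ob 1) (ob 1) (nestedCap k) ⨟ capTm

/-- Nested thin cups, merged to two strands of thickness `k`. -/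
def nestedCup : ∀ k : ℕ, Tm 𝕜 SGen Ob.unit (ob k ⊙ ob k)
  | 0 => Tm.lUnitInv Ob.unit
  | k + 1 => cupTm ⨟ Tm.insert (ob 1) (ob 1) (nestedCup k) ⨟
      (merge ofA 1 k (k + 1) (Nat.add_comm 1 k) ⊠ merge ofA k 1 (k + 1) rfl)

/-- The thick cap, defined by explosion. -/
def thickCap [Field 𝕜] (k : ℕ) : Tm 𝕜 SGen (ob k ⊙ ob k) Ob.unit :=
  Tm.smul ((k.factorial : 𝕜)⁻¹) (nestedCap k)

/-- The thick cup, defined by explosion. -/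
def thickCup [Field 𝕜] (k : ℕ) : Tm 𝕜 SGen Ob.unit (ob k ⊙ ob k) :=
  Tm.smul ((k.factorial : 𝕜)⁻¹) (nestedCup k)

end SGen

/-- The presentation of Sartori's dequantized orthogonal web category. -/
def sartoriPresentation (𝕜 : Type) [CommRing 𝕜] (N : ℕ) : Presentation 𝕜 where
  Gen := SGen
  Rel := SGen.Rel N

/-- Sartori's dequantized orthogonal web category of `O(N)` over `𝕜`. -/
abbrev SartoriWeb (𝕜 : Type) [CommRing 𝕜] (N : ℕ) : Type := Presented (sartoriPresentation 𝕜 N)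

/-- The braiding by crossings and the pivotal structure by exploded caps and cups. -/
def sartoriRibbon (𝕜 : Type) [Field 𝕜] (N : ℕ) : RibbonData (SartoriWeb 𝕜 N) :=
  diagrammaticData (sartoriPresentation 𝕜 N) SGen.ofA SGen.thickCap SGen.thickCup

/-! ### The functors -/

/-- Generators of Sartori's webs are sent to the orthogonal webs of the same name. -/
def sameName (𝕜 : Type) [CommRing 𝕜] (N : ℕ) : ∀ ⦃X Y : Ob⦄,
    (sartoriPresentation 𝕜 N).Gen X Y → Tm 𝕜 (orthoPresentation 𝕜 N).Gen X Y
  | _, _, SGen.typeA g => Tm.gen (OGen.typeA g)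
  | _, _, SGen.cap => OGen.capTm 1
  | _, _, SGen.cup => OGen.cupTm 1

/-- Merges, splits and crossings are sent to the webs of the same name, thick caps and cups are
exploded. -/
def explosion (𝕜 : Type) [Field 𝕜] (N : ℕ) : ∀ ⦃X Y : Ob⦄,
    (orthoPresentation 𝕜 N).Gen X Y → Tm 𝕜 (sartoriPresentation 𝕜 N).Gen X Y
  | _, _, OGen.typeA g => Tm.gen (SGen.typeA g)
  | _, _, OGen.cap k => SGen.thickCap k
  | _, _, OGen.cup k => SGen.thickCup k

/-- The field `ℚ(√-1)`. -/
def QI : Type := IntermediateField.adjoin ℚ {Complex.I}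

noncomputable instance : Field QI :=
  inferInstanceAs (Field (IntermediateField.adjoin ℚ {Complex.I}))

end OrthogonalWebs

/-! Both categories are presented, so an assignment on generators gives a functor as soon as it
respects the defining relations, and two such functors are mutually inverse as soon as they are so
on generators. The proof therefore consists of deriving each list of relations from the other.
Characteristic zero enters because thick caps are divided by factorials and because webs that are
invertible up to a nonzero integer are cancelled.

Placing words strand by strand to the left of an object turns a word into a composite of
endofunctors and a web into a natural transformation. Associators and unitors then become
identities, and two terms agree in the presented category exactly when they act equally
(`mk_eq_iff`). The diagrammatic arguments take place for such actions: `WebAction`, `OrthoAction`,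
`PivotalAction`.

Type A: no relation says that merges and splits slide past crossings; the Schur relation forces it.
Merging three strands and splitting the result into two can be expanded in two ways by
associativity. By induction on the total thickness all summands agree except one, hence that one
agrees too, and it is the desired slide (`merge_natural`). Reversing diagrams handles splits. The
thin crossing is one minus merge-split, so it is an involution and satisfies Yang-Baxter; merges are
epimorphisms, by the digon relation, which carries both facts to thick strands (`x_x`, `x_x_x`).

From Sartori's relations to the orthogonal ones: merge-split sliding and the antisymmetry of
split-off thin strands show that a merge below an exploded cap can be traded for a split at its
other foot (`m_cap`, `cap_m`). The thin curl equals N - (N-1) = 1, and sliding a strand through a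
cup turns this into the zigzag. Thick zigzags, rotations, circles and lollipops follow by explosion.
For the relation between the ladders e and f, only the thin commutator is a diagrammatic statement
(`ladderE_ladderF`); the general one is the commutation of divided powers of raising and lowering
operators (`WeightOperators.f_e`).

Conversely, rotation gives `PivotalAction.m_cap` and the slides through caps and cups, and the
bubble relation is the e-f relation on the word 1 ⊗ 0. Rotation and the digon relation also give
that k + 1 times the cap of thickness k + 1 is its one-step explosion, so thick caps are exploded
ones and the two assignments are inverse to each other.

The ribbon structure reduces to identities for single strands (`RibbonRelations`). Since crossings
are involutive and natural, every curl straightens and the twist is the identity. -/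

namespace OrthogonalWebs

/-! ### Ladders: the index set of the Schur relation -/

/-- The ways to turn two strands of thickness `k`, `l` into two strands of thickness `r`, `s`:
strands of thickness `p` and `q` stay on their side, strands of thickness `a` and `b` change it. -/
structure Ladder (k l r s : ℕ) where
  p : ℕ
  a : ℕ
  b : ℕ
  q : ℕ
  hk : p + a = k
  hl : b + q = l
  hr : p + b = r
  hs : a + q = s

namespace Ladder

variable {k l r s : ℕ}

/-- A ladder has one degree of freedom: once `p` is known, the sums fix the other thicknesses. -/
theorem ext_of_p {i j : Ladder k l r s} (h : i.p = j.p) : i = j := by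
  rcases i with ⟨p, a, b, q, hk, hl, hr, hs⟩
  rcases j with ⟨p', a', b', q', hk', hl', hr', hs'⟩
  obtain rfl : p = p' := h
  obtain rfl : a = a' := by omega
  obtain rfl : b = b' := by omega
  obtain rfl : q = q' := by omega
  rfl

instance : Finite (Ladder k l r s) :=
  Finite.of_injective (fun i => (⟨i.p, by have := i.hk; omega⟩ : Fin (k + 1)))
    fun _ _ h => ext_of_p (by simpa using h)

noncomputable instance : Fintype (Ladder k l r s) := Fintype.ofFinite _

/-- The ladder read from top to bottom. -/
def flip : Ladder k l r s ≃ Ladder r s k l where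
  toFun i := ⟨i.p, i.b, i.a, i.q, i.hr, i.hs, i.hk, i.hl⟩
  invFun i := ⟨i.p, i.b, i.a, i.q, i.hr, i.hs, i.hk, i.hl⟩
  left_inv _ := rfl
  right_inv _ := rfl

end Ladder

-- Web actions and reversal of diagrams

universe v u

/-- An action of type A webs on a category: a strand of thickness `k` acts by the functor `F k`,
which places the strand to the left, and webs act by natural transformations. -/
structure WebAction (D : Type u) [Category.{v} D] [Preadditive D] where
  F : ℕ → D ⥤ D
  F_additive : ∀ k, (F k).Additive
  unit : ∀ Z, (F 0).obj Z ≅ Z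
  unit_nat : ∀ {Z Z' : D} (f : Z ⟶ Z'), (F 0).map f ≫ (unit Z').hom = (unit Z).hom ≫ f
  m : ∀ {k l n : ℕ}, k + l = n → ∀ Z, (F k).obj ((F l).obj Z) ⟶ (F n).obj Z
  s : ∀ {k l n : ℕ}, k + l = n → ∀ Z, (F n).obj Z ⟶ (F k).obj ((F l).obj Z)
  x : ∀ (k l : ℕ) (Z), (F k).obj ((F l).obj Z) ⟶ (F l).obj ((F k).obj Z)
  m_nat : ∀ {k l n : ℕ} (h : k + l = n) {Z Z' : D} (f : Z ⟶ Z'),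
    (F k).map ((F l).map f) ≫ m h Z' = m h Z ≫ (F n).map f
  s_nat : ∀ {k l n : ℕ} (h : k + l = n) {Z Z' : D} (f : Z ⟶ Z'),
    (F n).map f ≫ s h Z' = s h Z ≫ (F k).map ((F l).map f)
  x_nat : ∀ (k l : ℕ) {Z Z' : D} (f : Z ⟶ Z'),
    (F k).map ((F l).map f) ≫ x k l Z' = x k l Z ≫ (F l).map ((F k).map f)
  m_zero_left : ∀ {l : ℕ} (h : 0 + l = l) Z, m h Z = (unit ((F l).obj Z)).hom
  m_zero_right : ∀ {k : ℕ} (h : k + 0 = k) Z, m h Z = (F k).map (unit Z).hom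
  s_zero_left : ∀ {l : ℕ} (h : 0 + l = l) Z, s h Z = (unit ((F l).obj Z)).inv
  s_zero_right : ∀ {k : ℕ} (h : k + 0 = k) Z, s h Z = (F k).map (unit Z).inv
  x_zero_left : ∀ l Z, x 0 l Z = (unit ((F l).obj Z)).hom ≫ (F l).map (unit Z).inv
  x_zero_right : ∀ k Z, x k 0 Z = (F k).map (unit Z).hom ≫ (unit ((F k).obj Z)).inv
  m_assoc : ∀ {k l m' p q n : ℕ} (hp : k + l = p) (hq : l + m' = q) (h₁ : p + m' = n)
    (h₂ : k + q = n) (Z), m hp ((F m').obj Z) ≫ m h₁ Z = (F k).map (m hq Z) ≫ m h₂ Z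
  s_coassoc : ∀ {k l m' p q n : ℕ} (hp : k + l = p) (hq : l + m' = q) (h₁ : p + m' = n)
    (h₂ : k + q = n) (Z), s h₁ Z ≫ s hp ((F m').obj Z) = s h₂ Z ≫ (F k).map (s hq Z)
  digon : ∀ {k l n : ℕ} (h : k + l = n) (Z), s h Z ≫ m h Z = n.choose k • 𝟙 _
  schur : ∀ {k l r t n : ℕ} (h : k + l = n) (h' : r + t = n) (Z), m h Z ≫ s h' Z =
    ∑ i : Ladder k l r t, (-1 : ℤ) ^ (i.a * i.b) • ((F k).map (s i.hl Z) ≫ s i.hk _ ≫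
      (F i.p).map (x i.a i.b _) ≫ (F i.p).map ((F i.b).map (m i.hs Z)) ≫ m i.hr _)

namespace WebAction

variable {D : Type u} [Category.{v} D] [Preadditive D] (A : WebAction D)

instance (k : ℕ) : (A.F k).Additive := A.F_additive k

/-- The web action read from top to bottom. -/
def op : WebAction Dᵒᵖ where
  F k := (A.F k).op
  F_additive k := inferInstance
  unit Z := (A.unit Z.unop).symm.op
  unit_nat f := Quiver.Hom.unop_inj (by
    have h := A.unit_nat f.unop
    simp only [Iso.op_hom, Iso.symm_hom, unop_comp, Functor.op_map, Quiver.Hom.unop_op]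
    rw [Iso.inv_comp_eq, ← Category.assoc, Iso.eq_comp_inv, h])
  m h Z := (A.s h Z.unop).op
  s h Z := (A.m h Z.unop).op
  x k l Z := (A.x l k Z.unop).op
  m_nat h _ _ f := Quiver.Hom.unop_inj (A.s_nat h f.unop).symm
  s_nat h _ _ f := Quiver.Hom.unop_inj (A.m_nat h f.unop).symm
  x_nat k l _ _ f := Quiver.Hom.unop_inj (A.x_nat l k f.unop).symm
  m_zero_left h Z := Quiver.Hom.unop_inj (A.s_zero_left h Z.unop)
  m_zero_right h Z := Quiver.Hom.unop_inj (A.s_zero_right h Z.unop)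
  s_zero_left h Z := Quiver.Hom.unop_inj (A.m_zero_left h Z.unop)
  s_zero_right h Z := Quiver.Hom.unop_inj (A.m_zero_right h Z.unop)
  x_zero_left l Z := Quiver.Hom.unop_inj (A.x_zero_right l Z.unop)
  x_zero_right l Z := Quiver.Hom.unop_inj (A.x_zero_left l Z.unop)
  m_assoc hp hq h₁ h₂ Z := Quiver.Hom.unop_inj (A.s_coassoc hp hq h₁ h₂ Z.unop)
  s_coassoc hp hq h₁ h₂ Z := Quiver.Hom.unop_inj (A.m_assoc hp hq h₁ h₂ Z.unop)
  digon h Z := Quiver.Hom.unop_inj (A.digon h Z.unop)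
  schur h h' Z := Quiver.Hom.unop_inj (by
    refine (A.schur h' h Z.unop).trans ?_
    -- Reading a ladder upside down exchanges `a` and `b`, on whose product alone the sign depends.
    -- The two splits, and the two merges, then occur in the other order, which the interchange laws
    -- `e₁` and `e₂` repair.
    rw [unop_sum, ← Equiv.sum_comp Ladder.flip]
    refine Finset.sum_congr rfl fun i _ => ?_
    have e₁ := A.s_nat i.hr (A.s i.hs Z.unop)
    have e₂ := A.m_nat i.hk (A.m i.hl Z.unop)
    change (-1 : ℤ) ^ (i.b * i.a) • (((A.F _).map (A.s i.hs _) ≫ A.s i.hr _ ≫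
      (A.F i.p).map (A.x i.b i.a _) ≫ (A.F i.p).map ((A.F i.a).map (A.m i.hl _)) ≫
        A.m i.hk _)) = ((-1 : ℤ) ^ (i.a * i.b) • _ : _ ⟶ _).unop
    rw [unop_zsmul, mul_comm i.b, e₂, ← Category.assoc, e₁]
    simp)

/-! Interchange laws and associativity inside a larger web. -/

theorem m_nat_assoc {k l n : ℕ} (h : k + l = n) {Z Z' : D} (f : Z ⟶ Z') {W : D} (t : _ ⟶ W) :
    (A.F k).map ((A.F l).map f) ≫ A.m h Z' ≫ t = A.m h Z ≫ (A.F n).map f ≫ t := by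
  rw [← Category.assoc, A.m_nat, Category.assoc]

theorem m_nat₁ {k l n : ℕ} (h : k + l = n) {Z Z' : D} (f : Z ⟶ Z') (G : D ⥤ D) :
    G.map ((A.F k).map ((A.F l).map f)) ≫ G.map (A.m h Z') =
      G.map (A.m h Z) ≫ G.map ((A.F n).map f) := by
  simp only [← Functor.map_comp, A.m_nat]

theorem m_nat₁_assoc {k l n : ℕ} (h : k + l = n) {Z Z' : D} (f : Z ⟶ Z') (G : D ⥤ D) {W : D}
    (t : _ ⟶ W) :
    G.map ((A.F k).map ((A.F l).map f)) ≫ G.map (A.m h Z') ≫ t =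
      G.map (A.m h Z) ≫ G.map ((A.F n).map f) ≫ t := by
  rw [← Category.assoc, m_nat₁, Category.assoc]

theorem m_nat₂ {k l n : ℕ} (h : k + l = n) {Z Z' : D} (f : Z ⟶ Z') (G : D ⥤ D) (H : D ⥤ D) :
    H.map (G.map ((A.F k).map ((A.F l).map f))) ≫ H.map (G.map (A.m h Z')) =
      H.map (G.map (A.m h Z)) ≫ H.map (G.map ((A.F n).map f)) := by
  simp only [← Functor.map_comp, A.m_nat]

theorem m_nat₂_assoc {k l n : ℕ} (h : k + l = n) {Z Z' : D} (f : Z ⟶ Z') (G : D ⥤ D) (H : D ⥤ D)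
    {W : D} (t : _ ⟶ W) :
    H.map (G.map ((A.F k).map ((A.F l).map f))) ≫ H.map (G.map (A.m h Z')) ≫ t =
      H.map (G.map (A.m h Z)) ≫ H.map (G.map ((A.F n).map f)) ≫ t := by
  rw [← Category.assoc, m_nat₂, Category.assoc]

theorem s_nat_assoc {k l n : ℕ} (h : k + l = n) {Z Z' : D} (f : Z ⟶ Z') {W : D} (t : _ ⟶ W) :
    (A.F n).map f ≫ A.s h Z' ≫ t = A.s h Z ≫ (A.F k).map ((A.F l).map f) ≫ t := by
  rw [← Category.assoc, A.s_nat, Category.assoc]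

theorem s_nat₁ {k l n : ℕ} (h : k + l = n) {Z Z' : D} (f : Z ⟶ Z') (G : D ⥤ D) :
    G.map ((A.F n).map f) ≫ G.map (A.s h Z') =
      G.map (A.s h Z) ≫ G.map ((A.F k).map ((A.F l).map f)) := by
  simp only [← Functor.map_comp, A.s_nat]

theorem s_nat₁_assoc {k l n : ℕ} (h : k + l = n) {Z Z' : D} (f : Z ⟶ Z') (G : D ⥤ D) {W : D}
    (t : _ ⟶ W) :
    G.map ((A.F n).map f) ≫ G.map (A.s h Z') ≫ t =
      G.map (A.s h Z) ≫ G.map ((A.F k).map ((A.F l).map f)) ≫ t := by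
  rw [← Category.assoc, s_nat₁, Category.assoc]

theorem s_nat₂ {k l n : ℕ} (h : k + l = n) {Z Z' : D} (f : Z ⟶ Z') (G : D ⥤ D) (H : D ⥤ D) :
    H.map (G.map ((A.F n).map f)) ≫ H.map (G.map (A.s h Z')) =
      H.map (G.map (A.s h Z)) ≫ H.map (G.map ((A.F k).map ((A.F l).map f))) := by
  simp only [← Functor.map_comp, A.s_nat]

theorem s_nat₂_assoc {k l n : ℕ} (h : k + l = n) {Z Z' : D} (f : Z ⟶ Z') (G : D ⥤ D) (H : D ⥤ D)
    {W : D} (t : _ ⟶ W) :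
    H.map (G.map ((A.F n).map f)) ≫ H.map (G.map (A.s h Z')) ≫ t =
      H.map (G.map (A.s h Z)) ≫ H.map (G.map ((A.F k).map ((A.F l).map f))) ≫ t := by
  rw [← Category.assoc, s_nat₂, Category.assoc]

theorem x_nat_assoc (k l : ℕ) {Z Z' : D} (f : Z ⟶ Z') {W : D} (t : _ ⟶ W) :
    (A.F k).map ((A.F l).map f) ≫ A.x k l Z' ≫ t = A.x k l Z ≫ (A.F l).map ((A.F k).map f) ≫ t := by
  rw [← Category.assoc, A.x_nat, Category.assoc]

theorem x_nat₁ (k l : ℕ) {Z Z' : D} (f : Z ⟶ Z') (G : D ⥤ D) :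
    G.map ((A.F k).map ((A.F l).map f)) ≫ G.map (A.x k l Z') =
      G.map (A.x k l Z) ≫ G.map ((A.F l).map ((A.F k).map f)) := by
  simp only [← Functor.map_comp, A.x_nat]

theorem x_nat₁_assoc (k l : ℕ) {Z Z' : D} (f : Z ⟶ Z') (G : D ⥤ D) {W : D} (t : _ ⟶ W) :
    G.map ((A.F k).map ((A.F l).map f)) ≫ G.map (A.x k l Z') ≫ t =
      G.map (A.x k l Z) ≫ G.map ((A.F l).map ((A.F k).map f)) ≫ t := by
  rw [← Category.assoc, x_nat₁, Category.assoc]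

theorem m_assoc_assoc {k l m' p q n : ℕ} (hp : k + l = p) (hq : l + m' = q) (h₁ : p + m' = n)
    (h₂ : k + q = n) (Z : D) {W : D} (t : _ ⟶ W) :
    A.m hp ((A.F m').obj Z) ≫ A.m h₁ Z ≫ t = (A.F k).map (A.m hq Z) ≫ A.m h₂ Z ≫ t := by
  rw [← Category.assoc, A.m_assoc hp hq h₁ h₂, Category.assoc]

theorem s_coassoc_assoc {k l m' p q n : ℕ} (hp : k + l = p) (hq : l + m' = q) (h₁ : p + m' = n)
    (h₂ : k + q = n) (Z : D) {W : D} (t : _ ⟶ W) :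
    A.s h₁ Z ≫ A.s hp ((A.F m').obj Z) ≫ t = A.s h₂ Z ≫ (A.F k).map (A.s hq Z) ≫ t := by
  rw [← Category.assoc, A.s_coassoc hp hq h₁ h₂, Category.assoc]

theorem s_coassoc₁ {k l m' p q n : ℕ} (hp : k + l = p) (hq : l + m' = q) (h₁ : p + m' = n)
    (h₂ : k + q = n) (Z : D) (G : D ⥤ D) :
    G.map (A.s h₁ Z) ≫ G.map (A.s hp ((A.F m').obj Z)) =
      G.map (A.s h₂ Z) ≫ G.map ((A.F k).map (A.s hq Z)) := by
  simp only [← Functor.map_comp, A.s_coassoc hp hq h₁ h₂]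

theorem s_coassoc₁_assoc {k l m' p q n : ℕ} (hp : k + l = p) (hq : l + m' = q) (h₁ : p + m' = n)
    (h₂ : k + q = n) (Z : D) (G : D ⥤ D) {W : D} (t : _ ⟶ W) :
    G.map (A.s h₁ Z) ≫ G.map (A.s hp ((A.F m').obj Z)) ≫ t =
      G.map (A.s h₂ Z) ≫ G.map ((A.F k).map (A.s hq Z)) ≫ t := by
  rw [← Category.assoc, s_coassoc₁, Category.assoc]

end WebAction

/-! ### Grids: two Schur relations applied in a row -/

/-- The ways to turn three strands of thickness `r`, `n`, `l` into two strands of thickness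
`t`, `w`. -/
structure Grid (r n l t w : ℕ) where
  p : ℕ
  a : ℕ
  n₁ : ℕ
  n₂ : ℕ
  l₁ : ℕ
  l₂ : ℕ
  hr : p + a = r
  hn : n₁ + n₂ = n
  hl : l₁ + l₂ = l
  ht : p + (n₁ + l₁) = t
  hw : a + (n₂ + l₂) = w

namespace Grid

variable {r n l t w : ℕ}

/-- Grids are pairs of ladders, the second of which ends on the last two strands. -/
def equivRight {q : ℕ} (hq : n + l = q) :
    Grid r n l t w ≃ Σ i : Ladder r q t w, Ladder n l i.b i.q where
  toFun g := ⟨⟨g.p, g.a, g.n₁ + g.l₁, g.n₂ + g.l₂, g.hr, by have := g.hn; have := g.hl; omega,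
    g.ht, g.hw⟩, ⟨g.n₁, g.n₂, g.l₁, g.l₂, g.hn, g.hl, rfl, rfl⟩⟩
  invFun i := ⟨i.1.p, i.1.a, i.2.p, i.2.a, i.2.b, i.2.q, i.1.hk, i.2.hk, i.2.hl,
    by rw [i.2.hr, i.1.hr], by rw [i.2.hs, i.1.hs]⟩
  left_inv _ := rfl
  right_inv := by
    rintro ⟨⟨p, a, b, q, h₁, h₂, h₃, h₄⟩, ⟨p', a', b', q', h₁', h₂', h₃', h₄'⟩⟩
    dsimp only at h₃' h₄'
    subst h₃' h₄'
    rfl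

/-- Grids are pairs of ladders, the second of which ends on the first two strands. -/
def equivLeft {q : ℕ} (hq : r + n = q) :
    Grid r n l t w ≃ Σ i : Ladder q l t w, Ladder r n i.p i.a where
  toFun g := ⟨⟨g.p + g.n₁, g.a + g.n₂, g.l₁, g.l₂, by have := g.hn; have := g.hr; omega, g.hl,
    by have := g.ht; omega, by have := g.hw; omega⟩, ⟨g.p, g.a, g.n₁, g.n₂, g.hr, g.hn, rfl, rfl⟩⟩
  invFun i := ⟨i.2.p, i.2.a, i.2.b, i.2.q, i.1.b, i.1.q, i.2.hk, i.2.hl, i.1.hl,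
    by rw [← add_assoc, i.2.hr, i.1.hr], by rw [← add_assoc, i.2.hs, i.1.hs]⟩
  left_inv _ := rfl
  right_inv := by
    rintro ⟨⟨p, a, b, q, h₁, h₂, h₃, h₄⟩, ⟨p', a', b', q', h₁', h₂', h₃', h₄'⟩⟩
    dsimp only at h₃' h₄'
    subst h₃' h₄'
    rfl

theorem ht' (g : Grid r n l t w) : g.p + g.n₁ + g.l₁ = t := (Nat.add_assoc _ _ _).trans g.ht

theorem hw' (g : Grid r n l t w) : g.a + g.n₂ + g.l₂ = w := (Nat.add_assoc _ _ _).trans g.hw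

noncomputable instance : Fintype (Grid r n l t w) := Fintype.ofEquiv _ (equivRight rfl).symm

/-- The sign of a grid. -/
def sign (g : Grid r n l t w) : ℤ := (-1) ^ (g.a * (g.n₁ + g.l₁)) * (-1) ^ (g.n₂ * g.l₁)

/-- The exponent is `a n₁ + a l₁ + n₂ l₁`, one product for each crossing of the fully resolved grid;
it does not depend on which merge is expanded first. -/
theorem sign_eq (g : Grid r n l t w) :
    g.sign = (-1) ^ ((g.a + g.n₂) * g.l₁) * (-1) ^ (g.a * g.n₁) := by
  rw [sign, ← pow_add, ← pow_add]
  congr 1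
  ring

end Grid

/-! ### Merges and splits slide past crossings -/

namespace WebAction

variable {D : Type u} [Category.{v} D] [Preadditive D] (A : WebAction D)

/-- A merge of strands of thickness `k`, `l` slides over a strand of thickness `r` to its left. -/
def MergeRight (k l r : ℕ) : Prop := ∀ {p : ℕ} (h : k + l = p) (Z : D),
  (A.F r).map (A.m h Z) ≫ A.x r p Z = A.x r k _ ≫ (A.F k).map (A.x r l Z) ≫ A.m h _

/-- A merge of strands of thickness `k`, `l` slides under a strand of thickness `r` to its
right. -/
def MergeLeft (k l r : ℕ) : Prop := ∀ {p : ℕ} (h : k + l = p) (Z : D),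
  A.m h _ ≫ A.x p r Z = (A.F k).map (A.x l r Z) ≫ A.x k r _ ≫ (A.F r).map (A.m h Z)

section Grid

variable {r n l t w : ℕ} (g : Grid r n l t w) (Z : D)

/-- The first strand, once split, meets the middle one merged with the last one through `φ`. -/
def gridRight (φ : (A.F g.a).obj ((A.F g.n₁).obj ((A.F g.l₁).obj ((A.F g.n₂).obj
      ((A.F g.l₂).obj Z)))) ⟶ (A.F (g.n₁ + g.l₁)).obj ((A.F g.a).obj ((A.F g.n₂).obj
      ((A.F g.l₂).obj Z)))) :
    (A.F r).obj ((A.F n).obj ((A.F l).obj Z)) ⟶ (A.F t).obj ((A.F w).obj Z) :=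
  (A.F r).map ((A.F n).map (A.s g.hl Z)) ≫ (A.F r).map (A.s g.hn _) ≫ A.s g.hr _ ≫
    (A.F g.p).map ((A.F g.a).map ((A.F g.n₁).map (A.x g.n₂ g.l₁ _))) ≫ (A.F g.p).map φ ≫
    (A.F g.p).map ((A.F (g.n₁ + g.l₁)).map ((A.F g.a).map (A.m rfl Z) ≫ A.m g.hw Z)) ≫
    A.m g.ht _

/-- The last strand, once split, meets the middle one merged with the first one through `ψ`. -/
def gridLeft (ψ : (A.F g.a).obj ((A.F g.n₂).obj ((A.F g.l₁).obj ((A.F g.l₂).obj Z))) ⟶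
      (A.F g.l₁).obj ((A.F (g.a + g.n₂)).obj ((A.F g.l₂).obj Z))) :
    (A.F r).obj ((A.F n).obj ((A.F l).obj Z)) ⟶ (A.F t).obj ((A.F w).obj Z) :=
  (A.F r).map ((A.F n).map (A.s g.hl Z)) ≫ (A.F r).map (A.s g.hn _) ≫ A.s g.hr _ ≫
    (A.F g.p).map (A.x g.a g.n₁ _) ≫ (A.F g.p).map ((A.F g.n₁).map ψ) ≫
    (A.F g.p).map ((A.F g.n₁).map ((A.F g.l₁).map (A.m g.hw' Z))) ≫ A.m rfl _ ≫ A.m g.ht' _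

/-- Once the remaining merge has been slid past its crossing on either side, both webs contain the
same crossings, of `a` with `n₁`, of `a` with `l₁` and of `n₂` with `l₁`. They differ by interchange
and associativity of merges only. -/
theorem gridRight_eq_gridLeft :
    A.gridRight g Z (A.x g.a g.n₁ _ ≫ (A.F g.n₁).map (A.x g.a g.l₁ _) ≫ A.m rfl _) =
      A.gridLeft g Z ((A.F g.a).map (A.x g.n₂ g.l₁ _) ≫ A.x g.a g.l₁ _ ≫
        (A.F g.l₁).map (A.m rfl _)) := by
  have e₁ := A.m_assoc (rfl : g.p + g.n₁ = _) (rfl : g.n₁ + g.l₁ = _)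
    g.ht' g.ht ((A.F w).obj Z)
  have e₂ := A.m_assoc (rfl : g.a + g.n₂ = _) (rfl : g.n₂ + g.l₂ = _)
    g.hw' g.hw Z
  unfold gridRight gridLeft
  rw [e₁]
  simp only [Functor.map_comp, Category.assoc, A.x_nat₁_assoc]
  simp only [← Functor.map_comp_assoc, ← Functor.map_comp, ← A.m_nat, ← e₂]

/-- The Schur relation for the outer merge creates a split directly after the merge of `n` and `l`,
so it applies a second time; the resulting pairs of ladders are the grids. A merge of `n₁` and `l₁`
below a crossing with `a` is left over. -/
theorem expandRight {q j : ℕ} (hq : n + l = q) (h : r + q = j) (h' : t + w = j) :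
    (A.F r).map (A.m hq Z) ≫ A.m h Z ≫ A.s h' Z = ∑ g : Grid r n l t w,
      g.sign • A.gridRight g Z ((A.F g.a).map (A.m rfl _) ≫ A.x g.a (g.n₁ + g.l₁) _) := by
  rw [A.schur, Preadditive.comp_sum, ← Equiv.sum_comp (Grid.equivRight hq).symm,
    Fintype.sum_sigma]
  refine Finset.sum_congr rfl fun i _ => ?_
  rw [Preadditive.comp_zsmul, ← Functor.map_comp_assoc, A.schur, Functor.map_sum,
    Preadditive.sum_comp, Finset.smul_sum]
  refine Finset.sum_congr rfl fun i' _ => ?_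
  rcases i with ⟨p, a, b, q, h₁, h₂, h₃, h₄⟩
  rcases i' with ⟨p', a', b', q', h₁', h₂', h₃', h₄'⟩
  dsimp only at h₃' h₄'
  subst h₃' h₄'
  simp only [Functor.map_zsmul, Preadditive.zsmul_comp, smul_smul]
  congr 1
  change _ = A.gridRight ⟨p, a, p', a', b', q', h₁, h₁', h₂', h₃, h₄⟩ Z
    ((A.F a).map (A.m rfl _) ≫ A.x a (p' + b') _)
  unfold gridRight
  dsimp only
  simp only [Functor.map_comp, Category.assoc, A.s_nat_assoc, A.s_nat₂_assoc, A.x_nat₁_assoc,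
    A.m_nat₂_assoc]

/-- The mirror image of `expandRight`; here a merge of `a` and `n₂` is left over below a crossing
with `l₁`. -/
theorem expandLeft {q j : ℕ} (hq : r + n = q) (h : q + l = j) (h' : t + w = j) :
    A.m hq _ ≫ A.m h Z ≫ A.s h' Z = ∑ g : Grid r n l t w,
      g.sign • A.gridLeft g Z (A.m rfl _ ≫ A.x (g.a + g.n₂) g.l₁ _) := by
  rw [A.schur, Preadditive.comp_sum, ← Equiv.sum_comp (Grid.equivLeft hq).symm,
    Fintype.sum_sigma]
  refine Finset.sum_congr rfl fun i _ => ?_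
  rw [Preadditive.comp_zsmul, ← A.m_nat_assoc, ← Category.assoc (A.m hq _), A.schur,
    Preadditive.sum_comp, Preadditive.comp_sum, Finset.smul_sum]
  refine Finset.sum_congr rfl fun i' _ => ?_
  rcases i with ⟨p, a, b, q, h₁, h₂, h₃, h₄⟩
  rcases i' with ⟨p', a', b', q', h₁', h₂', h₃', h₄'⟩
  dsimp only at h₃' h₄'
  subst h₃' h₄'
  simp only [Preadditive.zsmul_comp, Preadditive.comp_zsmul, smul_smul,
    Grid.sign_eq]
  congr 1
  change _ = A.gridLeft ⟨p', a', b', q', b, q, h₁', h₂', h₂, by omega, by omega⟩ Z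
    (A.m rfl _ ≫ A.x (a' + q') b _)
  unfold gridLeft
  dsimp only
  simp only [Functor.map_comp, Category.assoc, A.m_nat_assoc]

end Grid

theorem unit_nat_assoc {Z Z' W : D} (f : Z ⟶ Z') (t : Z' ⟶ W) :
    (A.F 0).map f ≫ (A.unit Z').hom ≫ t = (A.unit Z).hom ≫ f ≫ t := by
  rw [← Category.assoc, A.unit_nat, Category.assoc]

theorem unit_inv_nat {Z Z' : D} (f : Z ⟶ Z') :
    f ≫ (A.unit Z').inv = (A.unit Z).inv ≫ (A.F 0).map f := by
  rw [Iso.eq_inv_comp, ← Category.assoc, Iso.comp_inv_eq, A.unit_nat]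

theorem F_zero_map_injective {Z Z' : D} {f g : Z ⟶ Z'} (h : (A.F 0).map f = (A.F 0).map g) :
    f = g := by
  rw [← cancel_epi (A.unit Z).hom, ← A.unit_nat, ← A.unit_nat, h]

theorem isIso_m_left {k l n : ℕ} (h : k + l = n) (hk : k = 0) (Z : D) : IsIso (A.m h Z) := by
  subst hk
  obtain rfl : l = n := by omega
  rw [A.m_zero_left]
  infer_instance

theorem isIso_m_right {k l n : ℕ} (h : k + l = n) (hl : l = 0) (Z : D) : IsIso (A.m h Z) := by
  subst hl
  obtain rfl : k = n := by omega
  rw [A.m_zero_right]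
  infer_instance

theorem isIso_s_left {k l n : ℕ} (h : k + l = n) (hk : k = 0) (Z : D) : IsIso (A.s h Z) := by
  subst hk
  obtain rfl : l = n := by omega
  rw [A.s_zero_left]
  infer_instance

theorem isIso_s_right {k l n : ℕ} (h : k + l = n) (hl : l = 0) (Z : D) : IsIso (A.s h Z) := by
  subst hl
  obtain rfl : k = n := by omega
  rw [A.s_zero_right]
  infer_instance

instance (k : ℕ) (Z : D) : IsIso (A.x k 0 Z) := by
  rw [A.x_zero_right]
  infer_instance

instance (l : ℕ) (Z : D) : IsIso (A.x 0 l Z) := by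
  rw [A.x_zero_left]
  infer_instance

/-- Together with `mergeLeft_zero` this covers the grids in which one part of the middle strand has
thickness zero. Their slide may have the full thickness, where the induction hypothesis of
`merge_natural` says nothing. -/
theorem mergeRight_zero (l r : ℕ) : A.MergeRight 0 l r := by
  intro p h Z
  obtain rfl : l = p := by omega
  rw [A.m_zero_left, A.m_zero_left, A.x_zero_right, A.unit_nat, Category.assoc,
    Iso.inv_hom_id_assoc]

theorem mergeLeft_zero (k r : ℕ) : A.MergeLeft k 0 r := by
  intro p h Z
  obtain rfl : k = p := by omega
  rw [A.m_zero_right, A.m_zero_right, A.x_zero_left, Functor.map_comp, Category.assoc,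
    A.x_nat_assoc, ← Functor.map_comp, ← Functor.map_comp, Iso.inv_hom_id]
  simp

theorem eq_of_sum_eq_sum {ι M : Type*} [Fintype ι] [AddCommGroup M] {f g : ι → M} (i : ι)
    (h : ∑ j, f j = ∑ j, g j) (hne : ∀ j, j ≠ i → f j = g j) : f i = g i := by
  classical
  rw [← Finset.add_sum_erase _ _ (Finset.mem_univ i),
    ← Finset.add_sum_erase _ g (Finset.mem_univ i)] at h
  rw [Finset.sum_congr rfl fun j hj => hne j (Finset.ne_of_mem_erase hj)] at h
  exact add_right_cancel h

theorem _root_.OrthogonalWebs.Grid.sign_smul_injective {r n l t w : ℕ} (g : Grid r n l t w)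
    {M : Type*} [AddCommGroup M]
    {f f' : M} (h : g.sign • f = g.sign • f') : f = f' := by
  have hu : g.sign * g.sign = 1 := by
    simp [Grid.sign, ← pow_add]
  rw [← one_smul ℤ f, ← one_smul ℤ f', ← hu, mul_smul, mul_smul, h]

/-- If `p`, `n₂` and `l₂` vanish, every split and merge surrounding `φ`, and the crossing of `n₂`
with `l₁`, involves a strand of thickness zero and is an isomorphism. What remains is `F 0` applied
to `φ`, and `F 0` is faithful. -/
theorem gridRight_injective {r n l t w : ℕ} (g : Grid r n l t w) (hp : g.p = 0) (hn : g.n₂ = 0)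
    (hl : g.l₂ = 0) {Z : D} {φ ψ} (h : A.gridRight g Z φ = A.gridRight g Z ψ) : φ = ψ := by
  rcases g with ⟨p, a, n₁, n₂, l₁, l₂, h₁, h₂, h₃, h₄, h₅⟩
  dsimp only at hp hn hl
  subst hp hn hl
  unfold gridRight at h
  dsimp only at h φ ψ
  have i₁ := A.isIso_s_right h₃ rfl Z
  have i₂ := A.isIso_s_right h₂ rfl ((A.F l₁).obj ((A.F 0).obj Z))
  have i₃ := A.isIso_s_left h₁ rfl
    ((A.F n₁).obj ((A.F 0).obj ((A.F l₁).obj ((A.F 0).obj Z))))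
  have i₄ := A.isIso_m_left (rfl : 0 + 0 = _) rfl Z
  have i₅ := A.isIso_m_right h₅ rfl Z
  have i₆ := A.isIso_m_left h₄ rfl ((A.F w).obj Z)
  rw [cancel_epi, cancel_epi, cancel_epi, cancel_epi, cancel_mono] at h
  exact A.F_zero_map_injective h

theorem gridLeft_injective {r n l t w : ℕ} (g : Grid r n l t w) (hp : g.p = 0) (hn : g.n₁ = 0)
    (hl : g.l₂ = 0) {Z : D} {φ ψ} (h : A.gridLeft g Z φ = A.gridLeft g Z ψ) : φ = ψ := by
  rcases g with ⟨p, a, n₁, n₂, l₁, l₂, h₁, h₂, h₃, h₄, h₅⟩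
  dsimp only at hp hn hl
  subst hp hn hl
  unfold gridLeft at h
  dsimp only at h φ ψ
  have i₁ := A.isIso_s_right h₃ rfl Z
  have i₂ := A.isIso_s_left h₂ rfl ((A.F l₁).obj ((A.F 0).obj Z))
  have i₃ := A.isIso_s_left h₁ rfl
    ((A.F 0).obj ((A.F n₂).obj ((A.F l₁).obj ((A.F 0).obj Z))))
  have i₄ := A.isIso_m_left (rfl : 0 + 0 = _) rfl ((A.F l₁).obj ((A.F w).obj Z))
  have i₅ := A.isIso_m_right (Grid.hw' ⟨0, a, 0, n₂, l₁, 0, h₁, h₂, h₃, h₄, h₅⟩) rfl Z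
  have i₆ := A.isIso_m_left (Grid.ht' ⟨0, a, 0, n₂, l₁, 0, h₁, h₂, h₃, h₄, h₅⟩) rfl
    ((A.F w).obj Z)
  rw [cancel_epi, cancel_epi, cancel_epi, cancel_epi, cancel_mono] at h
  exact A.F_zero_map_injective (A.F_zero_map_injective h)

/-- The extremal grid carries two strands of thickness zero on its right, so the comparison of
summands yields the slide only in front of `F 0` applied twice. Naturality along the unit
isomorphisms removes them. -/
theorem mergeRight_of_F_zero {k l r : ℕ} (h : ∀ Z : D,
    (A.F r).map (A.m rfl ((A.F 0).obj ((A.F 0).obj Z))) ≫ A.x r (k + l) _ =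
      A.x r k _ ≫ (A.F k).map (A.x r l _) ≫ A.m rfl _) : A.MergeRight k l r := by
  rintro _ rfl Z
  rw [← cancel_mono ((A.F _).map ((A.F r).map ((A.unit Z).inv ≫ (A.unit _).inv))),
    Category.assoc, ← A.x_nat, ← Functor.map_comp_assoc, ← A.m_nat, Functor.map_comp_assoc, h]
  simp only [Category.assoc, ← A.m_nat, ← A.x_nat_assoc, ← A.x_nat₁_assoc]

theorem mergeLeft_of_F_zero {k l r : ℕ} (h : ∀ Z : D,
    A.m rfl _ ≫ A.x (k + l) r ((A.F 0).obj Z) =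
      (A.F k).map (A.x l r _) ≫ A.x k r _ ≫ (A.F r).map (A.m rfl _)) : A.MergeLeft k l r := by
  rintro _ rfl Z
  rw [← cancel_mono ((A.F r).map ((A.F _).map (A.unit Z).inv)), Category.assoc, ← A.x_nat,
    ← A.m_nat_assoc, h]
  simp only [Category.assoc, ← Functor.map_comp, ← A.m_nat]
  simp only [Functor.map_comp, ← A.x_nat_assoc, ← A.x_nat₁_assoc]

/-- Both slides are proved together by induction on the total thickness of the three strands,
because each of the two expansions of merge-merge-split needs the slide of one kind to be brought
into the common form of `gridRight_eq_gridLeft`. All summands except one are then known to agree. -/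
theorem merge_natural (j : ℕ) : ∀ r n l : ℕ, r + n + l = j →
    A.MergeRight n l r ∧ A.MergeLeft r n l := by
  induction j using Nat.strong_induction_on with
  | _ j ih =>
  intro r n l hj
  have hR : ∀ (n' l' r' : ℕ), r' + n' + l' < j → A.MergeRight n' l' r' :=
    fun n' l' r' h => (ih _ h _ _ _ rfl).1
  have hL : ∀ (n' l' r' : ℕ), r' + n' + l' < j → A.MergeLeft r' n' l' :=
    fun n' l' r' h => (ih _ h _ _ _ rfl).2
  -- Associativity of merges makes the left-hand sides of `expandRight` and `expandLeft` equal.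
  have key : ∀ (t w : ℕ) (_ : t + w = j) (Z : D), ∑ g : Grid r n l t w,
      g.sign • A.gridRight g Z ((A.F g.a).map (A.m rfl _) ≫ A.x g.a (g.n₁ + g.l₁) _) =
      ∑ g : Grid r n l t w, g.sign • A.gridLeft g Z (A.m rfl _ ≫ A.x (g.a + g.n₂) g.l₁ _) := by
    intro t w h Z
    rw [← A.expandRight Z rfl ((Nat.add_assoc _ _ _).symm.trans hj) h,
      ← A.expandLeft Z rfl hj h, ← Category.assoc, ← A.m_assoc rfl, Category.assoc]
  constructor
  · refine A.mergeRight_of_F_zero fun Z => ?_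
    -- With these target thicknesses, a left slide with `n₂ > 0` cannot have total thickness `j`:
    -- that would force `p = n₁ = l₂ = 0`, so the first target would be `l` and hence `n = 0`.
    have h₁ : ∀ g : Grid r n l (n + l) r,
        A.gridLeft g Z (A.m rfl _ ≫ A.x (g.a + g.n₂) g.l₁ _) =
        A.gridRight g Z (A.x g.a g.n₁ _ ≫ (A.F g.n₁).map (A.x g.a g.l₁ _) ≫ A.m rfl _) := by
      intro g
      rw [A.gridRight_eq_gridLeft]
      congr 1
      rcases g with ⟨p, a, n₁, n₂, l₁, l₂, h₁, h₂, h₃, h₄, h₅⟩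
      obtain rfl | h0 := Nat.eq_zero_or_pos n₂
      · exact A.mergeLeft_zero _ _ _ _
      · exact hL _ _ _ (by dsimp only; omega) _ _
    -- In this grid all of `r` crosses all of `n` and `l`; it is the only one whose right slide has
    -- the full thickness `j`.
    have h₂ := eq_of_sum_eq_sum ⟨0, r, n, 0, l, 0, by simp, rfl, rfl, by simp, by simp⟩
      (key (n + l) r (by omega) Z) fun g hg => by
        rw [h₁]
        congr 2
        rcases g with ⟨p, a, n₁, n₂, l₁, l₂, h₁, h₂, h₃, h₄, h₅⟩
        refine hR _ _ _ ?_ _ _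
        dsimp only
        by_contra hc
        obtain rfl : p = 0 := by omega
        obtain rfl : n₂ = 0 := by omega
        obtain rfl : l₂ = 0 := by omega
        obtain rfl : a = r := by omega
        obtain rfl : n₁ = n := by omega
        obtain rfl : l₁ = l := by omega
        exact hg rfl
    replace h₂ := Grid.sign_smul_injective _ h₂
    rw [h₁] at h₂
    exact A.gridRight_injective _ rfl rfl rfl h₂
  · refine A.mergeLeft_of_F_zero fun Z => ?_
    have h₁ : ∀ g : Grid r n l l (r + n),
        A.gridRight g Z ((A.F g.a).map (A.m rfl _) ≫ A.x g.a (g.n₁ + g.l₁) _) =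
        A.gridLeft g Z ((A.F g.a).map (A.x g.n₂ g.l₁ _) ≫ A.x g.a g.l₁ _ ≫
          (A.F g.l₁).map (A.m rfl _)) := by
      intro g
      rw [← A.gridRight_eq_gridLeft]
      congr 1
      rcases g with ⟨p, a, n₁, n₂, l₁, l₂, h₁, h₂, h₃, h₄, h₅⟩
      obtain rfl | h0 := Nat.eq_zero_or_pos n₁
      · exact A.mergeRight_zero _ _ _ _
      · exact hR _ _ _ (by dsimp only; omega) _ _
    -- Now all of `l` crosses all of `r` and `n`, and the left slide is the unknown one.
    have h₂ := eq_of_sum_eq_sum ⟨0, r, 0, n, l, 0, by simp, by simp, rfl, by simp, by simp⟩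
      (key l (r + n) (by omega) Z) fun g hg => by
        rw [h₁]
        congr 2
        rcases g with ⟨p, a, n₁, n₂, l₁, l₂, h₁, h₂, h₃, h₄, h₅⟩
        refine (hL _ _ _ ?_ _ _).symm
        dsimp only
        by_contra hc
        obtain rfl : p = 0 := by omega
        obtain rfl : n₁ = 0 := by omega
        obtain rfl : l₂ = 0 := by omega
        obtain rfl : a = r := by omega
        obtain rfl : n₂ = n := by omega
        obtain rfl : l₁ = l := by omega
        exact hg rfl
    replace h₂ := Grid.sign_smul_injective _ h₂
    rw [h₁] at h₂
    exact (A.gridLeft_injective _ rfl rfl rfl h₂).symm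

/-- Merges slide over strands to their left. -/
theorem m_x {k l p : ℕ} (h : k + l = p) (r : ℕ) (Z : D) :
    (A.F r).map (A.m h Z) ≫ A.x r p Z = A.x r k _ ≫ (A.F k).map (A.x r l Z) ≫ A.m h _ :=
  (A.merge_natural _ r k l rfl).1 h Z

/-- Merges slide under strands to their right. -/
theorem x_m {k l p : ℕ} (h : k + l = p) (r : ℕ) (Z : D) :
    A.m h _ ≫ A.x p r Z = (A.F k).map (A.x l r Z) ≫ A.x k r _ ≫ (A.F r).map (A.m h Z) :=
  (A.merge_natural _ k l r rfl).2 h Z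

/-- Splits slide under strands to their right. -/
theorem s_x {k l p : ℕ} (h : k + l = p) (r : ℕ) (Z : D) :
    A.x p r Z ≫ (A.F r).map (A.s h Z) = A.s h _ ≫ (A.F k).map (A.x l r Z) ≫ A.x k r _ :=
  (congrArg Quiver.Hom.unop (A.op.m_x h r (Opposite.op Z))).trans (Category.assoc _ _ _)

/-- Splits slide over strands to their left. -/
theorem x_s {k l p : ℕ} (h : k + l = p) (r : ℕ) (Z : D) :
    A.x r p Z ≫ A.s h _ = (A.F r).map (A.s h Z) ≫ A.x r k _ ≫ (A.F k).map (A.x r l Z) :=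
  (congrArg Quiver.Hom.unop (A.op.x_m h r (Opposite.op Z))).trans (Category.assoc _ _ _)

end WebAction

/-! ### Crossings of thick strands, deduced from thin ones -/

namespace WebAction

variable {D : Type u} [Category.{v} D] [Preadditive D] (A : WebAction D)

/-! Sliding merges and splits inside a larger web. -/

theorem m_x_assoc {k l p : ℕ} (h : k + l = p) (r : ℕ) (Z : D) {W : D} (t : _ ⟶ W) :
    (A.F r).map (A.m h Z) ≫ A.x r p Z ≫ t =
      A.x r k _ ≫ (A.F k).map (A.x r l Z) ≫ A.m h _ ≫ t := by
  simpa only [Category.assoc, Category.id_comp] using congrArg (· ≫ t) (A.m_x h r Z)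

theorem m_x₁ {k l p : ℕ} (h : k + l = p) (r : ℕ) (Z : D) (G : D ⥤ D) :
    G.map ((A.F r).map (A.m h Z)) ≫ G.map (A.x r p Z) =
      G.map (A.x r k _) ≫ G.map ((A.F k).map (A.x r l Z)) ≫ G.map (A.m h _) := by
  simpa only [Functor.map_comp, CategoryTheory.Functor.map_id] using congrArg G.map (A.m_x h r Z)

theorem m_x₁_assoc {k l p : ℕ} (h : k + l = p) (r : ℕ) (Z : D) (G : D ⥤ D) {W : D} (t : _ ⟶ W) :
    G.map ((A.F r).map (A.m h Z)) ≫ G.map (A.x r p Z) ≫ t =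
      G.map (A.x r k _) ≫ G.map ((A.F k).map (A.x r l Z)) ≫ G.map (A.m h _) ≫ t := by
  simpa only [Category.assoc, Category.id_comp] using
    congrArg (· ≫ t) (A.m_x₁ h r Z G)

theorem m_x₂ {k l p : ℕ} (h : k + l = p) (r : ℕ) (Z : D) (G : D ⥤ D) (H : D ⥤ D) :
    H.map (G.map ((A.F r).map (A.m h Z))) ≫ H.map (G.map (A.x r p Z)) =
      H.map (G.map (A.x r k _)) ≫ H.map (G.map ((A.F k).map (A.x r l Z))) ≫
        H.map (G.map (A.m h _)) := by
  simpa only [Functor.map_comp, CategoryTheory.Functor.map_id] using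
    congrArg H.map <| congrArg G.map (A.m_x h r Z)

theorem m_x₂_assoc {k l p : ℕ} (h : k + l = p) (r : ℕ) (Z : D) (G : D ⥤ D) (H : D ⥤ D) {W : D}
    (t : _ ⟶ W) :
    H.map (G.map ((A.F r).map (A.m h Z))) ≫ H.map (G.map (A.x r p Z)) ≫ t =
      H.map (G.map (A.x r k _)) ≫ H.map (G.map ((A.F k).map (A.x r l Z))) ≫
        H.map (G.map (A.m h _)) ≫ t := by
  simpa only [Category.assoc, Category.id_comp] using
    congrArg (· ≫ t) (A.m_x₂ h r Z G H)

theorem x_m_assoc {k l p : ℕ} (h : k + l = p) (r : ℕ) (Z : D) {W : D} (t : _ ⟶ W) :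
    A.m h _ ≫ A.x p r Z ≫ t =
      (A.F k).map (A.x l r Z) ≫ A.x k r _ ≫ (A.F r).map (A.m h Z) ≫ t := by
  simpa only [Category.assoc, Category.id_comp] using congrArg (· ≫ t) (A.x_m h r Z)

theorem s_x_assoc {k l p : ℕ} (h : k + l = p) (r : ℕ) (Z : D) {W : D} (t : _ ⟶ W) :
    A.x p r Z ≫ (A.F r).map (A.s h Z) ≫ t =
      A.s h _ ≫ (A.F k).map (A.x l r Z) ≫ A.x k r _ ≫ t := by
  simpa only [Category.assoc, Category.id_comp] using congrArg (· ≫ t) (A.s_x h r Z)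

theorem x_s_assoc {k l p : ℕ} (h : k + l = p) (r : ℕ) (Z : D) {W : D} (t : _ ⟶ W) :
    A.x r p Z ≫ A.s h _ ≫ t =
      (A.F r).map (A.s h Z) ≫ A.x r k _ ≫ (A.F k).map (A.x r l Z) ≫ t := by
  simpa only [Category.assoc, Category.id_comp] using congrArg (· ≫ t) (A.x_s h r Z)

theorem x_s₁ {k l p : ℕ} (h : k + l = p) (r : ℕ) (Z : D) (G : D ⥤ D) :
    G.map (A.x r p Z) ≫ G.map (A.s h _) =
      G.map ((A.F r).map (A.s h Z)) ≫ G.map (A.x r k _) ≫ G.map ((A.F k).map (A.x r l Z)) := by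
  simpa only [Functor.map_comp, CategoryTheory.Functor.map_id] using congrArg G.map (A.x_s h r Z)

theorem x_s₁_assoc {k l p : ℕ} (h : k + l = p) (r : ℕ) (Z : D) (G : D ⥤ D) {W : D} (t : _ ⟶ W) :
    G.map (A.x r p Z) ≫ G.map (A.s h _) ≫ t =
      G.map ((A.F r).map (A.s h Z)) ≫ G.map (A.x r k _) ≫ G.map ((A.F k).map (A.x r l Z)) ≫ t := by
  simpa only [Category.assoc, Category.id_comp] using
    congrArg (· ≫ t) (A.x_s₁ h r Z G)

/-! The relation between merges and splits when one strand is thin. -/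

/-- With a thin strand on the left there are only two ladders: the thin strand stays on its side,
which gives the identity, or it is exchanged with a thin part of the other strand, which gives the
crossing with sign -1. -/
theorem m_s_left {j : ℕ} (h : 1 + (j + 1) = j + 2) (h' : 1 + j = j + 1) (Z : D) :
    A.m h Z ≫ A.s h Z = 𝟙 _ - (A.F 1).map (A.s h' Z) ≫ A.x 1 1 _ ≫ (A.F 1).map (A.m h' Z) := by
  have := A.schur h h Z
  rw [Fintype.sum_eq_add (⟨1, 0, 0, j + 1, rfl, by simp, rfl, by simp⟩ : Ladder 1 (j + 1) 1 (j + 1))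
    ⟨0, 1, 1, j, rfl, h', rfl, h'⟩ (by simp) ?_] at this
  · rw [this]
    dsimp only
    rw [sub_eq_add_neg]
    congr 1
    · rw [A.x_zero_left, A.s_zero_left, A.s_zero_right, A.m_zero_left, A.m_zero_right]
      simp only [← Functor.map_comp, Category.assoc, A.unit_nat, A.unit_nat_assoc,
        Iso.inv_hom_id_assoc, Iso.inv_hom_id, CategoryTheory.Functor.map_id]
      simp
    · rw [A.s_zero_left, A.m_zero_left, A.unit_nat, A.unit_nat_assoc]
      simp
  · rintro ⟨p, a, b, q, h₁, h₂, h₃, h₄⟩ ⟨h5, h6⟩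
    exfalso
    obtain rfl | rfl : p = 0 ∨ p = 1 := by omega
    · exact h6 (Ladder.ext_of_p rfl)
    · exact h5 (Ladder.ext_of_p rfl)

theorem m_s_right {j : ℕ} (h : j + 1 + 1 = j + 2) (Z : D) :
    A.m h Z ≫ A.s h Z = 𝟙 _ - A.s rfl _ ≫ (A.F j).map (A.x 1 1 Z) ≫ A.m rfl _ := by
  have := A.schur h h Z
  rw [Fintype.sum_eq_add (⟨j + 1, 0, 0, 1, by simp, rfl, by simp, rfl⟩ : Ladder (j + 1) 1 (j + 1) 1)
    ⟨j, 1, 1, 0, rfl, rfl, rfl, rfl⟩ (by simp) ?_] at this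
  · rw [this]
    dsimp only
    rw [sub_eq_add_neg]
    congr 1
    · rw [A.x_zero_left, A.s_zero_left, A.s_zero_right, A.m_zero_left, A.m_zero_right]
      simp only [← Functor.map_comp, Category.assoc, A.unit_nat, A.unit_nat_assoc,
        Iso.inv_hom_id_assoc, Iso.inv_hom_id, CategoryTheory.Functor.map_id]
      simp
    · rw [A.s_zero_right, A.m_zero_right, A.s_nat_assoc, A.x_nat₁_assoc]
      simp only [← Functor.map_comp_assoc, ← Functor.map_comp]
      simp
  · rintro ⟨p, a, b, q, h₁, h₂, h₃, h₄⟩ ⟨h5, h6⟩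
    exfalso
    obtain rfl | rfl : q = 0 ∨ q = 1 := by omega
    · exact h6 (Ladder.ext_of_p (by dsimp only; omega))
    · exact h5 (Ladder.ext_of_p (by dsimp only; omega))

/-- For two thin strands the Schur relation can be solved for the crossing, so statements about thin
crossings become statements about merges and splits. -/
theorem x_one_one (Z : D) : A.x 1 1 Z = 𝟙 _ - A.m (rfl : 1 + 1 = 2) Z ≫ A.s rfl Z := by
  have := A.m_s_right (j := 0) rfl Z
  rw [this, sub_sub_cancel, A.s_zero_left, A.m_zero_left, A.unit_nat, Iso.inv_hom_id_assoc]

/-- Merge-split squares to twice itself by the digon relation, so one minus merge-split squares to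
one. -/
theorem x_one_one_x_one_one (Z : D) : A.x 1 1 Z ≫ A.x 1 1 Z = 𝟙 _ := by
  have h : A.m (rfl : 1 + 1 = 2) Z ≫ A.s rfl Z ≫ A.m (rfl : 1 + 1 = 2) Z ≫ A.s rfl Z =
      2 • (A.m (rfl : 1 + 1 = 2) Z ≫ A.s rfl Z) := by
    rw [← Category.assoc (A.s _ Z), A.digon, Preadditive.nsmul_comp, Category.id_comp,
      Preadditive.comp_nsmul]
    rfl
  rw [A.x_one_one]
  simp only [Preadditive.sub_comp, Preadditive.comp_sub, Category.id_comp, Category.comp_id,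
    Category.assoc, h]
  abel

/-- The digon of two thin strands has value 2, and 1 - 2 = -1: two thin strands split off together
are antisymmetric. -/
theorem s_x_one_one (Z : D) : A.s (rfl : 1 + 1 = 2) Z ≫ A.x 1 1 Z = - A.s rfl Z := by
  rw [A.x_one_one, Preadditive.comp_sub, ← Category.assoc, A.digon, Preadditive.nsmul_comp,
    Category.id_comp, Category.comp_id, show Nat.choose 2 1 = 2 from rfl, two_nsmul]
  abel

/-- The Yang-Baxter relation. -/
def YangBaxter (r k l : ℕ) : Prop := ∀ Z : D,
  A.x r k _ ≫ (A.F k).map (A.x r l Z) ≫ A.x k l _ =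
    (A.F r).map (A.x k l Z) ≫ A.x r l _ ≫ (A.F l).map (A.x r k Z)

/-- The crossing of the two thin strands is one minus merge-split, and merges and splits already
slide past the strand `r`. -/
theorem yangBaxter_one_one (r : ℕ) : A.YangBaxter r 1 1 := by
  intro Z
  simp only [A.x_one_one, Functor.map_sub, CategoryTheory.Functor.map_id, Preadditive.comp_sub,
    Preadditive.sub_comp, Category.comp_id, Category.id_comp, Functor.map_comp, Category.assoc]
  rw [← A.x_s, A.m_x_assoc]

theorem yangBaxter_zero_right (r k : ℕ) : A.YangBaxter r k 0 := by
  intro Z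
  simp only [A.x_zero_right, Functor.map_comp, Category.assoc, Iso.map_inv_hom_id_assoc]
  rw [← A.unit_inv_nat, A.x_nat_assoc]

theorem yangBaxter_zero_middle (r l : ℕ) : A.YangBaxter r 0 l := by
  intro Z
  simp only [A.x_zero_right, A.x_zero_left, Functor.map_comp, Category.assoc,
    A.unit_nat_assoc, Iso.inv_hom_id_assoc, A.x_nat_assoc]
  simp only [← Functor.map_comp, Iso.map_inv_hom_id_assoc]

section TorsionFree

variable [∀ X Y : D, IsAddTorsionFree (X ⟶ Y)]

/-- A section up to a nonzero integer suffices for cancellation when morphism groups have no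
torsion. -/
theorem epi_of_comp_eq_nsmul {X Y : D} {s : Y ⟶ X} {m : X ⟶ Y} {c : ℕ} (hc : c ≠ 0)
    (h : s ≫ m = c • 𝟙 _) : Epi m where
  left_cancellation f g e := by
    have : c • f = c • g := by
      rw [← Category.id_comp f, ← Category.id_comp g, ← Preadditive.nsmul_comp,
        ← Preadditive.nsmul_comp, ← h, Category.assoc, Category.assoc, e]
    exact nsmul_right_injective hc this

/-- By the digon relation a split is a section of the merge up to a binomial coefficient. Cancelling
merges is the device that reduces identities for thick strands to thinner ones; the functor `G`
allows it underneath other strands. -/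
theorem epi_m {k l n : ℕ} (h : k + l = n) (Z : D) (G : D ⥤ D) [G.Additive] :
    Epi (G.map (A.m h Z)) :=
  epi_of_comp_eq_nsmul (s := G.map (A.s h Z)) (Nat.choose_pos (by omega : k ≤ n)).ne' (by
    rw [← Functor.map_comp, A.digon, Functor.map_nsmul, CategoryTheory.Functor.map_id])

theorem x_x_add_right {r k l p : ℕ} (h : k + l = p) (h₁ : ∀ Z : D, A.x r k Z ≫ A.x k r Z = 𝟙 _)
    (h₂ : ∀ Z : D, A.x r l Z ≫ A.x l r Z = 𝟙 _) (Z : D) : A.x r p Z ≫ A.x p r Z = 𝟙 _ := by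
  have := A.epi_m h Z (A.F r)
  rw [← cancel_epi ((A.F r).map (A.m h Z)), A.m_x_assoc, A.x_m, ← Functor.map_comp_assoc, h₂]
  simp [reassoc_of% h₁]

theorem x_x_add_left {r k l p : ℕ} (h : k + l = p) (h₁ : ∀ Z : D, A.x k r Z ≫ A.x r k Z = 𝟙 _)
    (h₂ : ∀ Z : D, A.x l r Z ≫ A.x r l Z = 𝟙 _) (Z : D) : A.x p r Z ≫ A.x r p Z = 𝟙 _ := by
  have : Epi (A.m h ((A.F r).obj Z)) := A.epi_m h _ (𝟭 D)
  rw [← cancel_epi (A.m h _), A.x_m_assoc, A.m_x, reassoc_of% h₁, ← Functor.map_comp_assoc, h₂]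
  simp

/-- Crossings are involutive. -/
theorem x_x (k l : ℕ) (Z : D) : A.x k l Z ≫ A.x l k Z = 𝟙 _ := by
  -- First a thin strand against a thick one, peeling thin strands off the latter; then the other
  -- strand is peeled in the same way.
  have h₁ : ∀ (l : ℕ) (Z : D), A.x 1 l Z ≫ A.x l 1 Z = 𝟙 _ := by
    intro l
    induction l with
    | zero =>
      intro Z
      rw [A.x_zero_right, A.x_zero_left, Category.assoc, Iso.inv_hom_id_assoc,
        ← Functor.map_comp, Iso.hom_inv_id, CategoryTheory.Functor.map_id]
    | succ l ih => exact A.x_x_add_right rfl ih A.x_one_one_x_one_one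
  induction k generalizing Z with
  | zero =>
    rw [A.x_zero_right, A.x_zero_left, Category.assoc, ← Functor.map_comp_assoc, Iso.inv_hom_id,
      CategoryTheory.Functor.map_id, Category.id_comp, Iso.hom_inv_id]
  | succ k ih => exact A.x_x_add_left rfl ih (h₁ l) Z

/-- Precomposing with the merge of `l₁` and `l₂` and sliding it upwards through both sides leaves
the relations for `l₁` and for `l₂`, used one after the other. -/
theorem YangBaxter.add_right {r k l₁ l₂ l : ℕ} (h : l₁ + l₂ = l) (h₁ : A.YangBaxter r k l₁)
    (h₂ : A.YangBaxter r k l₂) : A.YangBaxter r k l := by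
  intro Z
  have := A.epi_m h Z (A.F k ⋙ A.F r)
  rw [← cancel_epi ((A.F k ⋙ A.F r).map (A.m h Z))]
  dsimp only [Functor.comp_map, Functor.comp_obj]
  have e := congrArg (A.F l₁).map (h₂ Z)
  have e' := h₁ ((A.F l₂).obj Z)
  simp only [Functor.map_comp] at e
  rw [A.x_nat_assoc, A.m_x₁_assoc, A.m_x, A.m_x₁_assoc, A.m_x_assoc, ← A.m_nat,
    A.x_nat_assoc, reassoc_of% e', reassoc_of% e, A.x_nat_assoc]

theorem YangBaxter.add_middle {r k₁ k₂ k l : ℕ} (h : k₁ + k₂ = k) (h₁ : A.YangBaxter r k₁ l)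
    (h₂ : A.YangBaxter r k₂ l) : A.YangBaxter r k l := by
  intro Z
  have := A.epi_m h ((A.F l).obj Z) (A.F r)
  rw [← cancel_epi ((A.F r).map (A.m h _))]
  have e := congrArg (A.F k₁).map (h₂ Z)
  have he := h₁ ((A.F k₂).obj Z)
  simp only [Functor.map_comp] at e
  rw [A.m_x_assoc, ← Functor.map_comp_assoc (A.F r), A.x_m, ← A.m_nat_assoc, A.x_m]
  simp only [Functor.map_comp, Category.assoc]
  rw [A.x_nat_assoc, reassoc_of% e, ← Functor.map_comp (A.F l) _ (A.x r k Z), A.m_x]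
  simp only [Functor.map_comp]
  rw [← A.x_nat_assoc r k₁, A.x_nat_assoc k₁ l, reassoc_of% he]

/-- Crossings slide over strands to their left. -/
theorem x_x_x (r k l : ℕ) : A.YangBaxter r k l := by
  have h₁ : ∀ l, A.YangBaxter r 1 l := by
    intro l
    induction l with
    | zero => exact A.yangBaxter_zero_right r 1
    | succ l ih => exact YangBaxter.add_right A rfl ih (A.yangBaxter_one_one r)
  induction k with
  | zero => exact A.yangBaxter_zero_middle r l
  | succ k ih => exact YangBaxter.add_middle A rfl ih (h₁ l)

theorem x_x_assoc (k l : ℕ) (Z : D) {W : D} (t : _ ⟶ W) :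
    A.x k l Z ≫ A.x l k Z ≫ t =
      t := by
  simpa only [Category.assoc, Category.id_comp] using congrArg (· ≫ t) (A.x_x k l Z)

theorem x_x₁ (k l : ℕ) (Z : D) (G : D ⥤ D) :
    G.map (A.x k l Z) ≫ G.map (A.x l k Z) =
      𝟙 _ := by
  simpa only [Functor.map_comp, CategoryTheory.Functor.map_id] using congrArg G.map (A.x_x k l Z)

theorem x_x₁_assoc (k l : ℕ) (Z : D) (G : D ⥤ D) {W : D} (t : _ ⟶ W) :
    G.map (A.x k l Z) ≫ G.map (A.x l k Z) ≫ t =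
      t := by
  simpa only [Category.assoc, Category.id_comp] using
    congrArg (· ≫ t) (A.x_x₁ k l Z G)

end TorsionFree

end WebAction

/-! ### Exploded caps and cups: merges at one foot, splits at the other -/

/-- An action of type A webs together with caps and cups of all thicknesses that are exploded
into thin ones, subject to relations between thin caps and cups. -/
structure OrthoAction (N : ℕ) (D : Type u) [Category.{v} D] [Preadditive D] extends
    WebAction D where
  cap : ∀ (k : ℕ) (Z : D), (F k).obj ((F k).obj Z) ⟶ Z
  cup : ∀ (k : ℕ) (Z : D), Z ⟶ (F k).obj ((F k).obj Z)
  cap_nat : ∀ (k : ℕ) {Z Z' : D} (f : Z ⟶ Z'), (F k).map ((F k).map f) ≫ cap k Z' = cap k Z ≫ f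
  cup_nat : ∀ (k : ℕ) {Z Z' : D} (f : Z ⟶ Z'), f ≫ cup k Z' = cup k Z ≫ (F k).map ((F k).map f)
  cap_zero : ∀ Z, cap 0 Z = (unit _).hom ≫ (unit Z).hom
  cup_zero : ∀ Z, cup 0 Z = (unit Z).inv ≫ (unit _).inv
  cap_succ : ∀ {k : ℕ} (h : 1 + k = k + 1) Z, (k + 1) • cap (k + 1) Z =
    (F (k + 1)).map (s rfl Z) ≫ s h _ ≫ (F 1).map (cap k _) ≫ cap 1 Z
  cup_succ : ∀ {k : ℕ} (h : 1 + k = k + 1) Z, (k + 1) • cup (k + 1) Z =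
    cup 1 Z ≫ (F 1).map (cup k _) ≫ (F 1).map ((F k).map (m rfl Z)) ≫ m h _
  circle_one : ∀ Z, cup 1 Z ≫ cap 1 Z = N • 𝟙 Z
  bubble_one : ∀ Z, (F 1).map (cup 1 Z) ≫ m (rfl : 1 + 1 = 2) _ ≫ s rfl _ ≫
    (F 1).map (cap 1 Z) + 𝟙 _ = N • 𝟙 _
  s_cap_one : ∀ Z, s (rfl : 1 + 1 = 2) Z ≫ cap 1 Z = 0
  cup_m_one : ∀ Z, cup 1 Z ≫ m (rfl : 1 + 1 = 2) Z = 0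
  slide_cap_one : ∀ (l : ℕ) (Z), x l 1 _ ≫ (F 1).map (x l 1 Z) ≫ cap 1 _ = (F l).map (cap 1 Z)
  slide_cup_one : ∀ (l : ℕ) (Z), (F l).map (cup 1 Z) ≫ x l 1 _ ≫ (F 1).map (x l 1 Z) = cup 1 _
  m_s_cap_one : ∀ Z, m (rfl : 1 + 1 = 2) _ ≫ s rfl _ ≫ (F 1).map (cap 1 _) ≫ cap 1 Z =
    (F 1).map ((F 1).map (m (rfl : 1 + 1 = 2) Z ≫ s rfl Z)) ≫ (F 1).map (cap 1 _) ≫ cap 1 Z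

namespace OrthoAction

variable {N : ℕ} {D : Type u} [Category.{v} D] [Preadditive D] (A : OrthoAction N D)

/-! Interchange laws for caps and cups. -/

theorem cap_nat_assoc (k : ℕ) {Z Z' : D} (f : Z ⟶ Z') {W : D} (t : _ ⟶ W) :
    (A.F k).map ((A.F k).map f) ≫ A.cap k Z' ≫ t =
      A.cap k Z ≫ f ≫ t := by
  simpa only [Category.assoc, Category.id_comp] using congrArg (· ≫ t) (A.cap_nat k f)

theorem cap_nat₁ (k : ℕ) {Z Z' : D} (f : Z ⟶ Z') (G : D ⥤ D) :
    G.map ((A.F k).map ((A.F k).map f)) ≫ G.map (A.cap k Z') =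
      G.map (A.cap k Z) ≫ G.map (f) := by
  simpa only [Functor.map_comp, CategoryTheory.Functor.map_id] using congrArg G.map (A.cap_nat k f)

theorem cap_nat₁_assoc (k : ℕ) {Z Z' : D} (f : Z ⟶ Z') (G : D ⥤ D) {W : D} (t : _ ⟶ W) :
    G.map ((A.F k).map ((A.F k).map f)) ≫ G.map (A.cap k Z') ≫ t =
      G.map (A.cap k Z) ≫ G.map (f) ≫ t := by
  simpa only [Category.assoc, Category.id_comp] using
    congrArg (· ≫ t) (A.cap_nat₁ k f G)

theorem cap_nat₂ (k : ℕ) {Z Z' : D} (f : Z ⟶ Z') (G : D ⥤ D) (H : D ⥤ D) :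
    H.map (G.map ((A.F k).map ((A.F k).map f))) ≫ H.map (G.map (A.cap k Z')) =
      H.map (G.map (A.cap k Z)) ≫ H.map (G.map (f)) := by
  simpa only [Functor.map_comp, CategoryTheory.Functor.map_id] using
    congrArg H.map <| congrArg G.map (A.cap_nat k f)

theorem cap_nat₂_assoc (k : ℕ) {Z Z' : D} (f : Z ⟶ Z') (G : D ⥤ D) (H : D ⥤ D) {W : D} (t : _ ⟶ W) :
    H.map (G.map ((A.F k).map ((A.F k).map f))) ≫ H.map (G.map (A.cap k Z')) ≫ t =
      H.map (G.map (A.cap k Z)) ≫ H.map (G.map (f)) ≫ t := by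
  simpa only [Category.assoc, Category.id_comp] using
    congrArg (· ≫ t) (A.cap_nat₂ k f G H)

theorem cup_nat_assoc (k : ℕ) {Z Z' : D} (f : Z ⟶ Z') {W : D} (t : _ ⟶ W) :
    f ≫ A.cup k Z' ≫ t =
      A.cup k Z ≫ (A.F k).map ((A.F k).map f) ≫ t := by
  simpa only [Category.assoc, Category.id_comp] using congrArg (· ≫ t) (A.cup_nat k f)

theorem cup_nat₁ (k : ℕ) {Z Z' : D} (f : Z ⟶ Z') (G : D ⥤ D) :
    G.map (f) ≫ G.map (A.cup k Z') =
      G.map (A.cup k Z) ≫ G.map ((A.F k).map ((A.F k).map f)) := by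
  simpa only [Functor.map_comp, CategoryTheory.Functor.map_id] using congrArg G.map (A.cup_nat k f)

theorem cup_nat₁_assoc (k : ℕ) {Z Z' : D} (f : Z ⟶ Z') (G : D ⥤ D) {W : D} (t : _ ⟶ W) :
    G.map (f) ≫ G.map (A.cup k Z') ≫ t =
      G.map (A.cup k Z) ≫ G.map ((A.F k).map ((A.F k).map f)) ≫ t := by
  simpa only [Category.assoc, Category.id_comp] using
    congrArg (· ≫ t) (A.cup_nat₁ k f G)

theorem cup_nat₂ (k : ℕ) {Z Z' : D} (f : Z ⟶ Z') (G : D ⥤ D) (H : D ⥤ D) :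
    H.map (G.map (f)) ≫ H.map (G.map (A.cup k Z')) =
      H.map (G.map (A.cup k Z)) ≫ H.map (G.map ((A.F k).map ((A.F k).map f))) := by
  simpa only [Functor.map_comp, CategoryTheory.Functor.map_id] using
    congrArg H.map <| congrArg G.map (A.cup_nat k f)

theorem cup_nat₂_assoc (k : ℕ) {Z Z' : D} (f : Z ⟶ Z') (G : D ⥤ D) (H : D ⥤ D) {W : D} (t : _ ⟶ W) :
    H.map (G.map (f)) ≫ H.map (G.map (A.cup k Z')) ≫ t =
      H.map (G.map (A.cup k Z)) ≫ H.map (G.map ((A.F k).map ((A.F k).map f))) ≫ t := by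
  simpa only [Category.assoc, Category.id_comp] using
    congrArg (· ≫ t) (A.cup_nat₂ k f G H)

theorem x_cap_one (Z : D) : A.x 1 1 Z ≫ A.cap 1 Z = A.cap 1 Z := by
  rw [A.x_one_one, Preadditive.sub_comp, Category.assoc, A.s_cap_one]
  simp

theorem cup_x_one (Z : D) : A.cup 1 Z ≫ A.x 1 1 Z = A.cup 1 Z := by
  rw [A.x_one_one, Preadditive.comp_sub, ← Category.assoc, A.cup_m_one]
  simp

/-- Merge-split sliding, rewritten with the thin crossing: on two nested caps a crossing can move
from one pair of feet to the other. -/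
theorem x_cap_cap_one (Z : D) : A.x 1 1 _ ≫ (A.F 1).map (A.cap 1 _) ≫ A.cap 1 Z =
    (A.F 1).map ((A.F 1).map (A.x 1 1 Z)) ≫ (A.F 1).map (A.cap 1 _) ≫ A.cap 1 Z := by
  have h := A.m_s_cap_one Z
  rw [A.x_one_one, A.x_one_one, Preadditive.sub_comp, Category.id_comp, Category.assoc, h,
    Functor.map_sub, Functor.map_sub, Preadditive.sub_comp, CategoryTheory.Functor.map_id,
    CategoryTheory.Functor.map_id, Category.id_comp]

/-- The two outermost of several thin strands that are split off are antisymmetric. -/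
theorem s_s_x_right {k : ℕ} (Z : D) : A.s (rfl : k + 1 + 1 = k + 2) Z ≫ A.s rfl _ ≫
    (A.F k).map (A.x 1 1 Z) = - A.s (rfl : k + 1 + 1 = k + 2) Z ≫ A.s rfl _ := by
  rw [← Category.assoc, A.s_coassoc rfl (rfl : 1 + 1 = 2) rfl rfl, Category.assoc,
    ← Functor.map_comp, A.s_x_one_one]
  simp

theorem s_s_x_left {k : ℕ} (h : 1 + (k + 1) = k + 2) (h' : 1 + k = k + 1) (Z : D) :
    A.s h Z ≫ (A.F 1).map (A.s h' Z) ≫ A.x 1 1 _ = - A.s h Z ≫ (A.F 1).map (A.s h' Z) := by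
  rw [← Category.assoc, ← A.s_coassoc (rfl : 1 + 1 = 2) h' (by omega), Category.assoc,
    A.s_x_one_one]
  simp

section TorsionFree

variable [∀ X Y : D, IsAddTorsionFree (X ⟶ Y)]

/-- Multiplied by k + 2, the cap of thickness k + 2 explodes, and its split meets the merge. The
Schur relation gives one copy of the claim minus a term with a crossing. That crossing travels
through two nested caps to thin strands split off one strand, where it becomes a sign, so this term
contributes k + 1 further copies. -/
theorem m_cap_one {k : ℕ} (h : 1 + k = k + 1) (Z : D) : A.m h _ ≫ A.cap (k + 1) Z =
    (A.F 1).map ((A.F k).map (A.s rfl Z)) ≫ (A.F 1).map (A.cap k _) ≫ A.cap 1 Z := by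
  induction k generalizing Z with
  | zero =>
    rw [A.m_zero_right, A.s_zero_left, A.cap_zero]
    simp only [← Functor.map_comp_assoc, A.unit_nat_assoc, Iso.inv_hom_id, Category.comp_id]
  | succ k ih =>
    have h' : 1 + k = k + 1 := Nat.add_comm _ _
    refine nsmul_right_injective (Nat.succ_ne_zero (k + 1)) ?_
    dsimp only
    rw [← Preadditive.comp_nsmul, A.cap_succ h, ← A.m_nat_assoc, ← Category.assoc (A.m h _),
      A.m_s_left h h', Preadditive.sub_comp, Preadditive.comp_sub, Category.id_comp]
    have key : (A.F 1).map ((A.F (k + 1)).map (A.s (rfl : k + 1 + 1 = k + 2) Z)) ≫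
        (A.F 1).map (A.s h' _) ≫ A.x 1 1 _ ≫ (A.F 1).map (A.m h' _) ≫
        (A.F 1).map (A.cap (k + 1) _) ≫ A.cap 1 Z =
        - ((k + 1) • ((A.F 1).map ((A.F (k + 1)).map (A.s (rfl : k + 1 + 1 = k + 2) Z)) ≫
          (A.F 1).map (A.cap (k + 1) _) ≫ A.cap 1 Z)) := by
      rw [← Functor.map_comp_assoc _ (A.m h' _), ih h']
      simp only [Functor.map_comp, Category.assoc]
      -- The place where the crossing is absorbed by antisymmetry, after it has been carried to the
      -- other feet of the nested caps.
      have e := congrArg (fun f => (A.F 1).map ((A.F 1).map ((A.F k).map f))) (A.s_s_x_right (k :=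
        k) Z)
      simp only [Functor.map_comp, Functor.map_neg, Preadditive.neg_comp] at e
      rw [← A.x_nat_assoc, ← A.x_nat_assoc, A.x_cap_cap_one, ← A.cap_nat₂_assoc, A.s_nat₁_assoc,
        reassoc_of% e, ← Preadditive.comp_nsmul, ← Preadditive.nsmul_comp, ← Functor.map_nsmul,
        A.cap_succ h']
      simp only [Functor.map_comp, Category.assoc, Preadditive.neg_comp, Preadditive.comp_neg,
        A.s_nat₁_assoc]
    rw [Category.assoc, Category.assoc, key, sub_neg_eq_add]
    exact (succ_nsmul' _ _).symm

/-- The same count with the two feet exchanged: the merge now sits on the right, and antisymmetry is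
used on the left. -/
theorem cap_m_one {k : ℕ} (h : 1 + k = k + 1) (Z : D) :
    (A.F (k + 1)).map (A.m rfl Z) ≫ A.cap (k + 1) Z =
      A.s h _ ≫ (A.F 1).map (A.cap k _) ≫ A.cap 1 Z := by
  induction k generalizing Z with
  | zero =>
    rw [A.m_zero_left, A.s_zero_right, A.cap_zero, ← Functor.map_comp_assoc, Iso.inv_hom_id_assoc]
  | succ k ih =>
    have h' : 1 + k = k + 1 := Nat.add_comm _ _
    refine nsmul_right_injective (Nat.succ_ne_zero (k + 1)) ?_
    dsimp only
    rw [← Preadditive.comp_nsmul, A.cap_succ h, ← Functor.map_comp_assoc, A.m_s_right,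
      Functor.map_sub, Preadditive.sub_comp, CategoryTheory.Functor.map_id, Category.id_comp]
    have key : (A.F (k + 2)).map (A.s (rfl : k + 1 = k + 1) _ ≫ (A.F k).map (A.x 1 1 Z) ≫
        A.m rfl _) ≫ A.s h _ ≫ (A.F 1).map (A.cap (k + 1) _) ≫ A.cap 1 Z =
        - ((k + 1) • (A.s h _ ≫ (A.F 1).map (A.cap (k + 1) _) ≫ A.cap 1 Z)) := by
      simp only [Functor.map_comp, Category.assoc]
      rw [A.s_nat_assoc, A.s_nat_assoc, A.s_nat_assoc,
        ← Functor.map_comp_assoc _ _ (A.cap (k + 1) _), ih h']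
      simp only [Functor.map_comp, Category.assoc]
      rw [A.s_nat₁_assoc, A.cap_nat₂_assoc, ← A.x_cap_cap_one, A.x_nat_assoc, A.s_nat₁_assoc,
        A.x_nat_assoc, reassoc_of% A.s_s_x_left h h', ← Preadditive.comp_nsmul,
        ← Preadditive.nsmul_comp, ← Functor.map_nsmul, A.cap_succ h']
      simp only [Functor.map_comp, Category.assoc, Preadditive.neg_comp, Preadditive.comp_neg,
        A.s_nat₁_assoc]
    rw [key, sub_neg_eq_add]
    exact (succ_nsmul' _ _).symm

/-- Peeling a thin strand off `k`, by cancelling the epimorphism that merges it, reduces to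
`m_cap_one`; coassociativity reassembles the splits at the other foot. -/
theorem m_cap {k l n : ℕ} (h : k + l = n) (h' : l + k = n) (Z : D) : A.m h _ ≫ A.cap n Z =
    (A.F k).map ((A.F l).map (A.s h' Z)) ≫ (A.F k).map (A.cap l _) ≫ A.cap k Z := by
  induction k generalizing n Z with
  | zero =>
    obtain rfl : n = l := by omega
    rw [A.m_zero_left, A.s_zero_right, A.cap_zero, A.unit_nat_assoc, A.unit_nat_assoc,
      A.cap_nat_assoc, Iso.inv_hom_id, Category.comp_id]
  | succ k ih =>
    obtain ⟨n, rfl⟩ : ∃ n', n = n' + 1 := ⟨k + l, by omega⟩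
    have hk : 1 + k = k + 1 := Nat.add_comm _ _
    have : Epi (A.m hk ((A.F l).obj ((A.F (n + 1)).obj Z))) := by
      simpa using A.epi_m hk ((A.F l).obj ((A.F (n + 1)).obj Z)) (𝟭 D)
    rw [← cancel_epi (A.m hk _), A.m_assoc_assoc hk (by omega : k + l = n) h (by omega),
      A.m_cap_one, ← A.m_nat₁_assoc, ← Functor.map_comp_assoc _ (A.m _ _),
      ih (by omega) (by omega : l + k = n), ← A.m_nat_assoc, ← A.m_nat_assoc, A.m_cap_one]
    simp only [Functor.map_comp, Category.assoc]
    rw [← A.cap_nat₂_assoc]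
    have e := congrArg (fun f => (A.F 1).map ((A.F k).map ((A.F l).map f)))
      (A.s_coassoc (by omega : l + k = n) rfl rfl h' Z)
    simp only [Functor.map_comp] at e
    rw [reassoc_of% e]

theorem cap_m {k l n : ℕ} (h : k + l = n) (h' : l + k = n) (Z : D) :
    (A.F n).map (A.m h Z) ≫ A.cap n Z = A.s h' _ ≫ (A.F l).map (A.cap k _) ≫ A.cap l Z := by
  induction l generalizing n Z with
  | zero =>
    obtain rfl : n = k := by omega
    rw [A.m_zero_right, A.s_zero_left, A.cap_zero, A.unit_nat_assoc, Iso.inv_hom_id_assoc,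
      A.cap_nat]
  | succ l ih =>
    obtain ⟨n, rfl⟩ : ∃ n', n = n' + 1 := ⟨k + l, by omega⟩
    have := A.epi_m (rfl : l + 1 = l + 1) Z (A.F k ⋙ A.F (n + 1))
    rw [← cancel_epi ((A.F k ⋙ A.F (n + 1)).map (A.m (rfl : l + 1 = l + 1) Z))]
    dsimp only [Functor.comp_map]
    rw [← Functor.map_comp_assoc, ← A.m_assoc (by omega : k + l = n) rfl rfl h, Functor.map_comp,
      Category.assoc, A.cap_m_one (by omega), A.s_nat_assoc,
        ← Functor.map_comp_assoc _ _ (A.cap n _),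
      ih (by omega) (by omega : l + k = n), A.s_nat_assoc, A.cap_nat₁_assoc,
      A.cap_m_one (by omega : 1 + l = l + 1), A.s_nat_assoc]
    simp only [Functor.map_comp, Category.assoc]
    rw [A.s_coassoc_assoc (by omega : 1 + l = l + 1) (by omega : l + k = n)]

end TorsionFree

end OrthoAction

/-! ### Exploded caps and cups: zigzags, rotation, circles and lollipops -/

namespace OrthoAction

variable {N : ℕ} {D : Type u} [Category.{v} D] [Preadditive D] (A : OrthoAction N D)

/-- The crossing is one minus merge-split: the identity closes up to a circle of value N,
merge-split to a bubble of value N - 1, and the difference is 1. -/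
theorem curl_one (Z : D) : (A.F 1).map (A.cup 1 Z) ≫ A.x 1 1 _ ≫ (A.F 1).map (A.cap 1 Z) = 𝟙 _ := by
  have h := A.bubble_one Z
  rw [A.x_one_one, Preadditive.sub_comp, Preadditive.comp_sub, Category.id_comp,
    ← Functor.map_comp, A.circle_one, Functor.map_nsmul, CategoryTheory.Functor.map_id,
    Category.assoc, ← h]
  exact add_sub_cancel_left _ _

/-- The zigzag is not among the relations for thin caps. Sliding a thin strand through the cup turns
it into a curl, whose value is known. -/
theorem zigzag_right_one (Z : D) : A.cup 1 _ ≫ (A.F 1).map (A.cap 1 Z) = 𝟙 _ := by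
  rw [← A.slide_cup_one, Category.assoc, Category.assoc, ← Functor.map_comp, A.x_cap_one,
    A.curl_one]

theorem zigzag_left_one (Z : D) : (A.F 1).map (A.cup 1 Z) ≫ A.cap 1 _ = 𝟙 _ := by
  rw [← A.curl_one, ← A.slide_cap_one, reassoc_of% A.x_one_one_x_one_one,
    ← Functor.map_comp_assoc, A.cup_x_one]

section TorsionFree

variable [∀ X Y : D, IsAddTorsionFree (X ⟶ Y)]

theorem slide_cap (l k : ℕ) (Z : D) :
    A.x l k _ ≫ (A.F k).map (A.x l k Z) ≫ A.cap k _ = (A.F l).map (A.cap k Z) := by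
  induction k generalizing Z with
  | zero =>
    rw [A.x_zero_right, A.x_zero_right, A.cap_zero, A.cap_zero, Category.assoc,
      A.unit_nat_assoc, Iso.inv_hom_id_assoc, Category.assoc, Iso.inv_hom_id, Category.comp_id,
      Functor.map_comp]
  | succ k ih =>
    have h : 1 + k = k + 1 := Nat.add_comm _ _
    refine nsmul_right_injective (Nat.succ_ne_zero k) ?_
    dsimp only
    have e := congrArg (A.F 1).map (ih ((A.F 1).obj Z))
    simp only [Functor.map_comp] at e
    rw [← Functor.map_nsmul, ← Preadditive.comp_nsmul, ← Preadditive.comp_nsmul, A.cap_succ h,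
      A.cap_succ h, ← Functor.map_comp_assoc, A.x_s]
    simp only [Functor.map_comp, Category.assoc]
    rw [A.s_nat_assoc, A.s_nat_assoc, A.s_nat_assoc, A.x_s_assoc, A.cap_nat₁_assoc,
      ← A.x_nat₁_assoc, reassoc_of% e, ← A.x_nat_assoc, ← A.x_nat_assoc, A.slide_cap_one,
      ← A.s_nat₁_assoc]

theorem slide_cup (l k : ℕ) (Z : D) :
    (A.F l).map (A.cup k Z) ≫ A.x l k _ ≫ (A.F k).map (A.x l k Z) = A.cup k _ := by
  induction k generalizing Z with
  | zero =>
    rw [A.x_zero_right, A.x_zero_right, A.cup_zero, A.cup_zero]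
    simp only [Functor.map_comp, Category.assoc]
    rw [← Functor.map_comp_assoc _ (A.unit ((A.F 0).obj Z)).inv, Iso.inv_hom_id,
      CategoryTheory.Functor.map_id, Category.id_comp,
      ← reassoc_of% A.unit_inv_nat ((A.F l).map (A.unit Z).hom), ← Functor.map_comp_assoc,
      Iso.inv_hom_id, CategoryTheory.Functor.map_id, Category.id_comp, A.unit_inv_nat]
  | succ k ih =>
    have h : 1 + k = k + 1 := Nat.add_comm _ _
    refine nsmul_right_injective (Nat.succ_ne_zero k) ?_
    dsimp only
    have e := congrArg (A.F 1).map (ih ((A.F 1).obj Z))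
    simp only [Functor.map_comp] at e
    rw [← Preadditive.nsmul_comp, ← Functor.map_nsmul, A.cup_succ h, A.cup_succ h]
    simp only [Functor.map_comp, Category.assoc]
    rw [A.m_x_assoc, ← A.m_nat, A.x_nat_assoc, A.x_nat₁_assoc, A.m_x₂_assoc,
      A.x_nat_assoc, reassoc_of% e, ← A.cup_nat₁_assoc, reassoc_of% A.slide_cup_one l Z]

/-- Exploding the cup and trading its merge for a split under the cap (`cap_m`) produces a thin
zigzag and one of thickness k. After both are straightened, a digon of value k + 1 remains. -/
theorem zigzag_left (k : ℕ) (Z : D) : (A.F k).map (A.cup k Z) ≫ A.cap k _ = 𝟙 _ := by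
  induction k generalizing Z with
  | zero =>
    rw [A.cup_zero, A.cap_zero, A.unit_nat_assoc]
    simp
  | succ k ih =>
    have h : 1 + k = k + 1 := Nat.add_comm _ _
    refine nsmul_right_injective (Nat.succ_ne_zero k) ?_
    dsimp only
    have e := congrArg (A.F k).map (A.zigzag_left_one Z)
    simp only [Functor.map_comp, CategoryTheory.Functor.map_id] at e
    rw [← Preadditive.nsmul_comp, ← Functor.map_nsmul, A.cup_succ h]
    simp only [Functor.map_comp, Category.assoc]
    rw [A.cap_m h rfl, A.s_nat_assoc, A.s_nat_assoc, A.s_nat_assoc, A.cap_nat₁_assoc,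
      A.cap_nat₁_assoc, reassoc_of% e, A.cap_nat, reassoc_of% ih ((A.F 1).obj Z), A.digon]
    simp

theorem zigzag_right (k : ℕ) (Z : D) : A.cup k _ ≫ (A.F k).map (A.cap k Z) = 𝟙 _ := by
  induction k generalizing Z with
  | zero =>
    rw [A.cup_zero, A.cap_zero, Category.assoc, ← A.unit_inv_nat]
    simp
  | succ k ih =>
    have h : 1 + k = k + 1 := Nat.add_comm _ _
    refine nsmul_right_injective (Nat.succ_ne_zero k) ?_
    dsimp only
    have e := congrArg (A.F 1).map (ih Z)
    simp only [Functor.map_comp, CategoryTheory.Functor.map_id] at e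
    rw [← Preadditive.nsmul_comp, A.cup_succ h]
    simp only [Category.assoc]
    have e₁ := congrArg (fun f => (A.F 1).map ((A.F k).map f)) (A.m_cap rfl h Z)
    simp only [Functor.map_comp] at e₁
    rw [← A.m_nat, reassoc_of% e₁, ← A.cup_nat₁_assoc, ← A.cup_nat₁_assoc, ← A.cup_nat_assoc,
      reassoc_of% A.zigzag_right_one ((A.F k).obj Z), reassoc_of% e, A.digon]
    simp

/-- A thick crossing decomposes into crossings of the exploded strands. The self-crossings disappear
by the induction hypothesis and the thin case, the mixed ones by sliding strands through caps. -/
theorem x_cap (k : ℕ) (Z : D) : A.x k k Z ≫ A.cap k Z = A.cap k Z := by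
  induction k generalizing Z with
  | zero =>
    rw [A.x_zero_left, A.cap_zero, Category.assoc, A.unit_nat_assoc, Iso.inv_hom_id,
      Category.comp_id, ← A.unit_nat]
  | succ k ih =>
    have h : 1 + k = k + 1 := Nat.add_comm _ _
    refine nsmul_right_injective (Nat.succ_ne_zero k) ?_
    dsimp only
    have e := congrArg (A.F 1).map (ih ((A.F 1).obj Z))
    simp only [Functor.map_comp] at e
    have e₁ := congrArg (A.F 1).map (A.slide_cap 1 k Z)
    simp only [Functor.map_comp] at e₁
    have e₂ : (A.F 1).map ((A.F k).map (A.x 1 k Z)) ≫ (A.F 1).map (A.cap k _) =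
        (A.F 1).map (A.x k 1 _) ≫ (A.F 1).map ((A.F 1).map (A.cap k Z)) := by
      rw [← e₁, A.x_x₁_assoc]
    have e₃ := congrArg (A.F k).map (A.x_cap_one ((A.F k).obj Z))
    simp only [Functor.map_comp] at e₃
    rw [← Preadditive.comp_nsmul, A.cap_succ h, A.s_x_assoc, A.x_s_assoc, reassoc_of% e,
      A.x_s₁_assoc, A.x_nat_assoc, reassoc_of% e₂, A.cap_nat,
      reassoc_of% A.slide_cap_one k ((A.F k).obj Z), reassoc_of% e₃, ← A.m_cap rfl h,
      ← Category.assoc, A.digon]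
    simpa using A.cap_succ h Z

/-- The rotated form of `m_cap`: zigzags express the merge through the cup and the split, and this
expression straightens. -/
theorem cup_s {k l n : ℕ} (h : k + l = n) (h' : l + k = n) (Z : D) : A.cup n Z ≫ A.s h _ =
    A.cup k Z ≫ (A.F k).map (A.cup l _) ≫ (A.F k).map ((A.F l).map (A.m h' Z)) := by
  have e : A.m h' Z = (A.F l).map ((A.F k).map (A.cup n Z ≫ A.s h _)) ≫
      (A.F l).map (A.cap k _) ≫ A.cap l _ := by
    rw [Functor.map_comp, Functor.map_comp, Category.assoc, ← A.m_cap h' h, A.m_nat_assoc,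
      A.zigzag_left, Category.comp_id]
  have e₁ := congrArg (A.F k).map (A.zigzag_right l ((A.F n).obj Z))
  simp only [Functor.map_comp, CategoryTheory.Functor.map_id] at e₁
  rw [e]
  simp only [Functor.map_comp, Category.assoc]
  rw [← A.cup_nat₁_assoc, ← A.cup_nat_assoc, ← A.cup_nat₁_assoc, ← A.cup_nat_assoc,
    ← A.cup_nat₁_assoc, reassoc_of% A.zigzag_right k ((A.F l).obj ((A.F n).obj Z)), e₁,
      Category.comp_id]

/-- Explosion with the thin cup innermost, whereas `cup_succ` places it outermost. -/
theorem cup_succ' {k : ℕ} (h : 1 + k = k + 1) (Z : D) : (k + 1) • A.cup (k + 1) Z =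
    A.cup k Z ≫ (A.F k).map (A.cup 1 _) ≫ (A.F k).map ((A.F 1).map (A.m h Z)) ≫ A.m rfl _ := by
  rw [← reassoc_of% A.cup_s rfl h Z, A.digon]
  simp

/-- The bubble has value N - k; the sum on the left avoids subtraction. The Schur relation splits it
into a circle and a thin curl, and the straightened curl leaves a digon of value k. -/
theorem bubble (k : ℕ) (h : 1 + k = k + 1) (Z : D) :
    A.cup 1 _ ≫ (A.F 1).map (A.m h Z ≫ A.s h Z) ≫ A.cap 1 _ + k • 𝟙 _ = N • 𝟙 _ := by
  cases k with
  | zero =>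
    rw [A.m_zero_right, A.s_zero_right, ← Functor.map_comp, Iso.hom_inv_id]
    simp [A.circle_one]
  | succ k =>
    have h' : 1 + k = k + 1 := Nat.add_comm _ _
    have e : A.cup 1 _ ≫ (A.F 1).map (A.x 1 1 ((A.F k).obj Z)) ≫ A.cap 1 _ = 𝟙 _ := by
      rw [← A.slide_cup_one, Category.assoc, Category.assoc, ← Functor.map_comp_assoc _ (A.x 1 1 _),
        A.x_one_one_x_one_one, CategoryTheory.Functor.map_id, Category.id_comp, A.x_cap_one,
        A.zigzag_left_one]
    rw [A.m_s_left h h', Functor.map_sub, Preadditive.sub_comp, Preadditive.comp_sub]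
    simp only [Functor.map_comp, CategoryTheory.Functor.map_id, Category.id_comp, Category.assoc]
    rw [A.circle_one, A.cap_nat, ← A.cup_nat_assoc, reassoc_of% e, A.digon]
    simp

/-- Explosion with the thin cup inside exposes a bubble, so k + 1 times the circle of thickness k +
1 is N - k times that of thickness k. This is the recurrence of the binomial coefficients. -/
theorem circle (k : ℕ) (Z : D) : A.cup k Z ≫ A.cap k Z = N.choose k • 𝟙 Z := by
  induction k generalizing Z with
  | zero => simp [A.cup_zero, A.cap_zero]
  | succ k ih =>
    have h : 1 + k = k + 1 := Nat.add_comm _ _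
    refine nsmul_right_injective (Nat.succ_ne_zero k) ?_
    dsimp only
    have b := congrArg (fun f => A.cup k Z ≫ (A.F k).map f ≫ A.cap k Z) (A.bubble k h Z)
    simp only [Functor.map_add, Functor.map_nsmul, CategoryTheory.Functor.map_id,
      Preadditive.add_comp, Preadditive.comp_add, Preadditive.nsmul_comp, Preadditive.comp_nsmul,
      Category.id_comp, ih, Functor.map_comp, Category.assoc] at b
    rw [← Preadditive.nsmul_comp, A.cup_succ' h]
    simp only [Category.assoc]
    -- Adding k copies on both sides replaces the factor N - k; for k > N both binomial coefficients
    -- vanish.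
    rw [A.m_cap rfl h, ← add_left_inj (k • N.choose k • 𝟙 Z), b, ← mul_nsmul', ← mul_nsmul',
      ← mul_nsmul', ← add_nsmul]
    congr 1
    have c := Nat.choose_succ_right_eq N k
    rcases le_or_gt k N with hk | hk
    · obtain ⟨d, rfl⟩ := Nat.exists_eq_add_of_le hk
      rw [Nat.add_sub_cancel_left] at c
      rw [Nat.mul_comm (k + 1), c]
      ring
    · simp [Nat.choose_eq_zero_of_lt hk, Nat.choose_eq_zero_of_lt (hk.trans (Nat.lt_succ_self k))]

/-- Exploding the cap and using coassociativity brings an innermost thin cap on top of a split of a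
strand of thickness 2, and the thin lollipop vanishes. -/
theorem s_cap {a n : ℕ} (ha : 0 < a) (h : a + a = n) (Z : D) : A.s h Z ≫ A.cap a Z = 0 := by
  obtain ⟨k, rfl⟩ : ∃ k, a = k + 1 := ⟨a - 1, by omega⟩
  have h' : 1 + k = k + 1 := Nat.add_comm _ _
  refine nsmul_right_injective (Nat.succ_ne_zero k) ?_
  dsimp only
  have e : (k + 1) • A.cap (k + 1) Z = A.s rfl _ ≫ A.m rfl _ ≫ A.cap (k + 1) Z := by
    rw [← Category.assoc, A.digon]
    simp
  rw [← Preadditive.comp_nsmul, e, A.m_cap rfl h',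
    A.s_coassoc_assoc rfl (by omega : 1 + (k + 1) = k + 2) h (by omega), ← Functor.map_comp_assoc,
    ← A.s_coassoc (rfl : 1 + 1 = 2) h' (by omega), Functor.map_comp, Category.assoc,
    ← Functor.map_comp_assoc _ _ (A.cap 1 _), A.s_cap_one]
  simp

theorem lollipop_right {a l p n : ℕ} (ha : 0 < a) (hp : l + a = p) (hn : p + a = n) (Z : D) :
    A.s hn Z ≫ A.s hp _ ≫ (A.F l).map (A.cap a Z) = 0 := by
  rw [A.s_coassoc_assoc hp rfl hn (by omega), ← Functor.map_comp, A.s_cap ha]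
  simp

theorem lollipop_left {a l p n : ℕ} (ha : 0 < a) (hp : a + l = p) (hn : a + p = n) (Z : D) :
    A.s hn Z ≫ (A.F a).map (A.s hp Z) ≫ A.cap a _ = 0 := by
  rw [← A.s_coassoc_assoc rfl hp (by omega) hn, A.s_cap ha]
  simp

theorem turn_right {k l n : ℕ} (h : k + l = n) (h' : l + k = n) (Z : D) :
    (A.F n).map (A.cup k Z ≫ (A.F k).map (A.cup l _)) ≫ (A.F n).map (A.m h _) ≫ A.cap n _ =
      A.s h' Z := by
  have e := congrArg (A.F l).map (A.zigzag_left k Z)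
  simp only [Functor.map_comp, CategoryTheory.Functor.map_id] at e
  rw [A.cap_m h h', A.s_nat_assoc]
  simp only [Functor.map_comp, Category.assoc]
  rw [A.cap_nat₁_assoc, reassoc_of% e, A.zigzag_left, Category.comp_id]

theorem turn_left {k l n : ℕ} (h : k + l = n) (h' : l + k = n) (Z : D) :
    A.cup l _ ≫ (A.F l).map (A.cup k _) ≫ (A.F l).map ((A.F k).map (A.m h _)) ≫
      (A.F l).map ((A.F k).map (A.cap n Z)) = A.s h' Z := by
  have e := congrArg (A.F l).map (A.zigzag_right k Z)
  simp only [Functor.map_comp, CategoryTheory.Functor.map_id] at e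
  have e₁ := congrArg (fun f => (A.F l).map ((A.F k).map f)) (A.m_cap h h' Z)
  simp only [Functor.map_comp] at e₁
  rw [e₁, ← A.cup_nat₁_assoc, ← A.cup_nat₁_assoc, ← A.cup_nat_assoc,
    reassoc_of% A.zigzag_right l ((A.F k).obj Z), e, Category.comp_id]

/-- Sliding a strand through the cup, with the involutivity of crossings, moves the crossing to the
other leg of the cup; there a zigzag frees it. -/
theorem turn_cross (k l : ℕ) (Z : D) : (A.F k).map ((A.F l).map (A.cup k Z)) ≫
    (A.F k).map (A.x l k _) ≫ A.cap k _ = A.x k l Z := by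
  have e : (A.F l).map (A.cup k Z) ≫ A.x l k _ = A.cup k _ ≫ (A.F k).map (A.x k l Z) := by
    rw [← A.slide_cup l k Z, Category.assoc, Category.assoc, A.x_x₁, Category.comp_id]
  rw [← Functor.map_comp_assoc, e, Functor.map_comp, Category.assoc, A.cap_nat,
    reassoc_of% A.zigzag_left k ((A.F l).obj Z)]

end TorsionFree

end OrthoAction

/-! ### Commutation of divided powers -/

theorem succ_mul_choose_succ (M : ℤ) (n : ℕ) :
    ((n : ℤ) + 1) * Ring.choose M (n + 1) = (M - n) * Ring.choose M n := by
  have h := Ring.choose_add_smul_choose (M - n) 1 n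
  rw [Ring.choose_one_right, Nat.add_comm 1 n, Nat.choose_symm_add, Nat.choose_one_right,
    nsmul_eq_mul, sub_add_cancel] at h
  push_cast at h
  linarith

section Weights

variable {D : Type u} [Category.{v} D] [Preadditive D]

/-- Divided powers of raising and lowering operators between weight spaces `X i`, where `p i` is
the identity of `X i` or zero. -/
structure WeightOperators (X : ℤ → D) (c : ℤ) where
  e : ℕ → ∀ i j : ℤ, X i ⟶ X j
  f : ℕ → ∀ i j : ℤ, X i ⟶ X j
  p : ∀ i : ℤ, X i ⟶ X i
  e_zero : ∀ i, e 0 i i = p i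
  f_zero : ∀ i, f 0 i i = p i
  e_p : ∀ a i j, e a i j ≫ p j = e a i j
  f_p : ∀ a i j, f a i j ≫ p j = f a i j
  p_f : ∀ a i j, p i ≫ f a i j = f a i j
  e_succ : ∀ (a : ℕ) (i j r : ℤ),
    j = i + a → r = j + 1 → e a i j ≫ e 1 j r = (a + 1) • e (a + 1) i r
  f_succ : ∀ (a : ℕ) (i j r : ℤ),
    j = i - a → r = j - 1 → f a i j ≫ f 1 j r = (a + 1) • f (a + 1) i r
  comm : ∀ i j r, j = i + 1 → r = i - 1 →
    f 1 i r ≫ e 1 r i = e 1 i j ≫ f 1 j i + (c + 2 * i) • p i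

namespace WeightOperators

variable {X : ℤ → D} {c : ℤ} (S : WeightOperators X c) [∀ X Y : D, IsAddTorsionFree (X ⟶ Y)]

/-- Induction on `b`, after multiplication by b + 2: the raising operator passes one lowering
operator by `comm` and the others by the induction hypothesis, and the accumulated weights form an
arithmetic progression. -/
theorem f_e_one (b : ℕ) (i r j i' : ℤ) (hr : r = i - (b + 1)) (hj : j = r + 1) (hi : i' = i + 1) :
    S.f (b + 1) i r ≫ S.e 1 r j = S.e 1 i i' ≫ S.f (b + 1) i' j + (c + 2 * i - b) • S.f b i j := by
  induction b generalizing r j with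
  | zero =>
    obtain rfl : j = i := by push_cast at hr; omega
    rw [Nat.zero_add, S.f_zero, S.comm j i' r hi (by push_cast at hr; omega)]
    simp
  | succ b ih =>
    have hj' : j = i - (b + 1) := by push_cast at hr; omega
    have ih' := ih j (j + 1) (by push_cast at hr ⊢; omega) rfl
    refine nsmul_right_injective (Nat.succ_ne_zero (b + 1)) ?_
    dsimp only
    have e₁ := S.f_succ (b + 1) i j r (by push_cast; omega) (by omega)
    have e₂ := S.f_succ b i (j + 1) j (by omega) (by omega)
    have e₃ := S.f_succ (b + 1) i' (j + 1) j (by push_cast; omega) (by omega)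
    have e₄ := S.comm j (j + 1) r rfl (by omega)
    calc (b + 1 + 1) • S.f (b + 1 + 1) i r ≫ S.e 1 r j
        = (S.f (b + 1) i j ≫ S.f 1 j r) ≫ S.e 1 r j := by
          rw [e₁, Preadditive.nsmul_comp]
      _ = (S.f (b + 1) i j ≫ S.e 1 j (j + 1)) ≫ S.f 1 (j + 1) j +
          (c + 2 * j) • S.f (b + 1) i j := by
          rw [Category.assoc, e₄, Preadditive.comp_add, Preadditive.comp_zsmul, S.f_p,
            Category.assoc]
      _ = _ := by
          rw [ih', Preadditive.add_comp, Category.assoc, e₃, Preadditive.zsmul_comp, e₂,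
            Preadditive.comp_nsmul]
          subst hj'
          push_cast
          module

/-- The web `f^{(b-y)} e^{(a-y)}`, or zero if this makes no sense. -/
def term (a b : ℕ) (i j : ℤ) (y : ℕ) : X i ⟶ X j :=
  if y ≤ a ∧ y ≤ b then S.e (a - y) i (i + a - y) ≫ S.f (b - y) (i + a - y) j else 0

/-- Moving a raising operator past `f^{(b-y)}` has two outcomes: it survives and joins `e^{(a-y)}`,
or it cancels one lowering operator, which raises the index `y`. -/
theorem term_e (a b y : ℕ) (i j j' : ℤ) (hj : j = i + a - b) (hj' : j' = j + 1) :
    S.term a b i j y ≫ S.e 1 j j' = ((a : ℤ) + 1 - y) • S.term (a + 1) b i j' y +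
      (c + 2 * i + 2 * a - b - y + 1) • S.term (a + 1) b i j' (y + 1) := by
  rcases lt_or_ge b y with hb | hb
  · simp [term, hb.not_ge, show ¬ y + 1 ≤ b by omega]
  rcases lt_or_ge a y with ha | ha
  -- At `y = a + 1` the summand for `a + 1` may be nonzero, but its coefficient `a + 1 - y`
  -- vanishes.
  · rcases eq_or_ne y (a + 1) with rfl | hy
    · simp [term]
    · simp [term, ha.not_ge, show ¬ y ≤ a + 1 by omega]
  obtain ⟨a, rfl⟩ := Nat.exists_eq_add_of_le ha
  obtain ⟨b, rfl⟩ := Nat.exists_eq_add_of_le hb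
  have e₁ := S.e_succ a i (i + a) (i + a + 1) rfl rfl
  have w₀ : i + (y + a : ℕ) - y = i + a := by push_cast; ring
  have w₁ : i + (y + a + 1 : ℕ) - y = i + a + 1 := by push_cast; ring
  have w₂ : i + (y + a + 1 : ℕ) - (y + 1 : ℕ) = i + a := by push_cast; ring
  simp only [term, ha, hb, show y ≤ y + a + 1 by omega, show y + 1 ≤ y + a + 1 by omega,
    true_and, if_true, show y + a + 1 - y = a + 1 by omega, Nat.add_sub_cancel_left,
    show y + a + 1 - (y + 1) = a by omega, and_self]
  rw [w₀, w₁, w₂]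
  cases b with
  | zero =>
    obtain rfl : j = i + a := by push_cast at hj; omega
    obtain rfl : j' = i + a + 1 := by omega
    simp only [Nat.add_zero, show ¬ y + 1 ≤ y by omega, if_false, smul_zero, add_zero]
    rw [S.f_zero, S.f_zero, S.e_p, S.e_p, e₁]
    push_cast
    module
  | succ b =>
    have h := S.f_e_one b (i + a) j j' (i + a + 1) (by push_cast at hj; omega) hj' rfl
    simp only [show y + 1 ≤ y + (b + 1) by omega, if_true,
      show y + (b + 1) - (y + 1) = b by omega]
    rw [Category.assoc, h, Preadditive.comp_add, ← Category.assoc, e₁, Preadditive.comp_zsmul,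
      Preadditive.nsmul_comp]
    push_cast
    module

/-- The induction over `n` runs over truncated sums, at the cost of a remainder from the
cancellations in the last summand. The coefficients match by Pascal's rule and the absorption
identity `succ_mul_choose_succ`. -/
theorem sum_term_e (a b n : ℕ) (i j j' : ℤ) (hj : j = i + a - b) (hj' : j' = j + 1) (M : ℤ)
    (hM : M = c + 2 * i + a - b) :
    (∑ y ∈ Finset.range (n + 1), Ring.choose M y • S.term a b i j y) ≫ S.e 1 j j' =
      (a + 1) • (∑ y ∈ Finset.range (n + 1), Ring.choose (M + 1) y • S.term (a + 1) b i j' y) +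
        (Ring.choose M n * (M + a - n + 1)) • S.term (a + 1) b i j' (n + 1) := by
  induction n with
  | zero =>
    simp only [zero_add, Finset.range_one, Finset.sum_singleton, Ring.choose_zero_right, one_smul,
      S.term_e a b 0 i j j' hj hj', hM]
    push_cast
    module
  | succ n ih =>
    have h := succ_mul_choose_succ M n
    have h' : (a + 1) • Ring.choose (M + 1) (n + 1) = Ring.choose M n * (M + a - n + 1) +
        Ring.choose M (n + 1) * ((a : ℤ) + 1 - (n + 1)) := by
      rw [Ring.choose_succ_succ, nsmul_eq_mul]
      push_cast
      linear_combination h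
    rw [Finset.sum_range_succ, Preadditive.add_comp, ih, Finset.sum_range_succ _ (n + 1),
      Preadditive.zsmul_comp, S.term_e a b (n + 1) i j j' hj hj', nsmul_add, ← smul_assoc, h', hM]
    push_cast
    module

/-- Induction on `a`, one raising operator at a time; absence of torsion permits the division by a +
1. -/
theorem f_e (a b : ℕ) (i r j : ℤ) (hr : r = i - b) (hj : j = r + a) :
    S.f b i r ≫ S.e a r j = ∑ y ∈ Finset.range (b + 1),
      Ring.choose (c + 2 * i + a - b) y • S.term a b i j y := by
  induction a generalizing j with
  | zero =>
    obtain rfl : j = r := by push_cast at hj; omega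
    rw [Finset.sum_eq_single_of_mem 0 (by simp)]
    · simp [term, S.e_zero, S.f_p]
      rw [show i + 0 - 0 = i by ring, S.e_zero, S.p_f]
    · intro y _ hy
      simp [term, hy]
  | succ a ih =>
    refine nsmul_right_injective (Nat.succ_ne_zero a) ?_
    dsimp only
    have h := S.sum_term_e a b b i (r + a) j (by omega) (by push_cast at hj; omega) _ rfl
    rw [← ih (r + a) rfl, Category.assoc, S.e_succ a r (r + a) j rfl (by push_cast at hj; omega),
      Preadditive.comp_nsmul] at h
    rw [h]
    -- At the truncation `n = b` the remainder would need a lowering operator of negative divided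
    -- power, so it is zero.
    simp only [term, show ¬ b + 1 ≤ b by omega, and_false, if_false, smul_zero, add_zero]
    push_cast
    simp only [show c + 2 * i + (a : ℤ) - b + 1 = c + 2 * i + (a + 1) - b by ring]

end WeightOperators

end Weights

/-! ### The ladders e and f as raising and lowering operators -/

namespace OrthoAction

variable {N : ℕ} {D : Type u} [Category.{v} D] [Preadditive D] (A : OrthoAction N D)

/-- The ladder `e^{(a)}`. -/
def ladderE {a k l p q : ℕ} (hp : k + a = p) (hq : a + l = q) (Z : D) :
    (A.F k).obj ((A.F l).obj Z) ⟶ (A.F p).obj ((A.F q).obj Z) :=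
  (A.F k).map (A.cup a _) ≫ (A.F k).map ((A.F a).map (A.m hq Z)) ≫ A.m hp _

/-- The ladder `f^{(b)}`. -/
def ladderF {b k l p q : ℕ} (hp : p + b = k) (hq : b + q = l) (Z : D) :
    (A.F k).obj ((A.F l).obj Z) ⟶ (A.F p).obj ((A.F q).obj Z) :=
  (A.F k).map (A.s hq Z) ≫ A.s hp _ ≫ (A.F p).map (A.cap b _)

theorem ladderE_zero {k l : ℕ} (hp : k + 0 = k) (hq : 0 + l = l) (Z : D) :
    A.ladderE hp hq Z = 𝟙 _ := by
  simp only [ladderE, A.cup_zero, A.m_zero_left, A.m_zero_right, ← Functor.map_comp, A.unit_nat]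
  simp

theorem ladderF_zero {k l : ℕ} (hp : k + 0 = k) (hq : 0 + l = l) (Z : D) :
    A.ladderF hp hq Z = 𝟙 _ := by
  simp only [ladderF, A.cap_zero, A.s_zero_left, A.s_zero_right, ← Functor.map_comp]
  simp

/-- Coassociativity collects the two rungs into splits of thickness b + 1, and the two nested caps
form the explosion of the cap of that thickness. -/
theorem ladderF_succ {b k l p q p' q' : ℕ} (hp : p + b = k) (hq : b + q = l) (hp' : p' + 1 = p)
    (hq' : 1 + q' = q) (Hp : p' + (b + 1) = k) (Hq : b + 1 + q' = l) (Z : D) :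
    A.ladderF hp hq Z ≫ A.ladderF hp' hq' Z = (b + 1) • A.ladderF Hp Hq Z := by
  have h : 1 + b = b + 1 := Nat.add_comm _ _
  simp only [ladderF, Category.assoc]
  rw [← Preadditive.comp_nsmul, ← Preadditive.comp_nsmul, ← Functor.map_nsmul, A.cap_succ h,
    ← A.cap_nat₁_assoc]
  simp only [Functor.map_comp]
  rw [A.s_nat_assoc hp', ← A.s_nat_assoc hp, A.s_coassoc_assoc hp' h hp Hp, ← A.s_nat_assoc Hp,
    ← A.s_coassoc₁_assoc rfl hq' Hq hq]

section TorsionFree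

variable [∀ X Y : D, IsAddTorsionFree (X ⟶ Y)]

theorem ladderE_succ {a k l p q p' q' : ℕ} (hp : k + a = p) (hq : a + l = q) (hp' : p + 1 = p')
    (hq' : 1 + q = q') (Hp : k + (a + 1) = p') (Hq : a + 1 + l = q') (Z : D) :
    A.ladderE hp hq Z ≫ A.ladderE hp' hq' Z = (a + 1) • A.ladderE Hp Hq Z := by
  have h : 1 + a = a + 1 := Nat.add_comm _ _
  simp only [ladderE, Category.assoc]
  have e := congrArg (A.F k).map (A.cup_succ' h ((A.F l).obj Z))
  simp only [Functor.map_comp, Functor.map_nsmul] at e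
  rw [← Preadditive.nsmul_comp, e, ← A.m_nat_assoc hp, ← A.m_nat_assoc hp, A.m_assoc hp rfl hp' Hp]
  simp only [Category.assoc]
  rw [← A.m_nat₁_assoc, A.cup_nat₂_assoc]
  have e₁ := congrArg (fun f => (A.F k).map ((A.F a).map ((A.F 1).map f)))
    (A.m_assoc h hq Hq hq' Z)
  simp only [Functor.map_comp] at e₁
  rw [reassoc_of% e₁]

/-- A cup and a cap that overlap in two crossings can be pulled apart by sliding strands through
them. This makes the doubly crossed summand of the ladder commutator equal to `f` followed by `e`.
-/
theorem cross_cap_cup (Z : D) : (A.F 1).map (A.cup 1 _) ≫ (A.F 1).map ((A.F 1).map (A.x 1 1 Z)) ≫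
    A.x 1 1 _ ≫ (A.F 1).map (A.cap 1 _) = A.cap 1 Z ≫ A.cup 1 Z := by
  have e : A.cup 1 _ ≫ (A.F 1).map (A.x 1 1 Z) = (A.F 1).map (A.cup 1 Z) ≫ A.x 1 1 _ := by
    rw [← A.slide_cup_one, Category.assoc, Category.assoc, A.x_x₁, Category.comp_id]
  have e₁ : A.cap 1 _ = (A.F 1).map (A.x 1 1 ((A.F 1).obj Z)) ≫ A.x 1 1 _ ≫
      (A.F 1).map (A.cap 1 _) := by
    rw [← A.slide_cap_one, A.x_x_assoc, A.x_x₁_assoc]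
  rw [← Functor.map_comp_assoc, e, Functor.map_comp, Category.assoc, ← e₁, A.cap_nat]

theorem ladder_bubble_right {k : ℕ} (l : ℕ) (h : 1 + l = l + 1) (Z : D) :
    (A.F k).map (A.cup 1 _) ≫ (A.F k).map ((A.F 1).map (A.m h Z)) ≫
      (A.F k).map ((A.F 1).map (A.s h Z)) ≫ (A.F k).map (A.cap 1 _) = ((N : ℤ) - l) • 𝟙 _ := by
  have b := congrArg (A.F k).map (A.bubble l h Z)
  simp only [Functor.map_add, Functor.map_nsmul, CategoryTheory.Functor.map_id,
    Functor.map_comp, Category.assoc] at b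
  rw [sub_smul, eq_sub_iff_add_eq, natCast_zsmul, natCast_zsmul, b]

theorem ladder_bubble_left (k : ℕ) (W : D) : (A.F k).map (A.cup 1 W) ≫ A.m rfl _ ≫ A.s rfl _ ≫
    (A.F k).map (A.cap 1 W) = ((N : ℤ) - k) • 𝟙 _ := by
  cases k with
  | zero =>
    rw [A.m_zero_left, A.s_zero_left, Iso.hom_inv_id_assoc, ← Functor.map_comp, A.circle_one]
    simp
  | succ k =>
    have e := congrArg (A.F k).map (A.curl_one W)
    simp only [Functor.map_comp, CategoryTheory.Functor.map_id] at e
    rw [← Category.assoc (A.m _ _), A.m_s_right, Preadditive.sub_comp, Preadditive.comp_sub,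
      Category.id_comp, ← Functor.map_comp, A.circle_one]
    simp only [Category.assoc]
    rw [A.s_nat_assoc, ← A.m_nat, reassoc_of% e, A.digon, sub_smul,
      natCast_zsmul, natCast_zsmul]
    simp

/-- If one of the words' strands is absent no rung can be removed, and only a bubble on the other
strand is left. -/
theorem ladderE_ladderF_of_zero {k l p q : ℕ} (hp : k + 1 = p) (hq : 1 + l = q)
    (h : k = 0 ∨ l = 0) (Z : D) :
    A.ladderE hp hq Z ≫ A.ladderF hp hq Z = ((N : ℤ) - k - l) • 𝟙 _ := by
  subst hp
  obtain rfl : q = l + 1 := by omega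
  simp only [ladderE, ladderF, Category.assoc]
  rw [← A.m_nat_assoc]
  rcases h with rfl | rfl
  · rw [A.m_zero_left, A.s_zero_left, Iso.hom_inv_id_assoc, A.ladder_bubble_right]
    simp
  · have e : (A.F k).map ((A.F 1).map ((A.F 1).map (A.unit Z).hom)) ≫
        (A.F k).map ((A.F 1).map ((A.F 1).map (A.unit Z).inv)) = 𝟙 _ := by
      simp [← Functor.map_comp]
    rw [A.m_zero_right hq, A.s_zero_right hq, reassoc_of% e, A.ladder_bubble_left]
    simp

/-- Both merge-splits along the rung are replaced by one minus a crossing term. Of the four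
products, the identity gives N, the doubly crossed one gives `f` followed by `e`, and the singly
crossed ones give -k and -l. The latter values are read off from the one-sided bubbles `hL` and
`hR`, whose expansions contain the same webs. -/
theorem ladderE_ladderF {k l p q k' l' : ℕ} (hp : k + 1 = p) (hq : 1 + l = q)
    (hk : k' + 1 = k) (hl : 1 + l' = l) (Z : D) :
    A.ladderE hp hq Z ≫ A.ladderF hp hq Z =
      A.ladderF hk hl Z ≫ A.ladderE hk hl Z + ((N : ℤ) - k - l) • 𝟙 _ := by
  subst hp hk
  obtain rfl : l = l' + 1 := by omega
  obtain rfl : q = l' + 2 := by omega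
  simp only [ladderE, ladderF, Category.assoc]
  have hL := A.ladder_bubble_left (k' + 1) ((A.F (l' + 1)).obj Z)
  have hR := A.ladder_bubble_right (k := k' + 1) (l' + 1) hq Z
  have hc := congrArg (A.F k').map (A.cross_cap_cup ((A.F l').obj Z))
  simp only [Functor.map_comp] at hc
  have eL := A.m_s_right (rfl : k' + 1 + 1 = k' + 2)
    ((A.F (l' + 1)).obj Z)
  have eL₁ := A.m_s_right (rfl : k' + 1 + 1 = k' + 2)
    ((A.F 1).obj ((A.F (l' + 1)).obj Z))
  have eR := congrArg (fun f => (A.F (k' + 1)).map ((A.F 1).map f)) (A.m_s_left hq hl Z)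
  simp only [Functor.map_comp, Functor.map_sub, CategoryTheory.Functor.map_id] at eR
  have c₀ : (A.F (k' + 1)).map (A.cup 1 ((A.F (l' + 1)).obj Z)) ≫ (A.F (k' + 1)).map (A.cap 1 _) =
      (N : ℤ) • 𝟙 _ := by
    rw [← Functor.map_comp, A.circle_one]
    simp
  rw [← A.m_nat_assoc]
  rw [← Category.assoc (A.m rfl _), eL₁] at hL ⊢
  rw [reassoc_of% eR]
  rw [← Category.assoc ((A.F (k' + 1)).map ((A.F 1).map (A.m hq Z))), eR] at hR
  simp only [Preadditive.sub_comp, Preadditive.comp_sub, Category.id_comp,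
    Category.assoc] at hL hR ⊢
  rw [c₀] at hL hR ⊢
  have key : (A.F (k' + 1)).map (A.cup 1 ((A.F (l' + 1)).obj Z)) ≫
      (A.F (k' + 1)).map ((A.F 1).map ((A.F 1).map (A.s hl Z))) ≫
        (A.F (k' + 1)).map ((A.F 1).map (A.x 1 1 _)) ≫
          (A.F (k' + 1)).map ((A.F 1).map ((A.F 1).map (A.m hl Z))) ≫
            A.s rfl _ ≫ (A.F k').map (A.x 1 1 _) ≫ A.m rfl _ ≫ (A.F (k' + 1)).map (A.cap 1 _) =
      (A.F (k' + 1)).map (A.s hl Z) ≫ A.s rfl _ ≫ (A.F k').map (A.cap 1 _) ≫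
        (A.F k').map (A.cup 1 _) ≫ (A.F k').map ((A.F 1).map (A.m hl Z)) ≫ A.m rfl _ := by
    rw [← A.cup_nat₁_assoc, A.s_nat_assoc, A.s_nat_assoc, A.s_nat_assoc, ← A.m_nat,
      A.x_nat₁_assoc, A.cap_nat₂_assoc, reassoc_of% hc]
  rw [key]
  rw [sub_eq_iff_eq_add, ← sub_eq_iff_eq_add'] at hL
  rw [hR, ← hL]
  module

/-- The ladders between the words `(c + i) ⊗ (d + i)`, where words with a strand of negative
thickness do not count. -/
def ladders (c d : ℤ) (Z : D) :
    WeightOperators (fun i : ℤ => (A.F (c + i).toNat).obj ((A.F (d + i).toNat).obj Z))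
      (c + d - N) where
  e a i j := if h : 0 ≤ c + i ∧ 0 ≤ d + i ∧ j = i + a then
    A.ladderE (a := a) (by omega) (by omega) Z else 0
  f b i j := if h : 0 ≤ c + j ∧ 0 ≤ d + j ∧ i = j + b then
    A.ladderF (b := b) (by omega) (by omega) Z else 0
  p i := if 0 ≤ c + i ∧ 0 ≤ d + i then 𝟙 _ else 0
  e_zero i := by
    by_cases h : 0 ≤ c + i ∧ 0 ≤ d + i
    · rw [dif_pos (by simpa using h), if_pos h, A.ladderE_zero]
    · rw [dif_neg (by tauto), if_neg h]
  f_zero i := by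
    by_cases h : 0 ≤ c + i ∧ 0 ≤ d + i
    · rw [dif_pos (by simpa using h), if_pos h, A.ladderF_zero]
    · rw [dif_neg (by tauto), if_neg h]
  e_p a i j := by
    by_cases h : 0 ≤ c + i ∧ 0 ≤ d + i ∧ j = i + a
    · rw [if_pos (by omega), Category.comp_id]
    · rw [dif_neg h, Limits.zero_comp]
  f_p b i j := by
    by_cases h : 0 ≤ c + j ∧ 0 ≤ d + j ∧ i = j + b
    · rw [if_pos (by omega), Category.comp_id]
    · rw [dif_neg h, Limits.zero_comp]
  p_f b i j := by
    by_cases h : 0 ≤ c + j ∧ 0 ≤ d + j ∧ i = j + b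
    · rw [if_pos (by omega), Category.id_comp]
    · rw [dif_neg h, Limits.comp_zero]
  e_succ a i j r hj hr := by
    by_cases h : 0 ≤ c + i ∧ 0 ≤ d + i
    · rw [dif_pos (by omega), dif_pos (by omega), dif_pos (by omega)]
      exact A.ladderE_succ _ _ _ _ _ _ Z
    · rw [dif_neg (c := 0 ≤ c + i ∧ 0 ≤ d + i ∧ j = i + a) (by omega),
        dif_neg (c := 0 ≤ c + i ∧ 0 ≤ d + i ∧ r = i + (a + 1 : ℕ)) (by omega),
        Limits.zero_comp, nsmul_zero]
  f_succ b i j r hj hr := by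
    by_cases h : 0 ≤ c + r ∧ 0 ≤ d + r
    · rw [dif_pos (by omega), dif_pos (by omega), dif_pos (by omega)]
      exact A.ladderF_succ _ _ _ _ _ _ Z
    · rw [dif_neg (c := 0 ≤ c + r ∧ 0 ≤ d + r ∧ j = r + (1 : ℕ)) (by omega),
        dif_neg (c := 0 ≤ c + r ∧ 0 ≤ d + r ∧ i = r + (b + 1 : ℕ)) (by omega),
        Limits.comp_zero, nsmul_zero]
  comm i j r hj hr := by
    by_cases h : 0 ≤ c + i ∧ 0 ≤ d + i
    · rw [if_pos h, dif_pos (c := 0 ≤ c + i ∧ 0 ≤ d + i ∧ j = i + (1 : ℕ)) (by push_cast; omega),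
        dif_pos (c := 0 ≤ c + i ∧ 0 ≤ d + i ∧ j = i + (1 : ℕ)) (by push_cast; omega)]
      by_cases h' : 0 ≤ c + r ∧ 0 ≤ d + r
      · rw [dif_pos (by push_cast; omega), dif_pos (by push_cast; omega),
          A.ladderE_ladderF (k' := (c + r).toNat) (l' := (d + r).toNat) _ _ (by omega) (by omega),
          Int.toNat_of_nonneg h.1, Int.toNat_of_nonneg h.2]
        module
      -- The word below has a strand of negative thickness, so one of the two strands at `i` has
      -- thickness zero.
      · rw [dif_neg (by omega), Limits.zero_comp,
          A.ladderE_ladderF_of_zero _ _ (by omega), Int.toNat_of_nonneg h.1,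
          Int.toNat_of_nonneg h.2]
        module
    · rw [if_neg h, dif_neg (c := 0 ≤ c + i ∧ 0 ≤ d + i ∧ j = i + (1 : ℕ)) (by omega),
        dif_neg (c := 0 ≤ c + r ∧ 0 ≤ d + r ∧ i = r + (1 : ℕ)) (by omega), Limits.zero_comp,
        Limits.zero_comp,
        smul_zero, add_zero]

/-- The commutation formula `f_e` for the family of words `(k + i) ⊗ (l + i)`, started at `i = 0`
and ending at `i = a - b`. Integral weights with zero operators outside the admissible range account
for the vanishing conventions. -/
theorem ladderF_ladderE (k l a b p q : ℕ) (hp : k + a = p + b) (hq : l + a = q + b) (Z : D) :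
    (if H : b ≤ k ∧ b ≤ l then
      A.ladderF (b := b) (p := k - b) (q := l - b) (by omega) (by omega) Z ≫
        A.ladderE (a := a) (p := p) (q := q) (by omega) (by omega) Z
      else 0) =
    ∑ y ∈ Finset.range (min a b + 1), if H : y ≤ a ∧ y ≤ b then
      Ring.choose ((k : ℤ) + l - N + a - b) y •
        (A.ladderE (a := a - y) (k := k) (l := l) (p := k + (a - y)) (q := l + (a - y)) rfl
          (by omega) Z ≫ A.ladderF (b := b - y) (p := p) (q := q) (by omega) (by omega) Z)
      else 0 := by
  obtain ⟨c, hc⟩ : ∃ c : ℤ, (k : ℤ) = c := ⟨_, rfl⟩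
  obtain ⟨d, hd⟩ : ∃ d : ℤ, (l : ℤ) = d := ⟨_, rfl⟩
  rw [hc, hd]
  obtain rfl : k = (c + 0).toNat := by omega
  obtain rfl : l = (d + 0).toNat := by omega
  obtain rfl : p = (c + (-b + a)).toNat := by omega
  obtain rfl : q = (d + (-b + a)).toNat := by omega
  have h := (A.ladders c d Z).f_e a b 0 (-b) (-b + a) (by omega) rfl
  -- The middle words appear with different expressions for the same thicknesses; `e₁` and `e₂`
  -- identify the composites.
  have e₁ : ∀ {k l m n m' n' p q : ℕ} (h₁ : m + b = k) (h₂ : b + n = l) (h₃ : m + a = p)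
      (h₄ : a + n = q) (h₁' : m' + b = k) (h₂' : b + n' = l) (h₃' : m' + a = p)
      (h₄' : a + n' = q), A.ladderF h₁ h₂ Z ≫ A.ladderE h₃ h₄ Z =
        A.ladderF h₁' h₂' Z ≫ A.ladderE h₃' h₄' Z := by
    intros
    rename_i k l m n m' n' p q h₁ h₂ h₃ h₄ h₁' h₂' h₃' h₄'
    obtain rfl : m = m' := by omega
    obtain rfl : n = n' := by omega
    rfl
  have e₂ : ∀ {a b k l m n m' n' p q : ℕ} (h₁ : k + a = m) (h₂ : a + l = n) (h₃ : p + b = m)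
      (h₄ : b + q = n) (h₁' : k + a = m') (h₂' : a + l = n') (h₃' : p + b = m')
      (h₄' : b + q = n'), A.ladderE h₁ h₂ Z ≫ A.ladderF h₃ h₄ Z =
        A.ladderE h₁' h₂' Z ≫ A.ladderF h₃' h₄' Z := by
    intros
    rename_i k l m n m' n' p q h₁ h₂ h₃ h₄ h₁' h₂' h₃' h₄'
    obtain rfl : m = m' := by omega
    obtain rfl : n = n' := by omega
    rfl
  refine Eq.trans ?_ (h.trans ?_)
  · dsimp only [ladders]
    by_cases H : b ≤ (c + 0).toNat ∧ b ≤ (d + 0).toNat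
    · rw [dif_pos H, dif_pos (by omega), dif_pos (by omega)]
      exact e₁ _ _ _ _ _ _ _ _
    · rw [dif_neg H, dif_neg (by omega), Limits.zero_comp]
  -- The formula sums up to `b`; the summands with y > min a b have a negative divided power and
  -- vanish.
  · rw [← Finset.sum_subset (Finset.range_subset_range.2
      (show min a b + 1 ≤ b + 1 by omega)) (fun y _ hy => ?_)]
    · refine Finset.sum_congr rfl fun y hy => ?_
      have hy' : y ≤ a ∧ y ≤ b := by rw [Finset.mem_range] at hy; omega
      rw [dif_pos hy', mul_zero, add_zero (c + d - (N : ℤ)), WeightOperators.term, if_pos hy']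
      dsimp only [ladders]
      rw [dif_pos (by omega), dif_pos (by omega)]
      congr 1
      exact e₂ _ _ _ _ _ _ _ _
    · rw [Finset.mem_range] at hy
      rw [WeightOperators.term, if_neg (by omega), smul_zero]

end TorsionFree

end OrthoAction

/-! ### Webs acting on strands placed one by one -/

section Evaluation

variable {𝕜 : Type} [CommRing 𝕜] (P : Presentation 𝕜)

/-- The functor that places a word to the left of another one, strand by strand. -/
@[reducible]
def place : Ob → Presented P ⥤ Presented P
  | .unit => 𝟭 _
  | .of m => tensorLeft ⟨.of m⟩
  | .tensor X Y => place Y ⋙ place X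

instance (X : Ob) : (place P X).Additive := by
  induction X with
  | unit => infer_instance
  | of m => exact inferInstanceAs (tensorLeft (⟨.of m⟩ : Presented P)).Additive
  | tensor X Y hX hY => infer_instance

instance (X : Ob) : (place P X).Linear 𝕜 := by
  induction X with
  | unit => infer_instance
  | of m => exact inferInstanceAs ((tensorLeft (⟨.of m⟩ : Presented P)).Linear 𝕜)
  | tensor X Y hX hY => infer_instance

/-- Placing a word strand by strand amounts to forming the tensor product. -/
def placeIso : ∀ (X : Ob) (Z : Presented P), (⟨X⟩ : Presented P) ⊗ Z ≅ (place P X).obj Z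
  | .unit, Z => λ_ Z
  | .of _, Z => Iso.refl _
  | .tensor X Y, Z => α_ (⟨X⟩ : Presented P) ⟨Y⟩ Z ≪≫
      whiskerLeftIso ⟨X⟩ (placeIso Y Z) ≪≫ placeIso X ((place P Y).obj Z)

theorem placeIso_tensor (X Y : Ob) (Z : Presented P) : (placeIso P (X ⊙ Y) Z).hom =
    (α_ (⟨X⟩ : Presented P) ⟨Y⟩ Z).hom ≫ (⟨X⟩ : Presented P) ◁ (placeIso P Y Z).hom ≫
      (placeIso P X ((place P Y).obj Z)).hom := rfl

theorem placeIso_natural (X : Ob) {Z Z' : Presented P} (g : Z ⟶ Z') :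
    (⟨X⟩ : Presented P) ◁ g ≫ (placeIso P X Z').hom = (placeIso P X Z).hom ≫ (place P X).map g := by
  induction X generalizing Z Z' with
  | unit => exact leftUnitor_naturality g
  | of m =>
    change _ ≫ 𝟙 _ = 𝟙 _ ≫ _
    rw [Category.comp_id, Category.id_comp]
    rfl
  | tensor X Y hX hY =>
    have h := associator_naturality_right (⟨X⟩ : Presented P) ⟨Y⟩ g
    rw [placeIso_tensor, placeIso_tensor]
    change ((⟨X⟩ : Presented P) ⊗ ⟨Y⟩) ◁ g ≫ _ = _ ≫ (place P X).map ((place P Y).map g)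
    rw [reassoc_of% h, ← MonoidalCategory.whiskerLeft_comp_assoc, hY,
      MonoidalCategory.whiskerLeft_comp_assoc, hX]
    simp only [Category.assoc]

variable {P}

/-- The web given by a term, with another object on its right, acting on strands that are placed
one by one, so that associators and unitors become identities. -/
def Tm.act : ∀ {X Y : Ob}, Tm 𝕜 P.Gen X Y → ∀ Z : Presented P,
    (place P X).obj Z ⟶ (place P Y).obj Z
  | X, Y, .gen g,
    Z => (placeIso P X Z).inv ≫ (Tm.gen g : Tm 𝕜 P.Gen X Y).mk ▷ Z ≫ (placeIso P Y Z).hom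
  | _, _, .id _, _ => 𝟙 _
  | _, _, .comp f g, Z => f.act Z ≫ g.act Z
  | _, _, @Tm.tensor _ _ X _ _ Y' f g, Z => (place P X).map (g.act Z) ≫ f.act ((place P Y').obj Z)
  | _, _, .assoc _ _ _, _ => 𝟙 _
  | _, _, .assocInv _ _ _, _ => 𝟙 _
  | _, _, .lUnit _, _ => 𝟙 _
  | _, _, .lUnitInv _, _ => 𝟙 _
  | _, _, .rUnit _, _ => 𝟙 _
  | _, _, .rUnitInv _, _ => 𝟙 _
  | _, _, .zero _ _, _ => 0
  | _, _, .add f g, Z => f.act Z + g.act Z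
  | _, _, .smul c f, Z => c • f.act Z

/-- This is the pentagon. With the analogous lemmas for unitors it is the reason why structural
morphisms may act as identities. -/
theorem placeIso_assoc (X Y W : Ob) (Z : Presented P) :
    (Tm.assoc X Y W : Tm 𝕜 P.Gen _ _).mk ▷ Z ≫ (placeIso P (X ⊙ (Y ⊙ W)) Z).hom =
      (placeIso P ((X ⊙ Y) ⊙ W) Z).hom := by
  simp only [placeIso_tensor, MonoidalCategory.whiskerLeft_comp, Category.assoc]
  have h' := associator_naturality_right (⟨X⟩ : Presented P) ⟨Y⟩ (placeIso P W Z).hom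
  refine (pentagon_assoc (⟨X⟩ : Presented P) ⟨Y⟩ ⟨W⟩ Z _).trans ?_
  rw [← reassoc_of% h']
  rfl

theorem placeIso_lUnit (X : Ob) (Z : Presented P) :
    (Tm.lUnit X : Tm 𝕜 P.Gen _ _).mk ▷ Z ≫ (placeIso P X Z).hom =
      (placeIso P (.unit ⊙ X) Z).hom := by
  have h := leftUnitor_tensor_hom (⟨X⟩ : Presented P) Z
  change (λ_ (⟨X⟩ : Presented P)).hom ▷ Z ≫ _ = (α_ (𝟙_ (Presented P)) ⟨X⟩ Z).hom ≫
    𝟙_ (Presented P) ◁ (placeIso P X Z).hom ≫ (λ_ _).hom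
  rw [leftUnitor_naturality, h]
  simp

theorem placeIso_rUnit (X : Ob) (Z : Presented P) :
    (Tm.rUnit X : Tm 𝕜 P.Gen _ _).mk ▷ Z ≫ (placeIso P X Z).hom =
      (placeIso P (X ⊙ .unit) Z).hom := by
  exact (MonoidalCategory.triangle_assoc (⟨X⟩ : Presented P) Z _).symm

/-- The action is whiskering conjugated by `placeIso`. As the action is defined by recursion on
terms rather than by this formula, coherence is dealt with here, by induction over the term. -/
theorem Tm.act_spec {X Y : Ob} (f : Tm 𝕜 P.Gen X Y) (Z : Presented P) :
    f.mk ▷ Z ≫ (placeIso P Y Z).hom = (placeIso P X Z).hom ≫ f.act Z := by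
  induction f generalizing Z with
  | gen g => simp [Tm.act]
  | id X =>
    change (𝟙 (⟨X⟩ : Presented P)) ▷ Z ≫ _ = _ ≫ 𝟙 _
    simp
  | @comp X Y W f g hf hg =>
    change (f.mk ≫ g.mk) ▷ Z ≫ _ = _ ≫ f.act Z ≫ g.act Z
    rw [comp_whiskerRight_assoc, hg, reassoc_of% hf]
  | @tensor X Y X' Y' f g hf hg =>
    change (f.mk ⊗ₘ g.mk) ▷ Z ≫ _ = _ ≫ (place P X).map (g.act Z) ≫ f.act ((place P Y').obj Z)
    have h := associator_naturality f.mk g.mk (𝟙 Z)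
    rw [MonoidalCategory.tensorHom_id, MonoidalCategory.tensorHom_id] at h
    rw [placeIso_tensor, reassoc_of% h, MonoidalCategory.tensorHom_def' f.mk, Category.assoc,
      ← whisker_exchange_assoc, ← MonoidalCategory.whiskerLeft_comp_assoc, hg, hf,
      MonoidalCategory.whiskerLeft_comp_assoc, reassoc_of% placeIso_natural P X (g.act Z),
      placeIso_tensor]
    simp only [Category.assoc]
  | assoc X Y W => exact (placeIso_assoc X Y W Z).trans (Category.comp_id _).symm
  | assocInv X Y W =>
    rw [← placeIso_assoc, ← comp_whiskerRight_assoc]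
    have h : (Tm.assocInv X Y W : Tm 𝕜 P.Gen _ _).mk ≫ (Tm.assoc X Y W : Tm 𝕜 P.Gen _ _).mk = 𝟙 _ :=
      (α_ (⟨X⟩ : Presented P) ⟨Y⟩ ⟨W⟩).inv_hom_id
    rw [h, id_whiskerRight, Category.id_comp]
    exact (Category.comp_id _).symm
  | lUnit X => exact (placeIso_lUnit X Z).trans (Category.comp_id _).symm
  | lUnitInv X =>
    rw [← placeIso_lUnit, ← comp_whiskerRight_assoc]
    have h : (Tm.lUnitInv X : Tm 𝕜 P.Gen _ _).mk ≫ (Tm.lUnit X : Tm 𝕜 P.Gen _ _).mk = 𝟙 _ :=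
      (λ_ (⟨X⟩ : Presented P)).inv_hom_id
    rw [h, id_whiskerRight, Category.id_comp]
    exact (Category.comp_id _).symm
  | rUnit X => exact (placeIso_rUnit X Z).trans (Category.comp_id _).symm
  | rUnitInv X =>
    rw [← placeIso_rUnit, ← comp_whiskerRight_assoc]
    have h : (Tm.rUnitInv X : Tm 𝕜 P.Gen _ _).mk ≫ (Tm.rUnit X : Tm 𝕜 P.Gen _ _).mk = 𝟙 _ :=
      (ρ_ (⟨X⟩ : Presented P)).inv_hom_id
    rw [h, id_whiskerRight, Category.id_comp]
    exact (Category.comp_id _).symm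
  | zero X Y =>
    change (0 : (⟨X⟩ : Presented P) ⟶ ⟨Y⟩) ▷ Z ≫ _ = _ ≫ 0
    simp
  | add f g hf hg =>
    change (f.mk + g.mk) ▷ Z ≫ _ = _ ≫ (f.act Z + g.act Z)
    rw [MonoidalPreadditive.add_whiskerRight, Preadditive.add_comp, hf, hg, Preadditive.comp_add]
  | smul c f hf =>
    change (c • f.mk) ▷ Z ≫ _ = _ ≫ (c • f.act Z)
    rw [MonoidalLinear.smul_whiskerRight, Linear.smul_comp, hf, Linear.comp_smul]

theorem Tm.act_eq {X Y : Ob} (f : Tm 𝕜 P.Gen X Y) (Z : Presented P) :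
    f.act Z = (placeIso P X Z).inv ≫ f.mk ▷ Z ≫ (placeIso P Y Z).hom := by
  rw [f.act_spec, Iso.inv_hom_id_assoc]

theorem Tm.act_natural {X Y : Ob} (f : Tm 𝕜 P.Gen X Y) {Z Z' : Presented P} (g : Z ⟶ Z') :
    (place P X).map g ≫ f.act Z' = f.act Z ≫ (place P Y).map g := by
  rw [← cancel_epi (placeIso P X Z).hom, ← reassoc_of% placeIso_natural P X g, ← f.act_spec,
    ← reassoc_of% f.act_spec, whisker_exchange_assoc, placeIso_natural]

theorem Eqv.act_eq {X Y : Ob} {f g : Tm 𝕜 P.Gen X Y} (h : Eqv P f g) (Z : Presented P) :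
    f.act Z = g.act Z := by
  rw [Tm.act_eq, Tm.act_eq]
  have e : f.mk (P := P) = g.mk := Quotient.sound (s := eqvSetoid P X Y) h
  rw [e]

/-- Acting on the monoidal unit already recovers the web, up to the right unitor. -/
theorem Eqv.of_act_eq {X Y : Ob} {f g : Tm 𝕜 P.Gen X Y} (h : ∀ Z, f.act Z = g.act Z) :
    Eqv P f g := by
  have h₁ := h (𝟙_ _)
  rw [Tm.act_eq, Tm.act_eq, cancel_epi, cancel_mono] at h₁
  have h₂ : f.mk (P := P) = g.mk := by
    rw [← cancel_epi (ρ_ (⟨X⟩ : Presented P)).hom, ← rightUnitor_naturality,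
      ← rightUnitor_naturality, h₁]
  exact Quotient.exact h₂

theorem mk_eq_iff {X Y : Ob} {f g : Tm 𝕜 P.Gen X Y} :
    f.mk (P := P) = g.mk ↔ ∀ Z, f.act Z = g.act Z :=
  ⟨fun h => Eqv.act_eq (Quotient.exact h),
    fun h => Quotient.sound (s := eqvSetoid P X Y) (.of_act_eq h)⟩

/-! The action on composite terms. -/

section

variable {X Y X' Y' W : Ob} (Z : Presented P)

theorem act_id : (Tm.id X : Tm 𝕜 P.Gen X X).act Z = 𝟙 _ := rfl
theorem act_comp (f : Tm 𝕜 P.Gen X Y) (g : Tm 𝕜 P.Gen Y W) :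
    (f ⨟ g).act Z = f.act Z ≫ g.act Z := rfl
theorem act_tensor (f : Tm 𝕜 P.Gen X Y) (g : Tm 𝕜 P.Gen X' Y') :
    (f ⊠ g).act Z = (place P X).map (g.act Z) ≫ f.act ((place P Y').obj Z) := rfl
theorem act_assoc : (Tm.assoc X Y W : Tm 𝕜 P.Gen _ _).act Z = 𝟙 _ := rfl
theorem act_assocInv : (Tm.assocInv X Y W : Tm 𝕜 P.Gen _ _).act Z = 𝟙 _ := rfl
theorem act_lUnit : (Tm.lUnit X : Tm 𝕜 P.Gen _ _).act Z = 𝟙 _ := rfl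
theorem act_lUnitInv : (Tm.lUnitInv X : Tm 𝕜 P.Gen _ _).act Z = 𝟙 _ := rfl
theorem act_rUnit : (Tm.rUnit X : Tm 𝕜 P.Gen _ _).act Z = 𝟙 _ := rfl
theorem act_rUnitInv : (Tm.rUnitInv X : Tm 𝕜 P.Gen _ _).act Z = 𝟙 _ := rfl
theorem act_zero : (Tm.zero X Y : Tm 𝕜 P.Gen _ _).act Z = 0 := rfl
theorem act_add (f g : Tm 𝕜 P.Gen X Y) : (f.add g).act Z = f.act Z + g.act Z := rfl
theorem act_smul (c : 𝕜) (f : Tm 𝕜 P.Gen X Y) : (f.smul c).act Z = c • f.act Z := rfl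

theorem act_mid (A B : Ob) {C E : Ob} (f : Tm 𝕜 P.Gen (X ⊙ Y) (C ⊙ E)) :
    (Tm.mid A B f).act Z = (place P A).map (f.act ((place P B).obj Z)) := by
  change 𝟙 _ ≫ ((place P A).map (𝟙 _ ≫ (((place P X).map ((place P Y).map (𝟙 _))) ≫ f.act _) ≫
    𝟙 _) ≫ 𝟙 _) ≫ 𝟙 _ = _
  simp only [Category.id_comp, Category.comp_id, CategoryTheory.Functor.map_id]

theorem act_insert (A B : Ob) (f : Tm 𝕜 P.Gen .unit (X ⊙ Y)) :
    (Tm.insert A B f).act Z = (place P A).map (f.act ((place P B).obj Z)) := by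
  change ((place P A).map (𝟙 _ ≫ (𝟙 _ ≫ f.act _) ≫ 𝟙 _) ≫ 𝟙 _) ≫ 𝟙 _ = _
  simp only [Category.id_comp, Category.comp_id]

theorem act_contract (A B : Ob) (f : Tm 𝕜 P.Gen (X ⊙ Y) .unit) :
    (Tm.contract A B f).act Z = (place P A).map (f.act ((place P B).obj Z)) := by
  change 𝟙 _ ≫ ((place P A).map (𝟙 _ ≫ (((place P X).map ((place P Y).map (𝟙 _))) ≫ f.act _) ≫
    𝟙 _) ≫ 𝟙 _) = _
  simp only [Category.id_comp, Category.comp_id, CategoryTheory.Functor.map_id]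

theorem act_sumRange (n : ℕ) (f : ℕ → Tm 𝕜 P.Gen X Y) :
    (Tm.sumRange n f).act Z = ∑ y ∈ Finset.range n, (f y).act Z := by
  induction n with
  | zero => rfl
  | succ n ih => rw [Finset.sum_range_succ, ← ih]; rfl

end

end Evaluation

section

variable {𝕜 : Type} [Field 𝕜] [CharZero 𝕜] {P : Presentation 𝕜}

/-- Nonzero integers are invertible scalars; this supplies the hypothesis under which webs are
cancelled. -/
instance (X Y : Presented P) : IsAddTorsionFree (X ⟶ Y) where
  nsmul_right_injective n hn f g h := by
    have hn' : (n : 𝕜) ≠ 0 := Nat.cast_ne_zero.2 hn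
    have h' : (n : 𝕜) • f = (n : 𝕜) • g := by
      simpa only [Nat.cast_smul_eq_nsmul] using h
    simpa [smul_smul, inv_mul_cancel₀ hn'] using congrArg (fun t => (n : 𝕜)⁻¹ • t) h'

end

/-! ### Type A relations as a web action -/

section

variable {𝕜 : Type} [CommRing 𝕜] {P : Presentation 𝕜} (ι : ∀ ⦃X Y : Ob⦄, AGen X Y → P.Gen X Y)
  {N : ℕ} (hA : ∀ ⦃X Y : Ob⦄ {f g : Tm 𝕜 P.Gen X Y}, TypeARel ι N f g → P.Rel f g)

theorem TypeARel.act_eq {X Y : Ob} {f g : Tm 𝕜 P.Gen X Y} (h : TypeARel ι N f g)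
    (hA : ∀ ⦃X Y : Ob⦄ {f g : Tm 𝕜 P.Gen X Y}, TypeARel ι N f g → P.Rel f g)
    (Z : Presented P) : f.act Z = g.act Z :=
  Eqv.act_eq (.rel (hA h)) Z

theorem act_crossedLadder (k l r s a b : ℕ) (ha : a ≤ k) (hb : b ≤ l) (hr : k + b = r + a)
    (hs : k + l = r + s) (Z : Presented P) :
    (crossedLadder ι k l r s a b ha hb hr hs : Tm 𝕜 P.Gen _ _).act Z =
      (place P (ob k)).map ((split ι b (l - b) l (by omega)).act Z) ≫
      (split ι (k - a) a k (by omega)).act _ ≫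
      (place P (ob (k - a))).map ((cross ι a b).act _) ≫
      (place P (ob (k - a))).map ((place P (ob b)).map ((merge ι a (l - b) s (by omega)).act Z)) ≫
      (merge ι (k - a) b r (by omega)).act _ := by
  rw [crossedLadder, act_comp, act_comp, act_tensor, act_tensor, act_mid]
  simp only [Category.assoc]
  rfl

/-- Webs act on strands that are placed one by one. -/
def webAction : WebAction (Presented P) where
  F k := place P (ob k)
  F_additive _ := inferInstance
  -- The word `ob 0` is the unit, and placing the unit is the identity functor by definition.
  unit Z := Iso.refl Z
  unit_nat f := (Category.comp_id _).trans (Category.id_comp _).symm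
  m h Z := (merge ι _ _ _ h).act Z
  s h Z := (split ι _ _ _ h).act Z
  x k l Z := (cross ι k l).act Z
  m_nat h _ _ f := (merge ι _ _ _ h).act_natural f
  s_nat h _ _ f := (split ι _ _ _ h).act_natural f
  x_nat k l _ _ f := (cross ι k l).act_natural f
  m_zero_left _ Z := (TypeARel.merge_zero_left _).act_eq ι hA Z
  m_zero_right _ Z := ((TypeARel.merge_zero_right _).act_eq ι hA Z).trans
    (CategoryTheory.Functor.map_id _ _).symm
  s_zero_left _ Z := (TypeARel.split_zero_left _).act_eq ι hA Z
  s_zero_right _ Z := ((TypeARel.split_zero_right _).act_eq ι hA Z).trans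
    (CategoryTheory.Functor.map_id _ _).symm
  x_zero_left _ Z := ((TypeARel.cross_zero_left _).act_eq ι hA Z).trans
    (congrArg (𝟙 _ ≫ ·) (CategoryTheory.Functor.map_id _ _).symm)
  x_zero_right _ Z := ((TypeARel.cross_zero_right _).act_eq ι hA Z).trans
    (congrArg (· ≫ 𝟙 _) (CategoryTheory.Functor.map_id _ _).symm)
  m_assoc hp hq h₁ h₂ Z := by
    have h := (TypeARel.associativity _ _ _ _ _ _ hp hq h₁ h₂).act_eq ι hA Z
    simp only [act_comp, act_tensor, act_id, act_assoc, CategoryTheory.Functor.map_id,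
      Category.id_comp, Category.comp_id] at h
    exact h
  s_coassoc hp hq h₁ h₂ Z := by
    have h := (TypeARel.coassociativity _ _ _ _ _ _ hp hq h₁ h₂).act_eq ι hA Z
    simp only [act_comp, act_tensor, act_id, act_assocInv, CategoryTheory.Functor.map_id,
      Category.id_comp, Category.comp_id] at h
    exact h
  digon h Z := by
    have h := (TypeARel.digon _ _ _ h).act_eq ι hA Z
    rwa [act_comp, act_smul, act_id, Nat.cast_smul_eq_nsmul] at h
  schur {k l r t n} h h' Z := by
    have e := (TypeARel.schur k l r t n h h').act_eq ι hA Z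
    rw [act_comp] at e
    refine e.trans ?_
    simp only [act_sumRange]
    rw [← Finset.sum_product']
    -- The relation sums over all pairs `(a, b)` in a rectangle, with zero for pairs that do not
    -- fit; ladders are exactly the pairs that do.
    refine (Finset.sum_of_injOn (fun i : Ladder k l r t => (i.a, i.b)) ?_ ?_ ?_ ?_).symm
    · intro i _ j _ hij
      refine Ladder.ext_of_p ?_
      have h₁ := i.hk
      have h₂ := j.hk
      have h₃ : i.a = j.a := congrArg Prod.fst hij
      omega
    · intro i _
      have h₁ := i.hk
      have h₂ := i.hl
      simp only [Finset.coe_product, Set.mem_prod, Finset.coe_range, Set.mem_Iio]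
      omega
    · rintro ⟨a, b⟩ _ hi
      dsimp only
      rw [dif_neg]
      · rfl
      · rintro ⟨ha, hb, hr⟩
        exact hi ⟨⟨k - a, a, b, l - b, by omega, by omega, by omega, by omega⟩, by simp, rfl⟩
    · rintro ⟨p, a, b, q, hk, hl, hr, hs⟩ _
      obtain rfl : p = k - a := by omega
      obtain rfl : q = l - b := by omega
      dsimp only
      rw [dif_pos ⟨by omega, by omega, by omega⟩, act_smul, act_crossedLadder,
        ← Int.cast_smul_eq_zsmul 𝕜]
      push_cast
      rfl

end

/-! ### A criterion for symmetric ribbon categories -/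

section Ribbon

variable {𝕜 : Type} [CommRing 𝕜] {P : Presentation 𝕜} (ι : ∀ ⦃X Y : Ob⦄, AGen X Y → P.Gen X Y)
  (cap : ∀ k : ℕ, Tm 𝕜 P.Gen (ob k ⊙ ob k) Ob.unit)
  (cup : ∀ k : ℕ, Tm 𝕜 P.Gen Ob.unit (ob k ⊙ ob k))

/-- The relations between crossings, caps, cups and the other generators which make the presented
category symmetric ribbon. -/
structure RibbonRelations : Prop where
  cross_cross : ∀ (k l : ℕ) (Z : Presented P),
    (cross ι k l : Tm 𝕜 P.Gen _ _).act Z ≫ (cross ι l k : Tm 𝕜 P.Gen _ _).act Z = 𝟙 _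
  gen_natural : ∀ (m : ℕ) {X Y : Ob} (g : P.Gen X Y) (Z : Presented P),
    (place P (.of m)).map ((Tm.gen g : Tm 𝕜 P.Gen _ _).act Z) ≫
        (braidStrand ι m Y : Tm 𝕜 P.Gen _ _).act Z =
      (braidStrand ι m X : Tm 𝕜 P.Gen _ _).act Z ≫ (Tm.gen g : Tm 𝕜 P.Gen _ _).act _
  zigzag_left : ∀ (k : ℕ) (Z : Presented P),
    (place P (ob k)).map ((cup k).act Z) ≫ (cap k).act _ = 𝟙 _
  zigzag_right : ∀ (k : ℕ) (Z : Presented P),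
    (cup k).act _ ≫ (place P (ob k)).map ((cap k).act Z) = 𝟙 _
  cross_cap : ∀ (k : ℕ) (Z : Presented P),
    (cross ι k k : Tm 𝕜 P.Gen _ _).act Z ≫ (cap k).act Z = (cap k).act Z

/-- The action of the braiding of words. -/
def braidAct (X Y : Ob) (Z : Presented P) :
    (place P X).obj ((place P Y).obj Z) ⟶ (place P Y).obj ((place P X).obj Z) :=
  (braidWord ι X Y : Tm 𝕜 P.Gen _ _).act Z

theorem braidAct_natural (X Y : Ob) {Z Z' : Presented P} (g : Z ⟶ Z') :
    (place P X).map ((place P Y).map g) ≫ braidAct ι X Y Z' =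
      braidAct ι X Y Z ≫ (place P Y).map ((place P X).map g) :=
  (braidWord ι X Y : Tm 𝕜 P.Gen _ _).act_natural g

theorem braidAct_unit_left (Y : Ob) (Z : Presented P) : braidAct ι .unit Y Z = 𝟙 _ :=
  Category.comp_id _

theorem braidAct_tensor_left (X X' Y : Ob) (Z : Presented P) : braidAct ι (X ⊙ X') Y Z =
    (place P X).map (braidAct ι X' Y Z) ≫ braidAct ι X Y ((place P X').obj Z) := by
  simp only [braidAct, braidWord, act_comp, act_assoc, act_assocInv, act_tensor, act_id,
    Category.id_comp, Category.comp_id, CategoryTheory.Functor.map_id]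

theorem braidAct_unit_right (X : Ob) (Z : Presented P) : braidAct ι X .unit Z = 𝟙 _ := by
  induction X generalizing Z with
  | unit => exact Category.comp_id _
  | of m => exact Category.comp_id _
  | tensor X X' h h' =>
    rw [braidAct_tensor_left, h', h, CategoryTheory.Functor.map_id]
    exact Category.comp_id _

theorem braidAct_tensor_right (X Y Y' : Ob) (Z : Presented P) : braidAct ι X (Y ⊙ Y') Z =
    braidAct ι X Y ((place P Y').obj Z) ≫ (place P Y).map (braidAct ι X Y' Z) := by
  induction X generalizing Z with
  | unit =>
    rw [braidAct_unit_left, braidAct_unit_left, braidAct_unit_left, CategoryTheory.Functor.map_id]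
    exact (Category.comp_id _).symm
  | of m =>
    simp only [braidAct, braidWord, braidStrand, act_comp, act_assoc, act_assocInv, act_tensor,
      act_id, Category.id_comp, Category.comp_id, CategoryTheory.Functor.map_id]
  | tensor X X' h h' =>
    rw [braidAct_tensor_left, braidAct_tensor_left, braidAct_tensor_left, h, h']
    simp only [Functor.map_comp, Category.assoc]
    congr 1
    rw [← Category.assoc, ← Category.assoc]
    congr 1
    exact braidAct_natural ι X Y _

/-- The action of `evWord`. -/
def evAct (X : Ob) (Z : Presented P) :
    (place P (dualWord X)).obj ((place P X).obj Z) ⟶ Z :=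
  (evWord cap X).act Z

theorem evAct_natural (X : Ob) {Z Z' : Presented P} (g : Z ⟶ Z') :
    (place P (dualWord X)).map ((place P X).map g) ≫ evAct cap X Z' = evAct cap X Z ≫ g :=
  (evWord cap X).act_natural g

/-- The action of `evWord'`. -/
def evAct' (X : Ob) (Z : Presented P) :
    (place P X).obj ((place P (dualWord X)).obj Z) ⟶ Z :=
  (evWord' cap X).act Z

theorem evAct'_natural (X : Ob) {Z Z' : Presented P} (g : Z ⟶ Z') :
    (place P X).map ((place P (dualWord X)).map g) ≫ evAct' cap X Z' = evAct' cap X Z ≫ g :=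
  (evWord' cap X).act_natural g

/-- The action of `coevWord`. -/
def coevAct (X : Ob) (Z : Presented P) :
    Z ⟶ (place P X).obj ((place P (dualWord X)).obj Z) :=
  (coevWord cup X).act Z

theorem coevAct_natural (X : Ob) {Z Z' : Presented P} (g : Z ⟶ Z') :
    g ≫ coevAct cup X Z' =
      coevAct cup X Z ≫ (place P X).map ((place P (dualWord X)).map g) :=
  (coevWord cup X).act_natural g

/-- The action of `coevWord'`. -/
def coevAct' (X : Ob) (Z : Presented P) :
    Z ⟶ (place P (dualWord X)).obj ((place P X).obj Z) :=
  (coevWord' cup X).act Z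

theorem coevAct'_natural (X : Ob) {Z Z' : Presented P} (g : Z ⟶ Z') :
    g ≫ coevAct' cup X Z' =
      coevAct' cup X Z ≫ (place P (dualWord X)).map ((place P X).map g) :=
  (coevWord' cup X).act_natural g

theorem evAct_tensor (X Y : Ob) (Z : Presented P) : evAct cap (X ⊙ Y) Z =
    (place P (dualWord Y)).map (evAct cap X ((place P Y).obj Z)) ≫ evAct cap Y Z :=
  congrArg (· ≫ (evWord cap Y).act Z) (act_contract Z (dualWord Y) Y (evWord cap X))

theorem coevAct_tensor (X Y : Ob) (Z : Presented P) : coevAct cup (X ⊙ Y) Z =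
    coevAct cup X Z ≫ (place P X).map (coevAct cup Y ((place P (dualWord X)).obj Z)) :=
  congrArg ((coevWord cup X).act Z ≫ ·) (act_insert Z X (dualWord X) (coevWord cup Y))

theorem evAct'_tensor (X Y : Ob) (Z : Presented P) : evAct' cap (X ⊙ Y) Z =
    (place P X).map (evAct' cap Y ((place P (dualWord X)).obj Z)) ≫ evAct' cap X Z :=
  congrArg (· ≫ (evWord' cap X).act Z) (act_contract Z X (dualWord X) (evWord' cap Y))

theorem coevAct'_tensor (X Y : Ob) (Z : Presented P) : coevAct' cup (X ⊙ Y) Z =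
    coevAct' cup Y Z ≫ (place P (dualWord Y)).map (coevAct' cup X ((place P Y).obj Z)) :=
  congrArg ((coevWord' cup Y).act Z ≫ ·) (act_insert Z (dualWord Y) Y (coevWord' cup X))

variable {ι cap cup}

namespace RibbonRelations

theorem braidAct_braidAct (R : RibbonRelations ι cap cup) (X Y : Ob) (Z : Presented P) :
    braidAct ι X Y Z ≫ braidAct ι Y X Z = 𝟙 _ := by
  induction X generalizing Z with
  | unit =>
    rw [braidAct_unit_left, braidAct_unit_right]
    exact Category.comp_id _
  | of m =>
    induction Y generalizing Z with
    | unit =>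
      rw [braidAct_unit_left, braidAct_unit_right]
      exact Category.comp_id _
    | of n => exact R.cross_cross (m + 1) (n + 1) Z
    | tensor Y Y' h h' =>
      rw [braidAct_tensor_left, braidAct_tensor_right, Category.assoc,
        ← Functor.map_comp_assoc, h', CategoryTheory.Functor.map_id, Category.id_comp, h]
      rfl
  | tensor X X' h h' =>
    rw [braidAct_tensor_left, braidAct_tensor_right, Category.assoc, reassoc_of% h,
      ← Functor.map_comp, h', CategoryTheory.Functor.map_id]
    rfl

/-- Induction over the word that crosses reduces to one strand, and induction over the term to
generators, where it is `gen_natural`. Structural morphisms act as identities and cause no work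
beyond splitting the braiding. -/
theorem natural_right (R : RibbonRelations ι cap cup) {Y Y' : Ob} (f : Tm 𝕜 P.Gen Y Y') (X : Ob)
    (Z : Presented P) :
    (place P X).map (f.act Z) ≫ braidAct ι X Y' Z = braidAct ι X Y Z ≫ f.act _ := by
  induction X generalizing Z with
  | unit =>
    rw [braidAct_unit_left, braidAct_unit_left]
    exact (Category.comp_id _).trans (Category.id_comp _).symm
  | tensor X X' h h' =>
    have e := congrArg (place P X).map (h' Z)
    simp only [Functor.map_comp] at e
    rw [braidAct_tensor_left, braidAct_tensor_left, Category.assoc]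
    change (place P X).map ((place P X').map (f.act Z)) ≫ _ =
      _ ≫ _ ≫ f.act ((place P X).obj ((place P X').obj Z))
    rw [← h, reassoc_of% e]
  | of m =>
    induction f generalizing Z with
    | gen g => exact R.gen_natural m g Z
    | id X =>
      rw [act_id, act_id, CategoryTheory.Functor.map_id]
      exact (Category.id_comp _).trans (Category.comp_id _).symm
    | comp f g hf hg => rw [act_comp, act_comp, Functor.map_comp, Category.assoc, hg,
      reassoc_of% hf]
    | @tensor X Y X' Y' f g hf hg =>
      have e := congrArg (place P X).map (hg Z)
      simp only [Functor.map_comp] at e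
      rw [act_tensor, act_tensor, braidAct_tensor_right, braidAct_tensor_right, Functor.map_comp,
        Category.assoc, reassoc_of% hf, ← f.act_natural,
          reassoc_of% braidAct_natural ι (.of m) X (g.act Z),
        reassoc_of% e, Category.assoc]
    | assoc X Y W =>
      rw [act_assoc, act_assoc, CategoryTheory.Functor.map_id]
      simp only [braidAct_tensor_right, Functor.map_comp, Category.assoc]
      exact (Category.id_comp _).trans
        (congrArg (_ ≫ ·) (congrArg (_ ≫ ·) (Category.comp_id _).symm))
    | assocInv X Y W =>
      rw [act_assocInv, act_assocInv, CategoryTheory.Functor.map_id]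
      simp only [braidAct_tensor_right, Functor.map_comp, Category.assoc]
      exact (Category.id_comp _).trans
        (congrArg (_ ≫ ·) (congrArg (_ ≫ ·) (Category.comp_id _).symm))
    | lUnit X =>
      rw [act_lUnit, act_lUnit, CategoryTheory.Functor.map_id, braidAct_tensor_right,
        braidAct_unit_right]
      exact (Category.id_comp _).trans ((Category.comp_id _).trans (Category.id_comp _)).symm
    | lUnitInv X =>
      rw [act_lUnitInv, act_lUnitInv, CategoryTheory.Functor.map_id, braidAct_tensor_right,
        braidAct_unit_right]
      exact (Category.id_comp _).trans ((Category.id_comp _).trans (Category.comp_id _).symm)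
    | rUnit X =>
      rw [act_rUnit, act_rUnit, CategoryTheory.Functor.map_id, braidAct_tensor_right,
        braidAct_unit_right, CategoryTheory.Functor.map_id]
      exact (Category.id_comp _).trans ((Category.comp_id _).trans (Category.comp_id _)).symm
    | rUnitInv X =>
      rw [act_rUnitInv, act_rUnitInv, CategoryTheory.Functor.map_id, braidAct_tensor_right,
        braidAct_unit_right, CategoryTheory.Functor.map_id]
      exact Category.id_comp _
    | zero X Y => rw [act_zero, act_zero, Functor.map_zero, Limits.zero_comp, Limits.comp_zero]
    | add f g hf hg =>
      rw [act_add, act_add, Functor.map_add, Preadditive.add_comp, hf, hg, Preadditive.comp_add]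
    | smul c f hf =>
      rw [act_smul, act_smul, Functor.map_smul, Linear.smul_comp, hf, Linear.comp_smul]

/-- The inverse of the braiding is the opposite braiding, so naturality in one variable gives it in
the other. -/
theorem natural_left (R : RibbonRelations ι cap cup) {X X' : Ob} (f : Tm 𝕜 P.Gen X X') (Y : Ob)
    (Z : Presented P) :
    f.act _ ≫ braidAct ι X' Y Z = braidAct ι X Y Z ≫ (place P Y).map (f.act Z) := by
  have h := R.natural_right f Y Z
  have h₁ := R.braidAct_braidAct Y X' Z
  have h₂ := R.braidAct_braidAct X Y Z
  rw [← Category.comp_id ((place P Y).map (f.act Z)), ← h₁, reassoc_of% h, reassoc_of% h₂]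

theorem symmetric (R : RibbonRelations ι cap cup) :
    ∃ s : SymmetricCategory (Presented P), ∀ X Y : Presented P,
      (s.braiding X Y).hom = (braidWord ι X.as Y.as).mk := by
  have inv (X Y : Ob) : (braidWord ι X Y : Tm 𝕜 P.Gen _ _).mk (P := P) ≫
    (braidWord ι Y X : Tm 𝕜 P.Gen _ _).mk = 𝟙 _ :=
    mk_eq_iff (P := P) (f := braidWord ι X Y ⨟ braidWord ι Y X) (g := Tm.id _) |>.2
      fun Z => R.braidAct_braidAct X Y Z
  refine ⟨{
    braiding X Y := ⟨(braidWord ι X.as Y.as).mk, (braidWord ι Y.as X.as).mk, inv _ _, inv _ _⟩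
    braiding_naturality_right := ?_
    braiding_naturality_left := ?_
    hexagon_forward := ?_
    hexagon_reverse := ?_
    symmetry := ?_ }, fun _ _ => rfl⟩
  · rintro X Y W ⟨f⟩
    refine (mk_eq_iff (P := P) (f := (Tm.id X.as ⊠ f) ⨟ braidWord ι X.as W.as)
      (g := braidWord ι X.as Y.as ⨟ (f ⊠ Tm.id X.as))).2 fun Z => ?_
    have h := R.natural_right f X.as Z
    simp only [act_comp, act_tensor, act_id, Category.comp_id, CategoryTheory.Functor.map_id,
      Category.id_comp]
    exact h
  · rintro X Y ⟨f⟩ W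
    refine (mk_eq_iff (P := P) (f := (f ⊠ Tm.id W.as) ⨟ braidWord ι Y.as W.as)
      (g := braidWord ι X.as W.as ⨟ (Tm.id W.as ⊠ f))).2 fun Z => ?_
    have h := R.natural_left f W.as Z
    simp only [act_comp, act_tensor, act_id, Category.comp_id, CategoryTheory.Functor.map_id,
      Category.id_comp]
    exact h
  · intro X Y W
    refine (mk_eq_iff (P := P) (f := Tm.assoc X.as Y.as W.as ⨟ braidWord ι X.as (Y.as ⊙ W.as) ⨟
        Tm.assoc _ _ _)
      (g := (braidWord ι X.as Y.as ⊠ Tm.id W.as) ⨟ Tm.assoc _ _ _ ⨟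
        (Tm.id Y.as ⊠ braidWord ι X.as W.as))).2 fun Z => ?_
    have h := braidAct_tensor_right ι X.as Y.as W.as Z
    simp only [act_comp, act_tensor, act_id, act_assoc, Category.comp_id,
      CategoryTheory.Functor.map_id,
      Category.id_comp]
    exact h
  · intro X Y W
    refine (mk_eq_iff (P := P) (f := Tm.assocInv X.as Y.as W.as ⨟ braidWord ι (X.as ⊙ Y.as) W.as ⨟
        Tm.assocInv _ _ _)
      (g := (Tm.id X.as ⊠ braidWord ι Y.as W.as) ⨟ Tm.assocInv _ _ _ ⨟
        (braidWord ι X.as W.as ⊠ Tm.id Y.as))).2 fun Z => ?_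
    have h := braidAct_tensor_left ι X.as Y.as W.as Z
    simp only [act_comp, act_tensor, act_id, act_assocInv, Category.comp_id,
      CategoryTheory.Functor.map_id,
      Category.id_comp]
    exact h
  · intro X Y
    exact inv _ _

/-! Duals of words. -/

theorem evAct_coevAct_left (R : RibbonRelations ι cap cup) (X : Ob) (Z : Presented P) :
    (place P (dualWord X)).map (coevAct cup X Z) ≫ evAct cap X _ = 𝟙 _ := by
  induction X generalizing Z with
  | unit => exact Category.comp_id _
  | of m => exact R.zigzag_left (m + 1) Z
  | tensor X Y hX hY =>
    rw [evAct_tensor, coevAct_tensor]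
    change (place P (dualWord Y)).map ((place P (dualWord X)).map (_ ≫ _)) ≫
      (place P (dualWord Y)).map (evAct cap X ((place P Y).obj
        ((place P (dualWord Y)).obj ((place P (dualWord X)).obj Z)))) ≫
      evAct cap Y ((place P (dualWord Y)).obj ((place P (dualWord X)).obj Z)) = 𝟙 _
    rw [← Functor.map_comp_assoc, Functor.map_comp (place P (dualWord X)), Category.assoc,
      evAct_natural,
      reassoc_of% hX, hY]

theorem evAct_coevAct_right (R : RibbonRelations ι cap cup) (X : Ob) (Z : Presented P) :
    coevAct cup X _ ≫ (place P X).map (evAct cap X Z) = 𝟙 _ := by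
  induction X generalizing Z with
  | unit => exact Category.comp_id _
  | of m => exact R.zigzag_right (m + 1) Z
  | tensor X Y hX hY =>
    rw [evAct_tensor, coevAct_tensor]
    change (coevAct cup X ((place P X).obj ((place P Y).obj Z)) ≫
      (place P X).map (coevAct cup Y ((place P (dualWord X)).obj
        ((place P X).obj ((place P Y).obj Z))))) ≫ (place P X).map ((place P Y).map (_ ≫ _)) = 𝟙 _
    rw [Category.assoc, ← Functor.map_comp, Functor.map_comp (place P Y),
      ← reassoc_of% coevAct_natural cup Y (evAct cap X ((place P Y).obj Z)), hY,
      Category.comp_id, hX]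

theorem evAct'_coevAct'_left (R : RibbonRelations ι cap cup) (X : Ob) (Z : Presented P) :
    (place P X).map (coevAct' cup X Z) ≫ evAct' cap X _ = 𝟙 _ := by
  induction X generalizing Z with
  | unit => exact Category.comp_id _
  | of m => exact R.zigzag_left (m + 1) Z
  | tensor X Y hX hY =>
    rw [evAct'_tensor, coevAct'_tensor]
    change (place P X).map ((place P Y).map (_ ≫ _)) ≫
      (place P X).map (evAct' cap Y ((place P (dualWord X)).obj
        ((place P X).obj ((place P Y).obj Z)))) ≫
      evAct' cap X ((place P X).obj ((place P Y).obj Z)) = 𝟙 _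
    rw [← Functor.map_comp_assoc, Functor.map_comp (place P Y), Category.assoc, evAct'_natural,
      reassoc_of% hY, hX]

theorem evAct'_coevAct'_right (R : RibbonRelations ι cap cup) (X : Ob) (Z : Presented P) :
    coevAct' cup X _ ≫ (place P (dualWord X)).map (evAct' cap X Z) = 𝟙 _ := by
  induction X generalizing Z with
  | unit => exact Category.comp_id _
  | of m => exact R.zigzag_right (m + 1) Z
  | tensor X Y hX hY =>
    rw [evAct'_tensor, coevAct'_tensor]
    change (coevAct' cup Y ((place P (dualWord Y)).obj ((place P (dualWord X)).obj Z)) ≫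
      (place P (dualWord Y)).map (coevAct' cup X ((place P Y).obj
        ((place P (dualWord Y)).obj ((place P (dualWord X)).obj Z))))) ≫
      (place P (dualWord Y)).map ((place P (dualWord X)).map (_ ≫ _)) = 𝟙 _
    rw [Category.assoc, ← Functor.map_comp, Functor.map_comp (place P (dualWord X)),
      ← reassoc_of% coevAct'_natural cup X (evAct' cap Y ((place P (dualWord X)).obj Z)), hX,
      Category.comp_id, hY]

theorem evAct_natural_right (R : RibbonRelations ι cap cup) (X Y : Ob) (Z : Presented P) :
    braidAct ι X (dualWord Y) _ ≫ (place P (dualWord Y)).map (braidAct ι X Y Z) ≫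
      evAct cap Y ((place P X).obj Z) = (place P X).map (evAct cap Y Z) := by
  have h := R.natural_right (evWord cap Y) X Z
  rw [braidAct_unit_right, braidAct_tensor_right, Category.assoc] at h
  exact h.symm.trans (Category.comp_id _)

theorem evAct'_natural_left (R : RibbonRelations ι cap cup) (X Y : Ob) (Z : Presented P) :
    (place P X).map (braidAct ι (dualWord X) Y Z) ≫ braidAct ι X Y _ ≫
      (place P Y).map (evAct' cap X Z) = evAct' cap X ((place P Y).obj Z) := by
  have h := R.natural_left (evWord' cap X) Y Z
  rw [braidAct_unit_left, braidAct_tensor_left, Category.assoc] at h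
  exact h.symm.trans (Category.comp_id _)

theorem evAct_natural_left (R : RibbonRelations ι cap cup) (X Y : Ob) (Z : Presented P) :
    (place P (dualWord X)).map (braidAct ι X Y Z) ≫ braidAct ι (dualWord X) Y _ ≫
      (place P Y).map (evAct cap X Z) = evAct cap X ((place P Y).obj Z) := by
  have h := R.natural_left (evWord cap X) Y Z
  rw [braidAct_unit_left, braidAct_tensor_left, Category.assoc] at h
  exact h.symm.trans (Category.comp_id _)

theorem coevAct_natural_right (R : RibbonRelations ι cap cup) (X Y : Ob) (Z : Presented P) :
    (place P X).map (coevAct cup Y Z) ≫ braidAct ι X Y _ ≫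
      (place P Y).map (braidAct ι X (dualWord Y) Z) = coevAct cup Y ((place P X).obj Z) := by
  have h := R.natural_right (coevWord cup Y) X Z
  rw [braidAct_unit_right, braidAct_tensor_right] at h
  exact h.trans (Category.id_comp _)

theorem braidAct_natural_left (R : RibbonRelations ι cap cup) (X Y W : Ob) (Z : Presented P) :
    (place P X).map (braidAct ι Y W Z) ≫ braidAct ι X W _ ≫
      (place P W).map (braidAct ι X Y Z) =
    braidAct ι X Y _ ≫ (place P Y).map (braidAct ι X W Z) ≫ braidAct ι Y W _ := by
  have n := R.natural_right (braidWord ι Y W) X Z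
  rw [braidAct_tensor_right, braidAct_tensor_right, Category.assoc] at n
  exact n

/-- For one strand this is `cross_cap`; for words the inner caps are pulled through the outer
strands. It ties the two families of duals together, on which pivotality and the triviality of the
twist rest. -/
theorem braidAct_evAct (R : RibbonRelations ι cap cup) (X : Ob) (Z : Presented P) :
    braidAct ι X (dualWord X) Z ≫ evAct cap X Z = evAct' cap X Z := by
  induction X generalizing Z with
  | unit => exact (congrArg (· ≫ 𝟙 _) (braidAct_unit_left ι _ Z)).trans (Category.comp_id _)
  | of m => exact R.cross_cap (m + 1) Z
  | tensor X Y hX hY =>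
    have e₁ : (place P X).map (braidAct ι Y (dualWord X) Z) ≫ evAct' cap X _ =
        braidAct ι X Y _ ≫ (place P Y).map (evAct' cap X Z) := by
      rw [← R.evAct'_natural_left X Y Z, ← Functor.map_comp_assoc, R.braidAct_braidAct,
        CategoryTheory.Functor.map_id, Category.id_comp]
    rw [evAct_tensor, evAct'_tensor]
    change braidAct ι (X ⊙ Y) (dualWord Y ⊙ dualWord X) Z ≫ _ = _
    rw [braidAct_tensor_right, braidAct_tensor_left, braidAct_tensor_left, Category.assoc,
      Category.assoc]
    change (place P X).map (braidAct ι Y (dualWord Y) ((place P (dualWord X)).obj Z)) ≫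
      braidAct ι X (dualWord Y) ((place P Y).obj ((place P (dualWord X)).obj Z)) ≫
      (place P (dualWord Y)).map ((place P X).map (braidAct ι Y (dualWord X) Z) ≫
        braidAct ι X (dualWord X) ((place P Y).obj Z)) ≫ _ ≫ _ = _
    rw [← Functor.map_comp_assoc (place P (dualWord Y)), Category.assoc, hX, e₁,
      Functor.map_comp, Category.assoc, evAct_natural,
      reassoc_of% R.evAct_natural_right X Y ((place P (dualWord X)).obj Z),
      ← Functor.map_comp_assoc, hY]

/-- By the zigzags `coev'` is determined by `ev'`, so it is enough to pair the left side with `ev'`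
and straighten; `braidAct_evAct` makes this possible. -/
theorem coevAct_braidAct (R : RibbonRelations ι cap cup) (X : Ob) (Z : Presented P) :
    coevAct cup X Z ≫ braidAct ι X (dualWord X) Z = coevAct' cup X Z := by
  have h : (place P X).map (coevAct cup X Z ≫ braidAct ι X (dualWord X) Z) ≫
      evAct' cap X ((place P X).obj Z) = 𝟙 _ := by
    rw [Functor.map_comp, Category.assoc, ← R.braidAct_evAct, ← R.evAct_natural_left X X Z,
      reassoc_of% R.braidAct_natural_left X X (dualWord X) Z,
      reassoc_of% R.braidAct_braidAct X (dualWord X) ((place P X).obj Z),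
      reassoc_of% R.coevAct_natural_right X X Z, R.evAct_coevAct_right]
  have n := coevAct'_natural cup X (coevAct cup X Z ≫ braidAct ι X (dualWord X) Z)
  refine (Category.comp_id _).symm.trans ?_
  rw [← R.evAct'_coevAct'_right X ((place P X).obj Z), ← Category.assoc, n, Category.assoc,
    ← Functor.map_comp, h, CategoryTheory.Functor.map_id, Category.comp_id]

/-- Writing `ev'` and `coev'` through the braiding turns the second dual into the first with
additional crossings; these slide along `f` and cancel in pairs. -/
theorem mate_eq_mate' (R : RibbonRelations ι cap cup) {X Y : Ob} (f : Tm 𝕜 P.Gen X Y)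
    (Z : Presented P) :
    (place P (dualWord Y)).map (coevAct cup X Z) ≫ (place P (dualWord Y)).map (f.act _) ≫
      evAct cap Y _ =
    coevAct' cup X _ ≫ (place P (dualWord X)).map (f.act _) ≫
      (place P (dualWord X)).map (evAct' cap Y Z) := by
  have e := R.natural_right f (dualWord Y) ((place P (dualWord X)).obj Z)
  have e' := R.natural_left f (dualWord X) ((place P (dualWord Y)).obj Z)
  rw [← R.braidAct_evAct, ← R.coevAct_braidAct, Category.assoc, ← reassoc_of% e',
    ← R.coevAct_natural_right, Functor.map_comp]
  simp only [Category.assoc]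
  have e₁ : (place P X).map (braidAct ι (dualWord Y) (dualWord X) Z) ≫ f.act _ =
    f.act _ ≫ (place P Y).map (braidAct ι (dualWord Y) (dualWord X) Z) := f.act_natural _
  rw [reassoc_of% e₁, ← reassoc_of% e,
    reassoc_of% R.braidAct_natural_left Y (dualWord Y) (dualWord X) Z,
    reassoc_of% R.braidAct_braidAct (dualWord Y) Y ((place P (dualWord X)).obj Z),
    R.evAct_natural_left]

/-- Sliding through the coevaluation turns the curl into a zigzag with two opposite crossings, which
cancel. -/
theorem curl (R : RibbonRelations ι cap cup) (X : Ob) (Z : Presented P) :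
    (place P X).map (coevAct cup X Z) ≫ braidAct ι X X _ ≫ (place P X).map (evAct' cap X Z) =
      𝟙 _ := by
  have e : (place P X).map (coevAct cup X Z) ≫ braidAct ι X X _ =
      coevAct cup X _ ≫ (place P X).map (braidAct ι (dualWord X) X Z) := by
    rw [← R.coevAct_natural_right, Category.assoc, Category.assoc, ← Functor.map_comp,
      R.braidAct_braidAct, CategoryTheory.Functor.map_id, Category.comp_id]
  rw [reassoc_of% e, ← R.braidAct_evAct, ← Functor.map_comp,
    reassoc_of% R.braidAct_braidAct (dualWord X) X Z, R.evAct_coevAct_right]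

/-- With a trivial twist, naturality, duality and compatibility with tensor products amount to
properties of identities and to the symmetry of the braiding. -/
theorem twist_eq_id (R : RibbonRelations ι cap cup) (X : Presented P) :
    (diagrammaticData P ι cap cup).twist X = 𝟙 X := by
  refine (mk_eq_iff (P := P) (f := Tm.rUnitInv X.as ⨟ (Tm.id X.as ⊠ coevWord cup X.as) ⨟
    Tm.assocInv _ _ _ ⨟ (braidWord ι X.as X.as ⊠ Tm.id (dualWord X.as)) ⨟ Tm.assoc _ _ _ ⨟
    (Tm.id X.as ⊠ evWord' cap X.as) ⨟ Tm.rUnit _) (g := Tm.id X.as)).2 fun Z => ?_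
  have h := R.curl X.as Z
  simp only [act_comp, act_tensor, act_id, act_assoc, act_assocInv, act_rUnit, act_rUnitInv,
    Category.comp_id, CategoryTheory.Functor.map_id, Category.id_comp]
  exact h

theorem mate_id (R : RibbonRelations ι cap cup) (X : Presented P) :
    (diagrammaticData P ι cap cup).mate (𝟙 X) = 𝟙 _ := by
  refine (mk_eq_iff (P := P) (f := Tm.rUnitInv _ ⨟ (Tm.id (dualWord X.as) ⊠ coevWord cup X.as) ⨟
    (Tm.id (dualWord X.as) ⊠ (Tm.id X.as ⊠ Tm.id (dualWord X.as))) ⨟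
    Tm.assocInv _ _ _ ⨟ (evWord cap X.as ⊠ Tm.id (dualWord X.as)) ⨟ Tm.lUnit _)
    (g := Tm.id _)).2 fun Z => ?_
  have h := R.evAct_coevAct_left X.as Z
  simp only [act_comp, act_tensor, act_id, act_assocInv, act_lUnit, act_rUnitInv,
    Category.comp_id, CategoryTheory.Functor.map_id, Category.id_comp]
  exact (congrArg (_ ≫ ·) ((congrArg (· ≫ _) (CategoryTheory.Functor.map_id _ _)).trans
    (Category.id_comp _))).trans h

/-- Crossings, caps and cups make the presented category symmetric ribbon. -/
theorem isSymmetricRibbon (R : RibbonRelations ι cap cup) :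
    IsSymmetricRibbon (diagrammaticData P ι cap cup) where
  symmetric := R.symmetric
  rightDual X := by
    refine ⟨{ coevaluation' := (coevWord cup X.as).mk, evaluation' := (evWord cap X.as).mk,
              coevaluation_evaluation' := ?_, evaluation_coevaluation' := ?_ }, rfl, rfl⟩
    · refine (mk_eq_iff (P := P) (f := (Tm.id (dualWord X.as) ⊠ coevWord cup X.as) ⨟
        Tm.assocInv _ _ _ ⨟ (evWord cap X.as ⊠ Tm.id (dualWord X.as)))
        (g := Tm.rUnit _ ⨟ Tm.lUnitInv _)).2 fun Z => ?_
      have h := R.evAct_coevAct_left X.as Z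
      simp only [act_comp, act_tensor, act_id, act_assocInv, act_rUnit, act_lUnitInv,
        Category.comp_id, CategoryTheory.Functor.map_id, Category.id_comp]
      exact h
    · refine (mk_eq_iff (P := P) (f := (coevWord cup X.as ⊠ Tm.id X.as) ⨟
        Tm.assoc _ _ _ ⨟ (Tm.id X.as ⊠ evWord cap X.as))
        (g := Tm.lUnit _ ⨟ Tm.rUnitInv _)).2 fun Z => ?_
      have h := R.evAct_coevAct_right X.as Z
      simp only [act_comp, act_tensor, act_id, act_assoc, act_lUnit, act_rUnitInv,
        Category.comp_id, CategoryTheory.Functor.map_id, Category.id_comp]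
      exact h
  leftDual X := by
    refine ⟨{ coevaluation' := (coevWord' cup X.as).mk, evaluation' := (evWord' cap X.as).mk,
              coevaluation_evaluation' := ?_, evaluation_coevaluation' := ?_ }, rfl, rfl⟩
    · refine (mk_eq_iff (P := P) (f := (Tm.id X.as ⊠ coevWord' cup X.as) ⨟
        Tm.assocInv _ _ _ ⨟ (evWord' cap X.as ⊠ Tm.id X.as))
        (g := Tm.rUnit _ ⨟ Tm.lUnitInv _)).2 fun Z => ?_
      have h := R.evAct'_coevAct'_left X.as Z
      simp only [act_comp, act_tensor, act_id, act_assocInv, act_rUnit, act_lUnitInv,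
        Category.comp_id, CategoryTheory.Functor.map_id, Category.id_comp]
      exact h
    · refine (mk_eq_iff (P := P) (f := (coevWord' cup X.as ⊠ Tm.id (dualWord X.as)) ⨟
        Tm.assoc _ _ _ ⨟ (Tm.id (dualWord X.as) ⊠ evWord' cap X.as))
        (g := Tm.lUnit _ ⨟ Tm.rUnitInv _)).2 fun Z => ?_
      have h := R.evAct'_coevAct'_right X.as Z
      simp only [act_comp, act_tensor, act_id, act_assoc, act_lUnit, act_rUnitInv,
        Category.comp_id, CategoryTheory.Functor.map_id, Category.id_comp]
      exact h
  pivotal {X Y} f := by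
    rcases f with ⟨f⟩
    refine (mk_eq_iff (P := P) (f := Tm.rUnitInv _ ⨟ (Tm.id (dualWord Y.as) ⊠ coevWord cup X.as) ⨟
      (Tm.id (dualWord Y.as) ⊠ (f ⊠ Tm.id (dualWord X.as))) ⨟
      Tm.assocInv _ _ _ ⨟ (evWord cap Y.as ⊠ Tm.id (dualWord X.as)) ⨟ Tm.lUnit _)
      (g := Tm.lUnitInv _ ⨟ (coevWord' cup X.as ⊠ Tm.id (dualWord Y.as)) ⨟
      ((Tm.id (dualWord X.as) ⊠ f) ⊠ Tm.id (dualWord Y.as)) ⨟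
      Tm.assoc _ _ _ ⨟ (Tm.id (dualWord X.as) ⊠ evWord' cap Y.as) ⨟ Tm.rUnit _)).2 fun Z => ?_
    have h := R.mate_eq_mate' f Z
    simp only [act_comp, act_tensor, act_id, act_assoc, act_assocInv, act_lUnit, act_lUnitInv,
      act_rUnit, act_rUnitInv, Category.comp_id, CategoryTheory.Functor.map_id, Category.id_comp]
    exact h
  twist_isIso X := by
    rw [R.twist_eq_id]
    infer_instance
  twist_natural f := by
    rw [R.twist_eq_id, R.twist_eq_id, Category.comp_id, Category.id_comp]
  twist_tensor X Y := by
    obtain ⟨s, hs⟩ := R.symmetric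
    rw [R.twist_eq_id, R.twist_eq_id, R.twist_eq_id]
    change _ = _ ≫ (braidWord ι X.as Y.as).mk ≫ (braidWord ι Y.as X.as).mk
    rw [← hs, ← hs, s.symmetry, id_tensorHom_id]
    exact (Category.comp_id _).symm
  twist_dual X := by
    rw [R.twist_eq_id, R.twist_eq_id, R.mate_id]

end RibbonRelations

end Ribbon

/-! ### Consequences of rotation in orthogonal webs -/

/-- An action of type A webs together with caps and cups of all thicknesses by which webs can be
rotated. -/
structure PivotalAction (D : Type u) [Category.{v} D] [Preadditive D] extends WebAction D where
  cap : ∀ (k : ℕ) (Z : D), (F k).obj ((F k).obj Z) ⟶ Z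
  cup : ∀ (k : ℕ) (Z : D), Z ⟶ (F k).obj ((F k).obj Z)
  cap_nat : ∀ (k : ℕ) {Z Z' : D} (f : Z ⟶ Z'), (F k).map ((F k).map f) ≫ cap k Z' = cap k Z ≫ f
  cup_nat : ∀ (k : ℕ) {Z Z' : D} (f : Z ⟶ Z'), f ≫ cup k Z' = cup k Z ≫ (F k).map ((F k).map f)
  zigzag_left : ∀ (k : ℕ) (Z : D), (F k).map (cup k Z) ≫ cap k _ = 𝟙 _
  zigzag_right : ∀ (k : ℕ) (Z : D), cup k _ ≫ (F k).map (cap k Z) = 𝟙 _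
  turn_right : ∀ {k l n : ℕ} (h : k + l = n) (h' : l + k = n) (Z : D),
    (F n).map (cup k Z) ≫ (F n).map ((F k).map (cup l _)) ≫ (F n).map (m h _) ≫ cap n _ = s h' Z
  turn_left : ∀ {k l n : ℕ} (h : k + l = n) (h' : l + k = n) (Z : D),
    cup l _ ≫ (F l).map (cup k _) ≫ (F l).map ((F k).map (m h _)) ≫
      (F l).map ((F k).map (cap n Z)) = s h' Z
  turn_cross : ∀ (k l : ℕ) (Z : D), (F k).map ((F l).map (cup k Z)) ≫
    (F k).map (x l k _) ≫ cap k _ = x k l Z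

namespace PivotalAction

variable {D : Type u} [Category.{v} D] [Preadditive D] (A : PivotalAction D)

theorem cap_nat_assoc (k : ℕ) {Z Z' : D} (f : Z ⟶ Z') {W : D} (t : _ ⟶ W) :
    (A.F k).map ((A.F k).map f) ≫ A.cap k Z' ≫ t =
      A.cap k Z ≫ f ≫ t := by
  simpa only [Category.assoc, Category.id_comp] using congrArg (· ≫ t) (A.cap_nat k f)

theorem cap_nat₁ (k : ℕ) {Z Z' : D} (f : Z ⟶ Z') (G : D ⥤ D) :
    G.map ((A.F k).map ((A.F k).map f)) ≫ G.map (A.cap k Z') =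
      G.map (A.cap k Z) ≫ G.map (f) := by
  simpa only [Functor.map_comp, CategoryTheory.Functor.map_id] using congrArg G.map (A.cap_nat k f)

theorem cap_nat₁_assoc (k : ℕ) {Z Z' : D} (f : Z ⟶ Z') (G : D ⥤ D) {W : D} (t : _ ⟶ W) :
    G.map ((A.F k).map ((A.F k).map f)) ≫ G.map (A.cap k Z') ≫ t =
      G.map (A.cap k Z) ≫ G.map (f) ≫ t := by
  simpa only [Category.assoc, Category.id_comp] using
    congrArg (· ≫ t) (A.cap_nat₁ k f G)

theorem cup_nat_assoc (k : ℕ) {Z Z' : D} (f : Z ⟶ Z') {W : D} (t : _ ⟶ W) :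
    f ≫ A.cup k Z' ≫ t =
      A.cup k Z ≫ (A.F k).map ((A.F k).map f) ≫ t := by
  simpa only [Category.assoc, Category.id_comp] using congrArg (· ≫ t) (A.cup_nat k f)

theorem cup_nat₁ (k : ℕ) {Z Z' : D} (f : Z ⟶ Z') (G : D ⥤ D) :
    G.map (f) ≫ G.map (A.cup k Z') =
      G.map (A.cup k Z) ≫ G.map ((A.F k).map ((A.F k).map f)) := by
  simpa only [Functor.map_comp, CategoryTheory.Functor.map_id] using congrArg G.map (A.cup_nat k f)

theorem cup_nat₁_assoc (k : ℕ) {Z Z' : D} (f : Z ⟶ Z') (G : D ⥤ D) {W : D} (t : _ ⟶ W) :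
    G.map (f) ≫ G.map (A.cup k Z') ≫ t =
      G.map (A.cup k Z) ≫ G.map ((A.F k).map ((A.F k).map f)) ≫ t := by
  simpa only [Category.assoc, Category.id_comp] using
    congrArg (· ≫ t) (A.cup_nat₁ k f G)

theorem zigzag_left_assoc (k : ℕ) (Z : D) {W : D} (t : _ ⟶ W) :
    (A.F k).map (A.cup k Z) ≫ A.cap k _ ≫ t =
      t := by
  simpa only [Category.assoc, Category.id_comp] using congrArg (· ≫ t) (A.zigzag_left k Z)

theorem zigzag_left₁ (k : ℕ) (Z : D) (G : D ⥤ D) :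
    G.map ((A.F k).map (A.cup k Z)) ≫ G.map (A.cap k _) =
      𝟙 _ := by
  simpa only [Functor.map_comp, CategoryTheory.Functor.map_id] using
    congrArg G.map (A.zigzag_left k Z)

theorem zigzag_left₁_assoc (k : ℕ) (Z : D) (G : D ⥤ D) {W : D} (t : _ ⟶ W) :
    G.map ((A.F k).map (A.cup k Z)) ≫ G.map (A.cap k _) ≫ t =
      t := by
  simpa only [Category.assoc, Category.id_comp] using
    congrArg (· ≫ t) (A.zigzag_left₁ k Z G)

theorem zigzag_right₁ (k : ℕ) (Z : D) (G : D ⥤ D) :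
    G.map (A.cup k _) ≫ G.map ((A.F k).map (A.cap k Z)) =
      𝟙 _ := by
  simpa only [Functor.map_comp, CategoryTheory.Functor.map_id] using
    congrArg G.map (A.zigzag_right k Z)

theorem zigzag_right₁_assoc (k : ℕ) (Z : D) (G : D ⥤ D) {W : D} (t : _ ⟶ W) :
    G.map (A.cup k _) ≫ G.map ((A.F k).map (A.cap k Z)) ≫ t =
      t := by
  simpa only [Category.assoc, Category.id_comp] using
    congrArg (· ≫ t) (A.zigzag_right₁ k Z G)

/-- Writing the split as a rotated merge exhibits the right side as the left side with zigzags
inserted. -/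
theorem m_cap {k l n : ℕ} (h : k + l = n) (h' : l + k = n) (Z : D) : A.m h _ ≫ A.cap n Z =
    (A.F k).map ((A.F l).map (A.s h' Z)) ≫ (A.F k).map (A.cap l _) ≫ A.cap k Z := by
  rw [← A.turn_left h h']
  simp only [Functor.map_comp, Category.assoc]
  rw [A.cap_nat₁_assoc, A.cap_nat₁_assoc, A.cap_nat₁_assoc, A.zigzag_left₁_assoc, A.cap_nat,
    A.cap_nat_assoc, A.zigzag_left_assoc]

theorem cap_m {k l n : ℕ} (h : k + l = n) (h' : l + k = n) (Z : D) :
    (A.F n).map (A.m h Z) ≫ A.cap n Z = A.s h' _ ≫ (A.F l).map (A.cap k _) ≫ A.cap l Z := by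
  rw [← A.turn_right h h']
  simp only [Category.assoc]
  rw [← A.cap_nat_assoc, ← A.cap_nat, ← A.m_nat₁_assoc, ← A.m_nat₁_assoc]
  have e := congrArg (A.F n).map (A.cup_nat₁ l (A.cap k ((A.F l).obj Z)) (A.F k))
  have e₁ := congrArg (fun f => (A.F n).map ((A.F k).map f)) (A.zigzag_right l Z)
  simp only [Functor.map_comp, CategoryTheory.Functor.map_id] at e e₁
  rw [← reassoc_of% e, A.zigzag_right₁_assoc, reassoc_of% e₁]

theorem cup_s {k l n : ℕ} (h : k + l = n) (h' : l + k = n) (Z : D) : A.cup n Z ≫ A.s h _ =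
    A.cup k Z ≫ (A.F k).map (A.cup l _) ≫ (A.F k).map ((A.F l).map (A.m h' Z)) := by
  have e := congrArg (fun f => (A.F k).map ((A.F l).map f)) (A.zigzag_left n Z)
  simp only [Functor.map_comp, CategoryTheory.Functor.map_id] at e
  rw [← A.turn_left h' h, A.cup_nat_assoc, A.cup_nat₁_assoc, A.m_nat₂_assoc, e, Category.comp_id]

theorem cup_F_s {k l n : ℕ} (h : k + l = n) (h' : l + k = n) (Z : D) :
    A.cup n Z ≫ (A.F n).map (A.s h' Z) = A.cup k Z ≫ (A.F k).map (A.cup l _) ≫ A.m h _ := by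
  rw [← A.turn_right h h']
  simp only [Functor.map_comp]
  rw [← A.cup_nat_assoc, ← A.cup_nat_assoc, ← A.cup_nat_assoc, A.zigzag_right, Category.comp_id]

/-- A digon of value k + 1 on one leg of the cap, whose merge is traded for a split on the other
leg. Thus rotation alone forces thick caps to be exploded ones. -/
theorem cap_succ {k : ℕ} (h : 1 + k = k + 1) (Z : D) : (k + 1) • A.cap (k + 1) Z =
    (A.F (k + 1)).map (A.s rfl Z) ≫ A.s h _ ≫ (A.F 1).map (A.cap k _) ≫ A.cap 1 Z := by
  rw [A.s_nat_assoc, ← A.m_cap h rfl, ← Category.assoc, A.digon]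
  simp

theorem cup_succ {k : ℕ} (h : 1 + k = k + 1) (Z : D) : (k + 1) • A.cup (k + 1) Z =
    A.cup 1 Z ≫ (A.F 1).map (A.cup k _) ≫ (A.F 1).map ((A.F k).map (A.m rfl Z)) ≫ A.m h _ := by
  have e := A.cup_s h rfl Z
  rw [← reassoc_of% e, A.digon]
  simp

/-- The quarter turn of the crossing with one zigzag straightened; its partner `x_cap` is obtained
at the other end. -/
theorem cup_x (l k : ℕ) (Z : D) :
    (A.F l).map (A.cup k Z) ≫ A.x l k _ = A.cup k _ ≫ (A.F k).map (A.x k l Z) := by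
  rw [← A.turn_cross k l, Functor.map_comp, Functor.map_comp, ← A.cup_nat_assoc,
    ← A.cup_nat_assoc, A.zigzag_right, Category.comp_id]

theorem x_cap (l k : ℕ) (Z : D) :
    (A.F k).map (A.x l k Z) ≫ A.cap k _ = A.x k l _ ≫ (A.F l).map (A.cap k Z) := by
  have e := congrArg (fun f => (A.F k).map ((A.F l).map f)) (A.zigzag_right k Z)
  simp only [Functor.map_comp, CategoryTheory.Functor.map_id] at e
  rw [← A.turn_cross k l, Category.assoc, Category.assoc, ← A.cap_nat, ← A.x_nat₁_assoc,
    reassoc_of% e]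

/-- Both sides are the cap of thickness 2 with a merge at each of its feet. -/
theorem m_s_cap (Z : D) : A.m (rfl : 1 + 1 = 2) _ ≫ A.s rfl _ ≫ (A.F 1).map (A.cap 1 _) ≫
    A.cap 1 Z = (A.F 1).map ((A.F 1).map (A.m (rfl : 1 + 1 = 2) Z ≫ A.s rfl Z)) ≫
      (A.F 1).map (A.cap 1 _) ≫ A.cap 1 Z := by
  simp only [Functor.map_comp, Category.assoc]
  rw [← A.m_cap rfl rfl, A.m_nat_assoc, A.cap_m rfl rfl]

theorem cup_m_s (Z : D) : A.cup 1 Z ≫ (A.F 1).map (A.cup 1 _) ≫ A.m (rfl : 1 + 1 = 2) _ ≫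
    A.s rfl _ = A.cup 1 Z ≫ (A.F 1).map (A.cup 1 _) ≫
      (A.F 1).map ((A.F 1).map (A.m (rfl : 1 + 1 = 2) Z ≫ A.s rfl Z)) := by
  have e := A.cup_F_s (rfl : 1 + 1 = 2) rfl Z
  have e' := A.cup_s (rfl : 1 + 1 = 2) rfl Z
  simp only [Functor.map_comp]
  rw [← reassoc_of% e, ← reassoc_of% e', A.s_nat]

/-- Rotating the web by a cap of thickness 2 turns it into the lollipop of a cap; a zigzag undoes
the rotation. -/
theorem cup_m_eq_zero (h : ∀ Z, A.s (rfl : 1 + 1 = 2) Z ≫ A.cap 1 Z = 0) (Z : D) :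
    A.cup 1 Z ≫ A.m (rfl : 1 + 1 = 2) Z = 0 := by
  have e : (A.F 2).map (A.cup 1 Z ≫ A.m (rfl : 1 + 1 = 2) Z) ≫ A.cap 2 Z = 0 := by
    rw [Functor.map_comp, Category.assoc, A.cap_m (rfl : 1 + 1 = 2) rfl, A.s_nat_assoc,
      A.zigzag_left₁_assoc, h]
  rw [← Category.comp_id (A.m _ _), ← A.zigzag_right 2, ← Category.assoc, A.cup_nat_assoc,
    ← Functor.map_comp, e]
  simp

section TorsionFree

variable [∀ X Y : D, IsAddTorsionFree (X ⟶ Y)]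

theorem slide_cap (l k : ℕ) (Z : D) :
    A.x l k _ ≫ (A.F k).map (A.x l k Z) ≫ A.cap k _ = (A.F l).map (A.cap k Z) := by
  rw [A.x_cap, A.x_x_assoc]

theorem slide_cup (l k : ℕ) (Z : D) :
    (A.F l).map (A.cup k Z) ≫ A.x l k _ ≫ (A.F k).map (A.x l k Z) = A.cup k _ := by
  rw [reassoc_of% A.cup_x l k Z, A.x_x₁, Category.comp_id]

end TorsionFree

end PivotalAction

/-! ### A strand slides past the generators -/

section

variable {𝕜 : Type} [CommRing 𝕜] {P : Presentation 𝕜} (ι : ∀ ⦃X Y : Ob⦄, AGen X Y → P.Gen X Y)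
  {N : ℕ} (hA : ∀ ⦃X Y : Ob⦄ {f g : Tm 𝕜 P.Gen X Y}, TypeARel ι N f g → P.Rel f g)

/-- The braiding of words treats the unit separately, whereas web actions have crossings for
thickness zero; the relation that such strands are not drawn reconciles them. -/
theorem act_braidStrand_ob (hA : ∀ ⦃X Y : Ob⦄ {f g : Tm 𝕜 P.Gen X Y}, TypeARel ι N f g → P.Rel f g)
    (m k : ℕ) (Z : Presented P) :
    (braidStrand ι m (ob k) : Tm 𝕜 P.Gen _ _).act Z = (webAction ι hA).x (m + 1) k Z := by
  cases k with
  | zero => exact ((TypeARel.cross_zero_right (m + 1)).act_eq ι hA Z).symm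
  | succ k => rfl

theorem act_braidStrand_ob_tensor
    (hA : ∀ ⦃X Y : Ob⦄ {f g : Tm 𝕜 P.Gen X Y}, TypeARel ι N f g → P.Rel f g)
    (m k l : ℕ) (Z : Presented P) :
    (braidStrand ι m (ob k ⊙ ob l) : Tm 𝕜 P.Gen _ _).act Z =
      (webAction ι hA).x (m + 1) k _ ≫
        ((webAction ι hA).F k).map ((webAction ι hA).x (m + 1) l Z) := by
  rw [← act_braidStrand_ob, ← act_braidStrand_ob]
  exact braidAct_tensor_right ι (.of m) (ob k) (ob l) Z

theorem act_braidStrand_unit (m : ℕ) (Z : Presented P) :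
    (braidStrand ι m .unit : Tm 𝕜 P.Gen _ _).act Z = 𝟙 _ :=
  Category.comp_id _

theorem cap_natural
    (hA : ∀ ⦃X Y : Ob⦄ {f g : Tm 𝕜 P.Gen X Y}, TypeARel ι N f g → P.Rel f g)
    (m : ℕ) {k l : ℕ} (c : Tm 𝕜 P.Gen (ob k ⊙ ob l) .unit) (Z : Presented P)
    (h : (webAction ι hA).x (m + 1) k _ ≫
      ((webAction ι hA).F k).map ((webAction ι hA).x (m + 1) l Z) ≫ c.act _ =
        ((webAction ι hA).F (m + 1)).map (c.act Z)) :
    (place P (.of m)).map (c.act Z) ≫ (braidStrand ι m .unit : Tm 𝕜 P.Gen _ _).act Z =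
      (braidStrand ι m (ob k ⊙ ob l) : Tm 𝕜 P.Gen _ _).act Z ≫ c.act _ := by
  rw [act_braidStrand_ob_tensor ι hA, act_braidStrand_unit]
  exact (Category.comp_id _).trans (h.symm.trans (Category.assoc _ _ _).symm)

theorem cup_natural
    (hA : ∀ ⦃X Y : Ob⦄ {f g : Tm 𝕜 P.Gen X Y}, TypeARel ι N f g → P.Rel f g)
    (m : ℕ) {k l : ℕ} (u : Tm 𝕜 P.Gen .unit (ob k ⊙ ob l)) (Z : Presented P)
    (h : ((webAction ι hA).F (m + 1)).map (u.act Z) ≫ (webAction ι hA).x (m + 1) k _ ≫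
      ((webAction ι hA).F k).map ((webAction ι hA).x (m + 1) l Z) = u.act _) :
    (place P (.of m)).map (u.act Z) ≫ (braidStrand ι m (ob k ⊙ ob l) : Tm 𝕜 P.Gen _ _).act Z =
      (braidStrand ι m .unit : Tm 𝕜 P.Gen _ _).act Z ≫ u.act _ := by
  rw [act_braidStrand_ob_tensor ι hA, act_braidStrand_unit]
  exact h.trans (Category.id_comp _).symm

end

/-- The derived slides of merges and splits and the Yang-Baxter relation, in the form required by
`RibbonRelations.gen_natural`. -/
theorem typeA_natural {𝕜 : Type} [Field 𝕜] [CharZero 𝕜] {P : Presentation 𝕜}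
    (ι : ∀ ⦃X Y : Ob⦄, AGen X Y → P.Gen X Y) {N : ℕ}
    (hA : ∀ ⦃X Y : Ob⦄ {f g : Tm 𝕜 P.Gen X Y}, TypeARel ι N f g → P.Rel f g)
    (m : ℕ) {X Y : Ob} (g : AGen X Y) (Z : Presented P) :
    (place P (.of m)).map ((Tm.gen (ι g) : Tm 𝕜 P.Gen _ _).act Z) ≫
        (braidStrand ι m Y : Tm 𝕜 P.Gen _ _).act Z =
      (braidStrand ι m X : Tm 𝕜 P.Gen _ _).act Z ≫ (Tm.gen (ι g) : Tm 𝕜 P.Gen _ _).act _ := by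
  cases g with
  | merge k l n h =>
    rw [act_braidStrand_ob ι hA, act_braidStrand_ob_tensor ι hA]
    exact ((webAction ι hA).m_x h (m + 1) Z).trans (Category.assoc _ _ _).symm
  | split k l n h =>
    rw [act_braidStrand_ob ι hA, act_braidStrand_ob_tensor ι hA]
    exact ((webAction ι hA).x_s h (m + 1) Z).symm
  | cross k l =>
    rw [act_braidStrand_ob_tensor ι hA, act_braidStrand_ob_tensor ι hA]
    exact ((webAction ι hA).x_x_x (m + 1) k l Z).symm.trans (Category.assoc _ _ _).symm

/-! ### Type A webs under substitution of generators -/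

section Subst

variable {𝕜 : Type} {G H : Ob → Ob → Type} (τ : ∀ ⦃X Y : Ob⦄, G X Y → Tm 𝕜 H X Y)

theorem Tm.subst_sumRange {X Y : Ob} (n : ℕ) (f : ℕ → Tm 𝕜 G X Y) :
    (Tm.sumRange n f).subst τ = Tm.sumRange n fun i => (f i).subst τ := by
  induction n with
  | zero => rfl
  | succ n ih => exact congrArg (Tm.add · _) ih

theorem Tm.subst_dite {X Y : Ob} (p : Prop) [Decidable p] (f : p → Tm 𝕜 G X Y)
    (g : ¬ p → Tm 𝕜 G X Y) :
    (if h : p then f h else g h).subst τ = if h : p then (f h).subst τ else (g h).subst τ := by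
  split_ifs <;> rfl

variable (ι : ∀ ⦃X Y : Ob⦄, AGen X Y → G X Y) (ι' : ∀ ⦃X Y : Ob⦄, AGen X Y → H X Y)

theorem TypeARel.subst {τ : ∀ ⦃X Y : Ob⦄, G X Y → Tm 𝕜 H X Y} [CommRing 𝕜]
    (hτ : ∀ ⦃X Y : Ob⦄ (g : AGen X Y), τ (ι g) = Tm.gen (ι' g)) {N : ℕ} {X Y : Ob}
    {f g : Tm 𝕜 G X Y} (h : TypeARel ι N f g) :
    TypeARel ι' N (f.subst τ) (g.subst τ) := by
  cases h
  case schur k l r s n h h' =>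
    have e := TypeARel.schur (𝕜 := 𝕜) (ι := ι') (N := N) k l r s n h h'
    rw [Tm.subst_sumRange]
    simp only [Tm.subst_sumRange, Tm.subst_dite, crossedLadder, Tm.subst, Tm.mid, merge, split,
      cross, hτ] at e ⊢
    exact e
  all_goals simp only [Tm.subst, merge, split, cross, hτ]
  case merge_zero_left => exact merge_zero_left _
  case merge_zero_right => exact merge_zero_right _
  case split_zero_left => exact split_zero_left _
  case split_zero_right => exact split_zero_right _
  case cross_zero_left => exact cross_zero_left _
  case cross_zero_right => exact cross_zero_right _
  case exterior hk => exact exterior _ hk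
  case associativity => exact associativity _ _ _ _ _ _ _ _ _ _
  case coassociativity => exact coassociativity _ _ _ _ _ _ _ _ _ _
  case digon => exact digon _ _ _ _

theorem subst_braidWord (hτ : ∀ ⦃X Y : Ob⦄ (g : AGen X Y), τ (ι g) = Tm.gen (ι' g)) (X Y : Ob) :
    (braidWord ι X Y).subst τ = braidWord ι' X Y := by
  induction X with
  | unit => rfl
  | of m =>
    change (braidStrand ι m Y).subst τ = braidStrand ι' m Y
    induction Y with
    | unit => rfl
    | of n => exact hτ _
    | tensor Y Y' h h' => simp only [braidStrand, Tm.subst, h, h']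
  | tensor X X' h h' => simp only [braidWord, Tm.subst, h, h']

end Subst

/-! The action on the shapes of terms that occur in the relations. -/

section

variable {𝕜 : Type} [CommRing 𝕜] {P : Presentation 𝕜} {A B C D E F K L M Q : Ob}

theorem act_snake_left (u : Tm 𝕜 P.Gen .unit (B ⊙ C)) (c : Tm 𝕜 P.Gen (A ⊙ B) .unit) (Z : Presented
    P) :
    (Tm.rUnitInv _ ⨟ (Tm.id A ⊠ u) ⨟ Tm.assocInv _ _ _ ⨟ (c ⊠ Tm.id C) ⨟ Tm.lUnit _ : Tm 𝕜 P.Gen _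
      _).act Z =
      (place P A).map (u.act Z) ≫ c.act _ := by
  simp only [act_comp, act_tensor, act_id, act_assocInv, act_lUnit, act_rUnitInv,
    CategoryTheory.Functor.map_id, Category.id_comp, Category.comp_id]

theorem act_snake_right (u : Tm 𝕜 P.Gen .unit (A ⊙ B)) (c : Tm 𝕜 P.Gen (B ⊙ C) .unit) (Z : Presented
    P) :
    (Tm.lUnitInv _ ⨟ (u ⊠ Tm.id C) ⨟ Tm.assoc _ _ _ ⨟ (Tm.id A ⊠ c) ⨟ Tm.rUnit _ : Tm 𝕜 P.Gen _ _).act Z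
      =
      u.act _ ≫ (place P A).map (c.act Z) := by
  simp only [act_comp, act_tensor, act_id, act_assoc, act_lUnitInv, act_rUnit,
    CategoryTheory.Functor.map_id, Category.id_comp, Category.comp_id]

theorem act_rotate_right (u : Tm 𝕜 P.Gen .unit (A ⊙ C)) (v : Tm 𝕜 P.Gen .unit (B ⊙ D)) (g : Tm 𝕜
    P.Gen (A ⊙ B) E) (c : Tm 𝕜 P.Gen (F ⊙ E) .unit) (Z : Presented P) :
    (Tm.rUnitInv _ ⨟ (Tm.id F ⊠ (u ⨟ Tm.insert A C v)) ⨟ (Tm.id F ⊠ (g ⊠ Tm.id (D ⊙ C))) ⨟ Tm.assocInv _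
      _ _ ⨟ (c ⊠ Tm.id (D ⊙ C)) ⨟ Tm.lUnit _ : Tm 𝕜 P.Gen _ _).act Z =
      (place P F).map (u.act Z) ≫ (place P F).map ((place P A).map (v.act _)) ≫
        (place P F).map (g.act _)
        ≫ c.act _ := by
  simp only [act_comp, act_tensor, act_id, act_assocInv, act_lUnit, act_rUnitInv, act_insert,
    Functor.map_comp, CategoryTheory.Functor.map_id, Category.id_comp, Category.comp_id,
    Category.assoc]
  rfl

theorem act_rotate_left (u : Tm 𝕜 P.Gen .unit (A ⊙ C)) (v : Tm 𝕜 P.Gen .unit (B ⊙ D)) (g : Tm 𝕜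
    P.Gen (D ⊙ C) E) (c : Tm 𝕜 P.Gen (E ⊙ F) .unit) (Z : Presented P) :
    (Tm.lUnitInv _ ⨟ ((u ⨟ Tm.insert A C v) ⊠ Tm.id F) ⨟ ((Tm.id (A ⊙ B) ⊠ g) ⊠ Tm.id F) ⨟ Tm.assoc _ _
      _ ⨟ (Tm.id (A ⊙ B) ⊠ c) ⨟ Tm.rUnit _ : Tm 𝕜 P.Gen _ _).act Z =
      u.act _ ≫ (place P A).map (v.act _) ≫ (place P A).map ((place P B).map (g.act _)) ≫
        (place P A).map
        ((place P B).map (c.act Z)) := by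
  simp only [act_comp, act_tensor, act_id, act_assoc, act_lUnitInv, act_rUnit, act_insert,
    CategoryTheory.Functor.map_id, Category.id_comp, Category.comp_id, Category.assoc]
  rfl

theorem act_rotate_quarter (u : Tm 𝕜 P.Gen .unit (C ⊙ D)) (g : Tm 𝕜 P.Gen (B ⊙ C) (E ⊙ F)) (c : Tm 𝕜
    P.Gen (A ⊙ E) .unit) (Z : Presented P) :
    (Tm.rUnitInv _ ⨟ (Tm.id (A ⊙ B) ⊠ u) ⨟ Tm.mid A D g ⨟ (c ⊠ Tm.id (F ⊙ D)) ⨟ Tm.lUnit _ : Tm 𝕜 P.Gen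
      _ _).act Z =
      (place P A).map ((place P B).map (u.act Z)) ≫ (place P A).map (g.act _) ≫ c.act _ := by
  simp only [act_comp, act_tensor, act_id, act_lUnit, act_rUnitInv, act_mid,
    CategoryTheory.Functor.map_id, Category.id_comp, Category.comp_id]
  rfl

theorem act_close_right (f : Tm 𝕜 P.Gen A (B ⊙ C)) (g : Tm 𝕜 P.Gen B (D ⊙ E)) (c : Tm 𝕜 P.Gen (E ⊙
    C) .unit) (Z : Presented P) :
    (f ⨟ (g ⊠ Tm.id C) ⨟ Tm.assoc _ _ _ ⨟ (Tm.id D ⊠ c) ⨟ Tm.rUnit _ : Tm 𝕜 P.Gen _ _).act Z =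
      f.act Z ≫ g.act _ ≫ (place P D).map (c.act Z) := by
  simp only [act_comp, act_tensor, act_id, act_assoc, act_rUnit, CategoryTheory.Functor.map_id,
    Category.id_comp, Category.comp_id]

theorem act_close_left (f : Tm 𝕜 P.Gen A (B ⊙ C)) (g : Tm 𝕜 P.Gen C (D ⊙ E)) (c : Tm 𝕜 P.Gen (B ⊙ D)
    .unit) (Z : Presented P) :
    (f ⨟ (Tm.id B ⊠ g) ⨟ Tm.assocInv _ _ _ ⨟ (c ⊠ Tm.id E) ⨟ Tm.lUnit _ : Tm 𝕜 P.Gen _ _).act Z =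
      f.act Z ≫ (place P B).map (g.act Z) ≫ c.act _ := by
  simp only [act_comp, act_tensor, act_id, act_assocInv, act_lUnit, CategoryTheory.Functor.map_id,
    Category.id_comp, Category.comp_id]

theorem act_insert_tensor (u : Tm 𝕜 P.Gen .unit (B ⊙ C)) (f : Tm 𝕜 P.Gen (A ⊙ B) E) (g : Tm 𝕜 P.Gen
    (C ⊙ D) F) (Z : Presented P) :
    (Tm.insert A D u ⨟ (f ⊠ g) : Tm 𝕜 P.Gen _ _).act Z =
      (place P A).map (u.act _) ≫ (place P A).map ((place P B).map (g.act Z)) ≫ f.act _ := by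
  simp only [act_comp, act_tensor, act_insert]
  rfl

theorem act_tensor_contract (f : Tm 𝕜 P.Gen E (A ⊙ B)) (g : Tm 𝕜 P.Gen F (C ⊙ D)) (c : Tm 𝕜 P.Gen (B
    ⊙ C) .unit) (Z : Presented P) :
    ((f ⊠ g) ⨟ Tm.contract A D c : Tm 𝕜 P.Gen _ _).act Z =
      (place P E).map (g.act Z) ≫ f.act _ ≫ (place P A).map (c.act _) := by
  simp only [act_comp, act_tensor, act_contract, Category.assoc]

theorem act_bubble (u : Tm 𝕜 P.Gen .unit (B ⊙ C)) (f : Tm 𝕜 P.Gen (A ⊙ B) D) (g : Tm 𝕜 P.Gen D (E ⊙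
    F)) (c : Tm 𝕜 P.Gen (F ⊙ C) .unit) (Z : Presented P) :
    (Tm.rUnitInv _ ⨟ (Tm.id A ⊠ u) ⨟ Tm.assocInv _ _ _ ⨟ ((f ⨟ g) ⊠ Tm.id C) ⨟ Tm.assoc _ _ _ ⨟ (Tm.id E
      ⊠ c) ⨟ Tm.rUnit _ : Tm 𝕜 P.Gen _ _).act Z =
      (place P A).map (u.act Z) ≫ f.act _ ≫ g.act _ ≫ (place P E).map (c.act Z) := by
  simp only [act_comp, act_tensor, act_id, act_assoc, act_assocInv, act_rUnit, act_rUnitInv,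
    CategoryTheory.Functor.map_id, Category.id_comp, Category.comp_id, Category.assoc]

theorem act_pass_cap (f : Tm 𝕜 P.Gen (A ⊙ B) (D ⊙ E)) (g : Tm 𝕜 P.Gen (E ⊙ C) (F ⊙ K)) (c : Tm 𝕜
    P.Gen (D ⊙ F) .unit) (Z : Presented P) :
    ((Tm.assocInv _ _ _ ⨟ (f ⊠ Tm.id C) ⨟ Tm.assoc _ _ _ ⨟ (Tm.id D ⊠ g) ⨟ Tm.assocInv _ _ _) ⨟ (c ⊠
      Tm.id K) ⨟ Tm.lUnit _ : Tm 𝕜 P.Gen _ _).act Z =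
      f.act _ ≫ (place P D).map (g.act Z) ≫ c.act _ := by
  simp only [act_comp, act_tensor, act_id, act_assoc, act_assocInv, act_lUnit,
    CategoryTheory.Functor.map_id, Category.id_comp, Category.comp_id, Category.assoc]

theorem act_cup_pass (u : Tm 𝕜 P.Gen .unit (B ⊙ C)) (f : Tm 𝕜 P.Gen (A ⊙ B) (D ⊙ E)) (g : Tm 𝕜 P.Gen
    (E ⊙ C) (F ⊙ K)) (Z : Presented P) :
    (Tm.rUnitInv _ ⨟ (Tm.id A ⊠ u) ⨟ Tm.assocInv _ _ _ ⨟ (f ⊠ Tm.id C) ⨟ Tm.assoc _ _ _ ⨟ (Tm.id D ⊠ g)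
      ⨟ Tm.assocInv _ _ _ : Tm 𝕜 P.Gen _ _).act Z =
      (place P A).map (u.act Z) ≫ f.act _ ≫ (place P D).map (g.act Z) := by
  simp only [act_comp, act_tensor, act_id, act_assoc, act_assocInv, act_rUnitInv,
    CategoryTheory.Functor.map_id, Category.id_comp, Category.comp_id]

theorem act_id_tensor_cap (c : Tm 𝕜 P.Gen (B ⊙ C) .unit) (Z : Presented P) :
    ((Tm.id A ⊠ c) ⨟ Tm.rUnit _ : Tm 𝕜 P.Gen _ _).act Z =
      (place P A).map (c.act Z) := by
  simp only [act_comp, act_tensor, act_id, act_rUnit, Category.comp_id]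

theorem act_cup_tensor_id (u : Tm 𝕜 P.Gen .unit (B ⊙ C)) (Z : Presented P) :
    (Tm.lUnitInv _ ⨟ (u ⊠ Tm.id A) : Tm 𝕜 P.Gen _ _).act Z =
      u.act _ := by
  simp only [act_comp, act_tensor, act_id, act_lUnitInv, CategoryTheory.Functor.map_id,
    Category.id_comp]

theorem act_tensor_id_caps (f : Tm 𝕜 P.Gen E F) (g : Tm 𝕜 P.Gen F (A ⊙ B)) (c : Tm 𝕜 P.Gen (B ⊙ C)
    .unit) (d : Tm 𝕜 P.Gen (A ⊙ D) .unit) (Z : Presented P) :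
    (((f ⨟ g) ⊠ Tm.id (C ⊙ D)) ⨟ Tm.contract A D c ⨟ d : Tm 𝕜 P.Gen _ _).act Z =
      f.act _ ≫ g.act _ ≫ (place P A).map (c.act _) ≫ d.act Z := by
  simp only [act_comp, act_tensor, act_id, act_contract, CategoryTheory.Functor.map_id,
    Category.id_comp, Category.assoc]
  rfl

theorem act_id_tensor_caps (f : Tm 𝕜 P.Gen E F) (g : Tm 𝕜 P.Gen F (C ⊙ D)) (c : Tm 𝕜 P.Gen (B ⊙ C)
    .unit) (d : Tm 𝕜 P.Gen (A ⊙ D) .unit) (Z : Presented P) :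
    ((Tm.id (A ⊙ B) ⊠ (f ⨟ g)) ⨟ Tm.contract A D c ⨟ d : Tm 𝕜 P.Gen _ _).act Z =
      (place P A).map ((place P B).map (f.act Z ≫ g.act Z)) ≫ (place P A).map (c.act _) ≫
        d.act Z := by
  simp only [act_comp, act_tensor, act_id, act_contract, Functor.map_comp, Category.comp_id,
    Category.assoc]
  rfl

theorem act_cups_tensor_id (u : Tm 𝕜 P.Gen .unit (A ⊙ D)) (v : Tm 𝕜 P.Gen .unit (B ⊙ C)) (f : Tm 𝕜
    P.Gen (A ⊙ B) E) (g : Tm 𝕜 P.Gen E F) (Z : Presented P) :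
    (u ⨟ Tm.insert A D v ⨟ ((f ⨟ g) ⊠ Tm.id (C ⊙ D)) : Tm 𝕜 P.Gen _ _).act Z =
      u.act Z ≫ (place P A).map (v.act _) ≫ f.act _ ≫ g.act _ := by
  simp only [act_comp, act_tensor, act_id, act_insert, CategoryTheory.Functor.map_id,
    Category.id_comp]
  rfl

theorem act_cups_id_tensor (u : Tm 𝕜 P.Gen .unit (A ⊙ D)) (v : Tm 𝕜 P.Gen .unit (B ⊙ C)) (f : Tm 𝕜
    P.Gen (C ⊙ D) E) (g : Tm 𝕜 P.Gen E F) (Z : Presented P) :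
    (u ⨟ Tm.insert A D v ⨟ (Tm.id (A ⊙ B) ⊠ (f ⨟ g)) : Tm 𝕜 P.Gen _ _).act Z =
      u.act Z ≫ (place P A).map (v.act _) ≫ (place P A).map ((place P B).map (f.act Z ≫
        g.act Z)) := by
  simp only [act_comp, act_tensor, act_id, act_insert, Functor.map_comp, Category.comp_id]
  rfl

theorem act_nested_cap (f : Tm 𝕜 P.Gen E (A ⊙ B)) (g : Tm 𝕜 P.Gen F (C ⊙ D)) (c : Tm 𝕜 P.Gen (B ⊙ C)
    .unit) (d : Tm 𝕜 P.Gen (A ⊙ D) .unit) (Z : Presented P) :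
    ((f ⊠ g) ⨟ Tm.contract A D c ⨟ d : Tm 𝕜 P.Gen _ _).act Z =
      (place P E).map (g.act Z) ≫ f.act _ ≫ (place P A).map (c.act _) ≫ d.act Z := by
  simp only [act_comp, act_tensor, act_contract, Category.assoc]

theorem act_nested_cup (u : Tm 𝕜 P.Gen .unit (A ⊙ D)) (v : Tm 𝕜 P.Gen .unit (B ⊙ C)) (f : Tm 𝕜 P.Gen
    (A ⊙ B) E) (g : Tm 𝕜 P.Gen (C ⊙ D) F) (Z : Presented P) :
    (u ⨟ Tm.insert A D v ⨟ (f ⊠ g) : Tm 𝕜 P.Gen _ _).act Z =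
      u.act Z ≫ (place P A).map (v.act _) ≫ (place P A).map ((place P B).map (g.act Z)) ≫
        f.act _ := by
  simp only [act_comp, act_tensor, act_insert]
  rfl

end

/-! ### Sartori's webs as an action with exploded caps and cups -/

namespace Sartori

variable (𝕜 : Type) [Field 𝕜] (N : ℕ)

/-- The action of merges, splits and crossings on Sartori's webs. -/
def webAction : WebAction (SartoriWeb 𝕜 N) :=
  OrthogonalWebs.webAction (P :=
    sartoriPresentation 𝕜 N) SGen.ofA (fun _ _ _ _ h => SGen.Rel.typeA h)

variable {𝕜 N}

/-- The action of the thin cap. -/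
def thinCap (Z : SartoriWeb 𝕜 N) :
    ((webAction 𝕜 N).F 1).obj (((webAction 𝕜 N).F 1).obj Z) ⟶ Z :=
  Tm.act (P := sartoriPresentation 𝕜 N) SGen.capTm Z

/-- The action of the thin cup. -/
def thinCup (Z : SartoriWeb 𝕜 N) :
    Z ⟶ ((webAction 𝕜 N).F 1).obj (((webAction 𝕜 N).F 1).obj Z) :=
  Tm.act (P := sartoriPresentation 𝕜 N) SGen.cupTm Z

/-- The action of nested thin caps. -/
def nestedCap (k : ℕ) (Z : SartoriWeb 𝕜 N) :
    ((webAction 𝕜 N).F k).obj (((webAction 𝕜 N).F k).obj Z) ⟶ Z :=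
  Tm.act (P := sartoriPresentation 𝕜 N) (SGen.nestedCap k) Z

/-- The action of nested thin cups. -/
def nestedCup (k : ℕ) (Z : SartoriWeb 𝕜 N) :
    Z ⟶ ((webAction 𝕜 N).F k).obj (((webAction 𝕜 N).F k).obj Z) :=
  Tm.act (P := sartoriPresentation 𝕜 N) (SGen.nestedCup k) Z

/-- The action of the thick cap. -/
def thickCap (k : ℕ) (Z : SartoriWeb 𝕜 N) :
    ((webAction 𝕜 N).F k).obj (((webAction 𝕜 N).F k).obj Z) ⟶ Z :=
  Tm.act (P := sartoriPresentation 𝕜 N) (SGen.thickCap k) Z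

/-- The action of the thick cup. -/
def thickCup (k : ℕ) (Z : SartoriWeb 𝕜 N) :
    Z ⟶ ((webAction 𝕜 N).F k).obj (((webAction 𝕜 N).F k).obj Z) :=
  Tm.act (P := sartoriPresentation 𝕜 N) (SGen.thickCup k) Z

theorem thickCap_eq (k : ℕ) (Z : SartoriWeb 𝕜 N) :
    thickCap k Z = (k.factorial : 𝕜)⁻¹ • nestedCap k Z := rfl

theorem thickCup_eq (k : ℕ) (Z : SartoriWeb 𝕜 N) :
    thickCup k Z = (k.factorial : 𝕜)⁻¹ • nestedCup k Z := rfl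

theorem nestedCap_succ {k : ℕ} (h : 1 + k = k + 1) (Z : SartoriWeb 𝕜 N) : nestedCap (k + 1) Z =
    ((webAction 𝕜 N).F (k + 1)).map ((webAction 𝕜 N).s rfl Z) ≫ (webAction 𝕜 N).s h _ ≫
      ((webAction 𝕜 N).F 1).map (nestedCap k _) ≫ thinCap Z := by
  refine Eq.trans (b := (((webAction 𝕜 N).F (k + 1)).map ((webAction 𝕜 N).s rfl Z) ≫
    (webAction 𝕜 N).s h _) ≫ (_ ≫ thinCap Z)) rfl ?_
  rw [Category.assoc]
  congr 3
  exact act_contract (P := sartoriPresentation 𝕜 N) _ _ _ _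

theorem nestedCup_succ {k : ℕ} (h : 1 + k = k + 1) (Z : SartoriWeb 𝕜 N) : nestedCup (k + 1) Z =
    thinCup Z ≫ ((webAction 𝕜 N).F 1).map (nestedCup k _) ≫
      ((webAction 𝕜 N).F 1).map (((webAction 𝕜 N).F k).map ((webAction 𝕜 N).m rfl Z)) ≫
        (webAction 𝕜 N).m h _ := by
  refine Eq.trans (b := thinCup Z ≫ _ ≫ ((webAction 𝕜 N).F 1).map (((webAction 𝕜 N).F k).map
    ((webAction 𝕜 N).m rfl Z)) ≫ (webAction 𝕜 N).m h _) rfl ?_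
  congr 2
  exact act_insert (P := sartoriPresentation 𝕜 N) _ _ _ _

/-- One explosion step of a thin strand splits off strands of thickness zero only. Hence the thin
cap is a member of the exploded family. -/
theorem thickCap_one (Z : SartoriWeb 𝕜 N) : thickCap 1 Z = thinCap Z := by
  have h₁ : (webAction 𝕜 N).s (rfl : 0 + 1 = 1) Z = 𝟙 _ := (webAction 𝕜 N).s_zero_left _ _
  have h₂ : (webAction 𝕜 N).s (rfl : 1 + 0 = 1) (((webAction 𝕜 N).F 1).obj Z) = 𝟙 _ :=
    ((webAction 𝕜 N).s_zero_right _ _).trans (CategoryTheory.Functor.map_id _ _)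
  rw [thickCap_eq, Nat.factorial_one, Nat.cast_one, inv_one, one_smul]
  refine (nestedCap_succ (k :=
    0) rfl Z).trans ((congrArg₂ (fun u v => ((webAction 𝕜 N).F 1).map u ≫ v ≫
    ((webAction 𝕜 N).F 1).map (𝟙 (((webAction 𝕜 N).F 1).obj Z)) ≫ thinCap Z) h₁ h₂).trans ?_)
  change ((webAction 𝕜 N).F 1).map (𝟙 (((webAction 𝕜 N).F 1).obj Z)) ≫ 𝟙 _ ≫
    ((webAction 𝕜 N).F 1).map (𝟙 (((webAction 𝕜 N).F 1).obj Z)) ≫ thinCap Z = _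
  simp only [CategoryTheory.Functor.map_id, Category.id_comp]

theorem thickCup_one (Z : SartoriWeb 𝕜 N) : thickCup 1 Z = thinCup Z := by
  have h₁ : (webAction 𝕜 N).m (rfl : 0 + 1 = 1) Z = 𝟙 _ := (webAction 𝕜 N).m_zero_left _ _
  have h₂ : (webAction 𝕜 N).m (rfl : 1 + 0 = 1) (((webAction 𝕜 N).F 1).obj Z) = 𝟙 _ :=
    ((webAction 𝕜 N).m_zero_right _ _).trans (CategoryTheory.Functor.map_id _ _)
  rw [thickCup_eq, Nat.factorial_one, Nat.cast_one, inv_one, one_smul]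
  refine (nestedCup_succ (k := 0) rfl Z).trans ((congrArg₂ (fun u v => thinCup Z ≫
    ((webAction 𝕜 N).F 1).map (𝟙 (((webAction 𝕜 N).F 1).obj Z)) ≫
      ((webAction 𝕜 N).F 1).map u ≫ v) h₁ h₂).trans ?_)
  change thinCup Z ≫ ((webAction 𝕜 N).F 1).map (𝟙 (((webAction 𝕜 N).F 1).obj Z)) ≫
    ((webAction 𝕜 N).F 1).map (𝟙 (((webAction 𝕜 N).F 1).obj Z)) ≫ 𝟙 _ = _
  simp only [CategoryTheory.Functor.map_id, Category.comp_id]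

theorem circle (Z : SartoriWeb 𝕜 N) : thinCup Z ≫ thinCap Z = N • 𝟙 Z :=
  (Eqv.act_eq (P := sartoriPresentation 𝕜 N) (.rel .circle) Z).trans
    (Nat.cast_smul_eq_nsmul 𝕜 N (𝟙 Z))

theorem bubble (Z : SartoriWeb 𝕜 N) : ((webAction 𝕜 N).F 1).map (thinCup Z) ≫
    (webAction 𝕜 N).m (rfl : 1 + 1 = 2) _ ≫ (webAction 𝕜 N).s rfl _ ≫
      ((webAction 𝕜 N).F 1).map (thinCap Z) + 𝟙 _ = N • 𝟙 _ := by
  have h := (act_bubble (P := sartoriPresentation 𝕜 N) SGen.cupTm (merge SGen.ofA 1 1 2 rfl)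
    (split SGen.ofA 1 1 2 rfl) SGen.capTm Z).symm.trans (Eqv.act_eq (.rel SGen.Rel.bubble) Z)
  refine (congrArg (fun t : ((webAction 𝕜 N).F 1).obj Z ⟶ ((webAction 𝕜 N).F 1).obj Z => t + 𝟙 _) h).trans ?_
  change ((N : 𝕜) - 1) • 𝟙 (((webAction 𝕜 N).F 1).obj Z) + 𝟙 _ = _
  rw [sub_smul, one_smul, sub_add_cancel, Nat.cast_smul_eq_nsmul]

theorem split_thinCap (Z : SartoriWeb 𝕜 N) :
    (webAction 𝕜 N).s (rfl : 1 + 1 = 2) Z ≫ thinCap Z = 0 :=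
  Eqv.act_eq (P := sartoriPresentation 𝕜 N) (.rel .lollipop_cap) Z

theorem thinCup_merge (Z : SartoriWeb 𝕜 N) :
    thinCup Z ≫ (webAction 𝕜 N).m (rfl : 1 + 1 = 2) Z = 0 :=
  Eqv.act_eq (P := sartoriPresentation 𝕜 N) (.rel .lollipop_cup) Z

theorem slide_cap (l : ℕ) (Z : SartoriWeb 𝕜 N) : (webAction 𝕜 N).x l 1 _ ≫
    ((webAction 𝕜 N).F 1).map ((webAction 𝕜 N).x l 1 Z) ≫ thinCap _ =
      ((webAction 𝕜 N).F l).map (thinCap Z) :=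
  (act_pass_cap (P := sartoriPresentation 𝕜 N) (cross SGen.ofA l 1) (cross SGen.ofA l 1)
    SGen.capTm Z).symm.trans ((Eqv.act_eq (.rel (SGen.Rel.slide_cap l)) Z).trans (act_id_tensor_cap _ Z))

theorem slide_cup (l : ℕ) (Z : SartoriWeb 𝕜 N) : ((webAction 𝕜 N).F l).map (thinCup Z) ≫
    (webAction 𝕜 N).x l 1 _ ≫ ((webAction 𝕜 N).F 1).map ((webAction 𝕜 N).x l 1 Z) = thinCup _ :=
  (act_cup_pass (P := sartoriPresentation 𝕜 N) SGen.cupTm (cross SGen.ofA l 1)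
    (cross SGen.ofA l 1) Z).symm.trans
      ((Eqv.act_eq (.rel (SGen.Rel.slide_cup l)) Z).trans (act_cup_tensor_id _ Z))

theorem mergeSplit_cap (Z : SartoriWeb 𝕜 N) : (webAction 𝕜 N).m (rfl : 1 + 1 = 2) _ ≫
    (webAction 𝕜 N).s rfl _ ≫ ((webAction 𝕜 N).F 1).map (thinCap _) ≫ thinCap Z =
      ((webAction 𝕜 N).F 1).map (((webAction 𝕜 N).F 1).map
        ((webAction 𝕜 N).m (rfl : 1 + 1 = 2) Z ≫ (webAction 𝕜 N).s rfl Z)) ≫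
          ((webAction 𝕜 N).F 1).map (thinCap _) ≫ thinCap Z :=
  (act_tensor_id_caps (P := sartoriPresentation 𝕜 N) (merge SGen.ofA 1 1 2 rfl)
    (split SGen.ofA 1 1 2 rfl) SGen.capTm SGen.capTm Z).symm.trans
      ((Eqv.act_eq (.rel SGen.Rel.mergeSplit_cap) Z).trans (act_id_tensor_caps _ _ _ _ Z))

variable [CharZero 𝕜]

/-- The factor k + 1 is the quotient of consecutive factorials in the normalization. -/
theorem thickCap_succ {k : ℕ} (h : 1 + k = k + 1) (Z : SartoriWeb 𝕜 N) :
    (k + 1) • thickCap (k + 1) Z =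
      ((webAction 𝕜 N).F (k + 1)).map ((webAction 𝕜 N).s rfl Z) ≫ (webAction 𝕜 N).s h _ ≫
        ((webAction 𝕜 N).F 1).map (thickCap k _) ≫ thickCap 1 Z := by
  have e : ((webAction 𝕜 N).F 1).map (thickCap k (((webAction 𝕜 N).F 1).obj Z)) =
      (k.factorial : 𝕜)⁻¹ • ((webAction 𝕜 N).F 1).map (nestedCap k (((webAction 𝕜 N).F 1).obj Z)) :=
    (place (sartoriPresentation 𝕜 N) (ob 1)).map_smul _ _
  have h₁ : (k.factorial : 𝕜) ≠ 0 := Nat.cast_ne_zero.2 k.factorial_ne_zero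
  have h₂ : (k : 𝕜) + 1 ≠ 0 := Nat.cast_add_one_ne_zero k
  rw [thickCap_one, e, thickCap_eq, nestedCap_succ h, ← Nat.cast_smul_eq_nsmul 𝕜, smul_smul,
    Linear.smul_comp, Linear.comp_smul, Linear.comp_smul, Nat.factorial_succ]
  congr 1
  push_cast
  field_simp

theorem thickCup_succ {k : ℕ} (h : 1 + k = k + 1) (Z : SartoriWeb 𝕜 N) :
    (k + 1) • thickCup (k + 1) Z =
      thickCup 1 Z ≫ ((webAction 𝕜 N).F 1).map (thickCup k _) ≫
        ((webAction 𝕜 N).F 1).map (((webAction 𝕜 N).F k).map ((webAction 𝕜 N).m rfl Z)) ≫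
          (webAction 𝕜 N).m h _ := by
  have e : ((webAction 𝕜 N).F 1).map (thickCup k (((webAction 𝕜 N).F 1).obj Z)) =
      (k.factorial : 𝕜)⁻¹ • ((webAction 𝕜 N).F 1).map (nestedCup k (((webAction 𝕜 N).F 1).obj Z)) :=
    (place (sartoriPresentation 𝕜 N) (ob 1)).map_smul _ _
  have h₁ : (k.factorial : 𝕜) ≠ 0 := Nat.cast_ne_zero.2 k.factorial_ne_zero
  have h₂ : (k : 𝕜) + 1 ≠ 0 := Nat.cast_add_one_ne_zero k
  rw [thickCup_one, e, thickCup_eq, nestedCup_succ h, ← Nat.cast_smul_eq_nsmul 𝕜, smul_smul,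
    Linear.smul_comp, Linear.comp_smul, Nat.factorial_succ]
  congr 1
  push_cast
  field_simp

variable (𝕜 N)

/-- The action of Sartori's webs. -/
def orthoAction : OrthoAction N (SartoriWeb 𝕜 N) where
  toWebAction := webAction 𝕜 N
  cap := thickCap
  cup := thickCup
  cap_nat k _ _ f := Tm.act_natural (P := sartoriPresentation 𝕜 N) (SGen.thickCap k) f
  cup_nat k _ _ f := Tm.act_natural (P := sartoriPresentation 𝕜 N) (SGen.thickCup k) f
  cap_zero Z := by
    rw [thickCap_eq, Nat.factorial_zero, Nat.cast_one, inv_one, one_smul]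
    exact (Category.comp_id _).symm
  cup_zero Z := by
    rw [thickCup_eq, Nat.factorial_zero, Nat.cast_one, inv_one, one_smul]
    exact (Category.comp_id _).symm
  cap_succ := thickCap_succ
  cup_succ := thickCup_succ
  circle_one Z := by rw [thickCap_one, thickCup_one, circle]
  bubble_one Z := by rw [thickCap_one, thickCup_one, bubble]
  s_cap_one Z := by rw [thickCap_one, split_thinCap]
  cup_m_one Z := by rw [thickCup_one, thinCup_merge]
  slide_cap_one l Z := by rw [thickCap_one, thickCap_one, slide_cap]
  slide_cup_one l Z := by rw [thickCup_one, thickCup_one, slide_cup]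
  m_s_cap_one Z := by rw [thickCap_one, thickCap_one, mergeSplit_cap]

end Sartori

/-- Sartori's webs satisfy the relations of a symmetric ribbon category. -/
theorem sartori_ribbonRelations (𝕜 : Type) [Field 𝕜] [CharZero 𝕜] (N : ℕ) :
    RibbonRelations (P := sartoriPresentation 𝕜 N) SGen.ofA SGen.thickCap SGen.thickCup where
  cross_cross k l Z := (Sartori.orthoAction 𝕜 N).x_x k l Z
  gen_natural m X Y g Z := by
    have hA : ∀ ⦃X Y : Ob⦄ {f g : Tm 𝕜 (sartoriPresentation 𝕜 N).Gen X Y},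
        TypeARel SGen.ofA N f g → (sartoriPresentation 𝕜 N).Rel f g := fun _ _ _ _ h => .typeA h
    cases g with
    | typeA g => exact typeA_natural (P := sartoriPresentation 𝕜 N) SGen.ofA hA m g Z
    | cap =>
      exact cap_natural (P := sartoriPresentation 𝕜 N) SGen.ofA hA m SGen.capTm Z
        (Sartori.slide_cap (m + 1) Z)
    | cup =>
      exact cup_natural (P := sartoriPresentation 𝕜 N) SGen.ofA hA m SGen.cupTm Z
        (Sartori.slide_cup (m + 1) Z)
  zigzag_left k Z := (Sartori.orthoAction 𝕜 N).zigzag_left k Z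
  zigzag_right k Z := (Sartori.orthoAction 𝕜 N).zigzag_right k Z
  cross_cap k Z := (Sartori.orthoAction 𝕜 N).x_cap k Z

section

variable {𝕜 : Type} [CommRing 𝕜] {P Q : Presentation 𝕜} {X Y : Ob}
  (τ : ∀ ⦃X Y : Ob⦄, P.Gen X Y → Tm 𝕜 Q.Gen X Y)

theorem act_subst_dite (p : Prop) [Decidable p] (f : p → Tm 𝕜 P.Gen X Y)
    (g : ¬ p → Tm 𝕜 P.Gen X Y) (Z : Presented Q) :
    ((if h : p then f h else g h).subst τ).act Z =
      if h : p then ((f h).subst τ).act Z else ((g h).subst τ).act Z := by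
  split_ifs <;> rfl

theorem act_subst_sumRange (n : ℕ) (f : ℕ → Tm 𝕜 P.Gen X Y) (Z : Presented Q) :
    ((Tm.sumRange n f).subst τ).act Z = ∑ y ∈ Finset.range n, ((f y).subst τ).act Z := by
  rw [Tm.subst_sumRange, act_sumRange]

end

/-! ### Explosion respects the orthogonal relations -/

namespace Sartori

variable (𝕜 : Type) [Field 𝕜] [CharZero 𝕜] (N : ℕ)

theorem act_ladderE (a k l p q : ℕ) (hp : k + a = p) (hq : a + l = q) (Z : SartoriWeb 𝕜 N) :
    Tm.act (P := sartoriPresentation 𝕜 N)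
      ((OGen.ladderE a k l p q hp hq).subst (explosion 𝕜 N)) Z =
        (orthoAction 𝕜 N).ladderE hp hq Z :=
  act_insert_tensor (P := sartoriPresentation 𝕜 N) (SGen.thickCup a) (merge SGen.ofA k a p hp)
    (merge SGen.ofA a l q hq) Z

theorem act_ladderF (b k l p q : ℕ) (hp : p + b = k) (hq : b + q = l) (Z : SartoriWeb 𝕜 N) :
    Tm.act (P := sartoriPresentation 𝕜 N)
      ((OGen.ladderF b k l p q hp hq).subst (explosion 𝕜 N)) Z =
        (orthoAction 𝕜 N).ladderF hp hq Z :=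
  act_tensor_contract (P := sartoriPresentation 𝕜 N) (split SGen.ofA p b k hp)
    (split SGen.ofA b q l hq) (SGen.thickCap b) Z

/-- Exploded caps and cups satisfy the relations of orthogonal webs. -/
theorem respects_explosion :
    Respects (orthoPresentation 𝕜 N) (sartoriPresentation 𝕜 N) (explosion 𝕜 N) := by
  intro X Y f g h
  let A := orthoAction 𝕜 N
  cases h with
  | typeA h => exact .rel (.typeA (h.subst OGen.ofA SGen.ofA fun _ _ _ => rfl))
  | cap_zero =>
    refine .of_act_eq (P := sartoriPresentation 𝕜 N) fun Z => ?_
    exact (A.cap_zero Z).trans (Category.comp_id _)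
  | cup_zero =>
    refine .of_act_eq (P := sartoriPresentation 𝕜 N) fun Z => ?_
    exact (A.cup_zero Z).trans (Category.comp_id _)
  | zigzag_left k =>
    refine .of_act_eq (P := sartoriPresentation 𝕜 N) fun Z => ?_
    exact (act_snake_left (P :=
      sartoriPresentation 𝕜 N) (SGen.thickCup k) (SGen.thickCap k) Z).trans
      (A.zigzag_left k Z)
  | zigzag_right k =>
    refine .of_act_eq (P := sartoriPresentation 𝕜 N) fun Z => ?_
    exact (act_snake_right (P := sartoriPresentation 𝕜 N) (SGen.thickCup k) (SGen.thickCap k)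
      Z).trans (A.zigzag_right k Z)
  | turn_right k l n h =>
    refine .of_act_eq (P := sartoriPresentation 𝕜 N) fun Z => ?_
    refine (act_rotate_right (P := sartoriPresentation 𝕜 N) (SGen.thickCup k) (SGen.thickCup l)
      (merge SGen.ofA k l n h) (SGen.thickCap n) Z).trans (Eq.trans ?_ (A.turn_right h ((Nat.add_comm l k).trans h) Z))
    rw [Functor.map_comp, Category.assoc]
    rfl
  | turn_left k l n h =>
    refine .of_act_eq (P := sartoriPresentation 𝕜 N) fun Z => ?_
    exact (act_rotate_left (P := sartoriPresentation 𝕜 N) (SGen.thickCup l) (SGen.thickCup k)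
      (merge SGen.ofA k l n h) (SGen.thickCap n) Z).trans (A.turn_left h ((Nat.add_comm l k).trans h) Z)
  | turn_cross k l =>
    refine .of_act_eq (P := sartoriPresentation 𝕜 N) fun Z => ?_
    exact (act_rotate_quarter (P := sartoriPresentation 𝕜 N) (SGen.thickCup k)
      (cross SGen.ofA l k) (SGen.thickCap k) Z).trans (A.turn_cross k l Z)
  | circle k =>
    refine .of_act_eq (P := sartoriPresentation 𝕜 N) fun Z => ?_
    exact (A.circle k Z).trans (Nat.cast_smul_eq_nsmul 𝕜 _ _).symm
  | lollipop_right a l p n ha hp hn =>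
    refine .of_act_eq (P := sartoriPresentation 𝕜 N) fun Z => ?_
    exact (act_close_right (P := sartoriPresentation 𝕜 N) (split SGen.ofA p a n hn)
      (split SGen.ofA l a p hp) (SGen.thickCap a) Z).trans (A.lollipop_right ha hp hn Z)
  | lollipop_left a l p n ha hp hn =>
    refine .of_act_eq (P := sartoriPresentation 𝕜 N) fun Z => ?_
    exact (act_close_left (P := sartoriPresentation 𝕜 N) (split SGen.ofA a p n hn)
      (split SGen.ofA a l p hp) (SGen.thickCap a) Z).trans (A.lollipop_left ha hp hn Z)
  | higherEF k l a b p q hp hq =>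
    refine .of_act_eq (P := sartoriPresentation 𝕜 N) fun Z => ?_
    have e := A.ladderF_ladderE k l a b p q hp hq Z
    refine (act_subst_dite (P := orthoPresentation 𝕜 N) (Q := sartoriPresentation 𝕜 N)
      -- Substitution and action pass through the case distinctions and the sum, so the relation
      -- becomes `ladderF_ladderE` with integral coefficients cast to the field.
      (explosion 𝕜 N) _ _ _ Z).trans (Eq.trans ?_ (e.trans (Eq.trans ?_ (act_subst_sumRange
        (P := orthoPresentation 𝕜 N) (Q := sartoriPresentation 𝕜 N) (explosion 𝕜 N) (min a b + 1)
        (fun x => if H : x ≤ a ∧ x ≤ b then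
            Tm.smul ((Ring.choose ((k : ℤ) + l - N + a - b) x : ℤ) : 𝕜)
              (OGen.ladderE (a - x) k l (k + (a - x)) (l + (a - x)) rfl (by omega) ⨟
                OGen.ladderF (b - x) (k + (a - x)) (l + (a - x)) p q (by omega) (by omega))
          else Tm.zero _ _) Z).symm)))
    · refine dite_congr rfl (fun H => ?_) (fun _ => rfl)
      exact congrArg₂ (· ≫ ·) (act_ladderF 𝕜 N _ _ _ _ _ _ _ Z) (act_ladderE 𝕜 N _ _ _ _ _ _ _ Z)
    · refine Finset.sum_congr rfl fun y _ => ?_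
      by_cases H : y ≤ a ∧ y ≤ b
      swap
      · rw [dif_neg H, dif_neg H]
        rfl
      rw [dif_pos H, dif_pos H]
      refine (Int.cast_smul_eq_zsmul 𝕜 _ _).symm.trans ?_
      exact congrArg (((Ring.choose ((k : ℤ) + l - N + a - b) y : ℤ) : 𝕜) • ·)
        (congrArg₂ (· ≫ ·) (act_ladderE 𝕜 N _ _ _ _ _ _ _ Z) (act_ladderF 𝕜 N _ _ _ _ _ _ _ Z)).symm

end Sartori

/-! ### Thin orthogonal webs satisfy Sartori's relations -/

namespace Ortho

variable (𝕜 : Type) [Field 𝕜] (N : ℕ)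

/-- The action of merges, splits and crossings on orthogonal webs. -/
def webAction : WebAction (OrthoWeb 𝕜 N) :=
  OrthogonalWebs.webAction (P := orthoPresentation 𝕜 N) OGen.ofA (fun _ _ _ _ h => OGen.Rel.typeA h)

/-- The action of orthogonal webs. -/
def pivotalAction : PivotalAction (OrthoWeb 𝕜 N) where
  toWebAction := webAction 𝕜 N
  cap k Z := Tm.act (P := orthoPresentation 𝕜 N) (OGen.capTm k) Z
  cup k Z := Tm.act (P := orthoPresentation 𝕜 N) (OGen.cupTm k) Z
  cap_nat k _ _ f := Tm.act_natural (P := orthoPresentation 𝕜 N) (OGen.capTm k) f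
  cup_nat k _ _ f := Tm.act_natural (P := orthoPresentation 𝕜 N) (OGen.cupTm k) f
  zigzag_left k Z :=
    (act_snake_left (P := orthoPresentation 𝕜 N) (OGen.cupTm k) (OGen.capTm k) Z).symm.trans
      (Eqv.act_eq (.rel (OGen.Rel.zigzag_left k)) Z)
  zigzag_right k Z :=
    (act_snake_right (P := orthoPresentation 𝕜 N) (OGen.cupTm k) (OGen.capTm k) Z).symm.trans
      (Eqv.act_eq (.rel (OGen.Rel.zigzag_right k)) Z)
  turn_right {k l n} h h' Z :=
    (act_rotate_right (P := orthoPresentation 𝕜 N) (OGen.cupTm k) (OGen.cupTm l)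
      (merge OGen.ofA k l n h) (OGen.capTm n) Z).symm.trans
        (Eqv.act_eq (.rel (OGen.Rel.turn_right k l n h)) Z)
  turn_left {k l n} h h' Z :=
    (act_rotate_left (P := orthoPresentation 𝕜 N) (OGen.cupTm l) (OGen.cupTm k)
      (merge OGen.ofA k l n h) (OGen.capTm n) Z).symm.trans
        (Eqv.act_eq (.rel (OGen.Rel.turn_left k l n h)) Z)
  turn_cross k l Z :=
    (act_rotate_quarter (P := orthoPresentation 𝕜 N) (OGen.cupTm k) (cross OGen.ofA l k)
      (OGen.capTm k) Z).symm.trans (Eqv.act_eq (.rel (OGen.Rel.turn_cross k l)) Z)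

variable {𝕜 N}

theorem circle_one (Z : OrthoWeb 𝕜 N) :
    (pivotalAction 𝕜 N).cup 1 Z ≫ (pivotalAction 𝕜 N).cap 1 Z = (N : 𝕜) • 𝟙 Z := by
  have h := Eqv.act_eq (P := orthoPresentation 𝕜 N) (.rel (OGen.Rel.circle 1)) Z
  refine h.trans ?_
  change (N.choose 1 : 𝕜) • 𝟙 Z = _
  rw [Nat.choose_one_right]

/-- The lollipop relation with `l = 0`; its inner split takes off a strand of thickness zero and
acts as the identity. -/
theorem s_cap_one (Z : OrthoWeb 𝕜 N) :
    (pivotalAction 𝕜 N).s (rfl : 1 + 1 = 2) Z ≫ (pivotalAction 𝕜 N).cap 1 Z = 0 := by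
  have h := (act_close_right (P := orthoPresentation 𝕜 N) (split OGen.ofA 1 1 2 rfl)
    (split OGen.ofA 0 1 1 rfl) (OGen.capTm 1) Z).symm.trans
      (Eqv.act_eq (.rel (OGen.Rel.lollipop_right 1 0 1 2 one_pos rfl rfl)) Z)
  have e : (webAction 𝕜 N).s (rfl : 0 + 1 = 1) (((webAction 𝕜 N).F 1).obj Z) = 𝟙 _ :=
    (webAction 𝕜 N).s_zero_left _ _
  refine Eq.trans ?_ ((congrArg (fun t => (webAction 𝕜 N).s (rfl : 1 + 1 = 2) Z ≫ t ≫
    (pivotalAction 𝕜 N).cap 1 Z) e).symm.trans h)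
  exact congrArg ((webAction 𝕜 N).s (rfl : 1 + 1 = 2) Z ≫ ·) (Category.id_comp _).symm

theorem act_ladderE (a k l p q : ℕ) (hp : k + a = p) (hq : a + l = q) (Z : OrthoWeb 𝕜 N) :
    Tm.act (P := orthoPresentation 𝕜 N) (OGen.ladderE a k l p q hp hq) Z =
      ((webAction 𝕜 N).F k).map ((pivotalAction 𝕜 N).cup a _) ≫
        ((webAction 𝕜 N).F k).map (((webAction 𝕜 N).F a).map ((webAction 𝕜 N).m hq Z)) ≫
          (webAction 𝕜 N).m hp _ :=
  act_insert_tensor (P := orthoPresentation 𝕜 N) (OGen.cupTm a) (merge OGen.ofA k a p hp)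
    (merge OGen.ofA a l q hq) Z

theorem act_ladderF (b k l p q : ℕ) (hp : p + b = k) (hq : b + q = l) (Z : OrthoWeb 𝕜 N) :
    Tm.act (P := orthoPresentation 𝕜 N) (OGen.ladderF b k l p q hp hq) Z =
      ((webAction 𝕜 N).F k).map ((webAction 𝕜 N).s hq Z) ≫ (webAction 𝕜 N).s hp _ ≫
        ((webAction 𝕜 N).F p).map ((pivotalAction 𝕜 N).cap b _) :=
  act_tensor_contract (P := orthoPresentation 𝕜 N) (split OGen.ofA p b k hp)
    (split OGen.ofA b q l hq) (OGen.capTm b) Z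

theorem merge_one_zero (Z : OrthoWeb 𝕜 N) : (webAction 𝕜 N).m (rfl : 1 + 0 = 1) Z = 𝟙 _ :=
  ((webAction 𝕜 N).m_zero_right _ _).trans (CategoryTheory.Functor.map_id _ _)

theorem split_one_zero (Z : OrthoWeb 𝕜 N) : (webAction 𝕜 N).s (rfl : 1 + 0 = 1) Z = 𝟙 _ :=
  ((webAction 𝕜 N).s_zero_right _ _).trans (CategoryTheory.Functor.map_id _ _)

theorem cap_zero (Z : OrthoWeb 𝕜 N) : (pivotalAction 𝕜 N).cap 0 Z = 𝟙 Z :=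
  Eqv.act_eq (P := orthoPresentation 𝕜 N) (.rel OGen.Rel.cap_zero) Z

theorem cup_zero (Z : OrthoWeb 𝕜 N) : (pivotalAction 𝕜 N).cup 0 Z = 𝟙 Z :=
  Eqv.act_eq (P := orthoPresentation 𝕜 N) (.rel OGen.Rel.cup_zero) Z

/-- The relation between ladders on the word `1 ⊗ 0`. -/
theorem ladder_one_zero (Z : OrthoWeb 𝕜 N) :
    0 = (Tm.act (P := orthoPresentation 𝕜 N) (OGen.ladderE 1 1 0 2 1 rfl rfl) Z ≫
      Tm.act (P := orthoPresentation 𝕜 N) (OGen.ladderF 1 2 1 1 0 rfl rfl) Z) +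
      ((1 : 𝕜) - N) • (Tm.act (P := orthoPresentation 𝕜 N) (OGen.ladderE 0 1 0 1 0 rfl rfl) Z ≫
      Tm.act (P := orthoPresentation 𝕜 N) (OGen.ladderF 0 1 0 1 0 rfl rfl) Z) := by
  -- On `1 ⊗ 0` with `a = b = 1` the left side is zero, since a rung of thickness 1 exceeds the
  -- strand of thickness 0. The sum has the terms x = 0, 1 with coefficients 1 and 1 - N.
  have h := Eqv.act_eq (P := orthoPresentation 𝕜 N)
    (.rel (OGen.Rel.higherEF 1 0 1 1 1 0 rfl rfl)) Z
  let c : ℤ := ((1 : ℕ) : ℤ) + ((0 : ℕ) : ℤ) - N + ((1 : ℕ) : ℤ) - ((1 : ℕ) : ℤ)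
  have e : ((Ring.choose c 0 : ℤ) : 𝕜) = 1 := by simp
  have e' : ((Ring.choose c 1 : ℤ) : 𝕜) = 1 - N := by simp [c]
  refine Eq.trans h (Eq.trans (b := (0 + ((Ring.choose c 0 : ℤ) : 𝕜) • _) +
    ((Ring.choose c 1 : ℤ) : 𝕜) • _) rfl ?_)
  rw [e, e', one_smul, zero_add]
  rfl

theorem ladderE_one (Z : OrthoWeb 𝕜 N) :
    Tm.act (P := orthoPresentation 𝕜 N) (OGen.ladderE 1 1 0 2 1 rfl rfl) Z =
      ((webAction 𝕜 N).F 1).map ((pivotalAction 𝕜 N).cup 1 Z) ≫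
        (webAction 𝕜 N).m (rfl : 1 + 1 = 2) _ := by
  refine (act_ladderE _ _ _ _ _ _ _ Z).trans ((congrArg (fun t =>
    ((webAction 𝕜 N).F 1).map ((pivotalAction 𝕜 N).cup 1 Z) ≫ ((webAction 𝕜 N).F 1).map
      (((webAction 𝕜 N).F 1).map t) ≫ (webAction 𝕜 N).m (rfl : 1 + 1 = 2) _)
        (merge_one_zero Z)).trans ?_)
  change _ ≫ ((webAction 𝕜 N).F 1).map (((webAction 𝕜 N).F 1).map (𝟙
    (((webAction 𝕜 N).F 1).obj Z))) ≫ _ = _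
  simp only [CategoryTheory.Functor.map_id, Category.id_comp]
  rfl

theorem ladderF_one (Z : OrthoWeb 𝕜 N) :
    Tm.act (P := orthoPresentation 𝕜 N) (OGen.ladderF 1 2 1 1 0 rfl rfl) Z =
      (webAction 𝕜 N).s (rfl : 1 + 1 = 2) _ ≫
        ((webAction 𝕜 N).F 1).map ((pivotalAction 𝕜 N).cap 1 Z) := by
  refine (act_ladderF _ _ _ _ _ _ _ Z).trans ((congrArg (fun t =>
    ((webAction 𝕜 N).F 2).map t ≫ (webAction 𝕜 N).s (rfl : 1 + 1 = 2) _ ≫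
      ((webAction 𝕜 N).F 1).map ((pivotalAction 𝕜 N).cap 1 Z)) (split_one_zero Z)).trans ?_)
  change ((webAction 𝕜 N).F 2).map (𝟙 (((webAction 𝕜 N).F 1).obj Z)) ≫ _ = _
  rw [CategoryTheory.Functor.map_id]
  exact Category.id_comp _

theorem ladderE_zero (Z : OrthoWeb 𝕜 N) :
    Tm.act (P := orthoPresentation 𝕜 N) (OGen.ladderE 0 1 0 1 0 rfl rfl) Z = 𝟙 _ := by
  have h : (webAction 𝕜 N).m (rfl : 0 + 0 = 0) Z = 𝟙 _ := (webAction 𝕜 N).m_zero_left _ _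
  refine (act_ladderE _ _ _ _ _ _ _ Z).trans ((congr (congrArg₂ (fun t u v =>
    ((webAction 𝕜 N).F 1).map t ≫ ((webAction 𝕜 N).F 1).map (((webAction 𝕜 N).F 0).map u) ≫ v)
      (cup_zero Z) h) (merge_one_zero _)).trans ?_)
  change ((webAction 𝕜 N).F 1).map (𝟙 Z) ≫ ((webAction 𝕜 N).F 1).map (𝟙 Z) ≫ 𝟙 _ = _
  simp only [CategoryTheory.Functor.map_id, Category.comp_id]
  rfl

theorem ladderF_zero (Z : OrthoWeb 𝕜 N) :
    Tm.act (P := orthoPresentation 𝕜 N) (OGen.ladderF 0 1 0 1 0 rfl rfl) Z = 𝟙 _ := by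
  have h : (webAction 𝕜 N).s (rfl : 0 + 0 = 0) Z = 𝟙 _ := (webAction 𝕜 N).s_zero_left _ _
  refine (act_ladderF _ _ _ _ _ _ _ Z).trans ((congr (congrArg₂ (fun t u v =>
    ((webAction 𝕜 N).F 1).map t ≫ u ≫ ((webAction 𝕜 N).F 1).map v)
      h (split_one_zero _)) (cap_zero Z)).trans ?_)
  change ((webAction 𝕜 N).F 1).map (𝟙 Z) ≫ 𝟙 _ ≫ ((webAction 𝕜 N).F 1).map (𝟙 Z) = _
  simp only [CategoryTheory.Functor.map_id, Category.comp_id]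
  rfl

/-- On the word `1 ⊗ 0` the ladders e and f are the lower and the upper half of the bubble, and the
trivial ladders are identities, so the relation reads 0 = bubble + (1 - N). -/
theorem bubble_one (Z : OrthoWeb 𝕜 N) :
    ((webAction 𝕜 N).F 1).map ((pivotalAction 𝕜 N).cup 1 Z) ≫
      (webAction 𝕜 N).m (rfl : 1 + 1 = 2) _ ≫ (webAction 𝕜 N).s rfl _ ≫
        ((webAction 𝕜 N).F 1).map ((pivotalAction 𝕜 N).cap 1 Z) = ((N : 𝕜) - 1) • 𝟙 _ := by
  have h := ladder_one_zero Z
  rw [ladderE_one, ladderF_one, ladderE_zero, ladderF_zero] at h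
  refine Eq.trans ?_ ((eq_neg_of_add_eq_zero_left h.symm).trans ?_)
  · exact (Category.assoc _ _ _).symm
  · rw [← neg_smul, neg_sub]
    exact congrArg (((N : 𝕜) - 1) • ·) (Category.comp_id _)

section TorsionFree

variable [CharZero 𝕜]

variable (𝕜 N)

/-- The thin cap and cup of orthogonal webs satisfy Sartori's relations. -/
theorem respects_sameName :
    Respects (sartoriPresentation 𝕜 N) (orthoPresentation 𝕜 N) (sameName 𝕜 N) := by
  intro X Y f g h
  cases h with
  | typeA h => exact .rel (.typeA (h.subst SGen.ofA OGen.ofA fun _ _ _ => rfl))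
  | circle => exact .of_act_eq (P := orthoPresentation 𝕜 N) circle_one
  | bubble =>
    refine .of_act_eq (P := orthoPresentation 𝕜 N) fun Z => ?_
    exact (act_bubble (P := orthoPresentation 𝕜 N) (OGen.cupTm 1) (merge OGen.ofA 1 1 2 rfl)
      (split OGen.ofA 1 1 2 rfl) (OGen.capTm 1) Z).trans (bubble_one Z)
  | lollipop_cap => exact .of_act_eq (P := orthoPresentation 𝕜 N) s_cap_one
  | lollipop_cup =>
    exact .of_act_eq (P := orthoPresentation 𝕜 N)
      fun Z => (pivotalAction 𝕜 N).cup_m_eq_zero s_cap_one Z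
  | slide_cap l =>
    refine .of_act_eq (P := orthoPresentation 𝕜 N) fun Z => ?_
    exact (act_pass_cap (P := orthoPresentation 𝕜 N) (cross OGen.ofA l 1) (cross OGen.ofA l 1)
      (OGen.capTm 1) Z).trans (((pivotalAction 𝕜 N).slide_cap l 1 Z).trans
        (act_id_tensor_cap (P := orthoPresentation 𝕜 N) (A := ob l) (OGen.capTm 1) Z).symm)
  | slide_cup l =>
    refine .of_act_eq (P := orthoPresentation 𝕜 N) fun Z => ?_
    exact (act_cup_pass (P := orthoPresentation 𝕜 N) (OGen.cupTm 1) (cross OGen.ofA l 1)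
      (cross OGen.ofA l 1) Z).trans (((pivotalAction 𝕜 N).slide_cup l 1 Z).trans
        (act_cup_tensor_id (P := orthoPresentation 𝕜 N) (A := ob l) (OGen.cupTm 1) Z).symm)
  | mergeSplit_cap =>
    refine .of_act_eq (P := orthoPresentation 𝕜 N) fun Z => ?_
    exact (act_tensor_id_caps (P := orthoPresentation 𝕜 N) (merge OGen.ofA 1 1 2 rfl)
      (split OGen.ofA 1 1 2 rfl) (OGen.capTm 1) (OGen.capTm 1) Z).trans
        (((pivotalAction 𝕜 N).m_s_cap Z).trans (act_id_tensor_caps (P := orthoPresentation 𝕜 N)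
          (merge OGen.ofA 1 1 2 rfl) (split OGen.ofA 1 1 2 rfl) (OGen.capTm 1) (OGen.capTm 1)
            Z).symm)
  | mergeSplit_cup =>
    refine .of_act_eq (P := orthoPresentation 𝕜 N) fun Z => ?_
    exact (act_cups_tensor_id (P := orthoPresentation 𝕜 N) (OGen.cupTm 1) (OGen.cupTm 1)
      (merge OGen.ofA 1 1 2 rfl) (split OGen.ofA 1 1 2 rfl) Z).trans
        (((pivotalAction 𝕜 N).cup_m_s Z).trans (act_cups_id_tensor (P := orthoPresentation 𝕜 N)
          (OGen.cupTm 1) (OGen.cupTm 1) (merge OGen.ofA 1 1 2 rfl) (split OGen.ofA 1 1 2 rfl)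
            Z).symm)

end TorsionFree

end Ortho

/-! ### Thick caps and cups of orthogonal webs are exploded ones -/

theorem inv_smul_nsmul {𝕜 M : Type*} [Field 𝕜] [CharZero 𝕜] [AddCommGroup M] [Module 𝕜 M] {n : ℕ}
    (hn : n ≠ 0) (x : M) : (n : 𝕜)⁻¹ • n • x = x := by
  rw [← Nat.cast_smul_eq_nsmul 𝕜, smul_smul, inv_mul_cancel₀ (Nat.cast_ne_zero.2 hn), one_smul]

namespace Ortho

variable {𝕜 : Type} [Field 𝕜] [CharZero 𝕜] {N : ℕ}

/-- Iterating `PivotalAction.cap_succ` collects the factors 1, ..., k, which the normalization of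
thick caps divides out again. -/
theorem act_nestedCap (k : ℕ) (Z : OrthoWeb 𝕜 N) :
    Tm.act (P := orthoPresentation 𝕜 N) ((SGen.nestedCap k).subst (sameName 𝕜 N)) Z =
      k.factorial • (pivotalAction 𝕜 N).cap k Z := by
  induction k generalizing Z with
  | zero =>
    exact ((cap_zero Z).symm.trans (one_nsmul _).symm)
  | succ k ih =>
    let A := pivotalAction 𝕜 N
    have h : 1 + k = k + 1 := Nat.add_comm _ _
    refine (act_nested_cap (P := orthoPresentation 𝕜 N) (split OGen.ofA 1 k (k + 1) h)
      (split OGen.ofA k 1 (k + 1) rfl) ((SGen.nestedCap k).subst (sameName 𝕜 N))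
      (OGen.capTm 1) Z).trans ?_
    have e : (A.F (k + 1)).map (A.s rfl Z) ≫ A.s h _ ≫ (A.F 1).map (k.factorial • A.cap k _) ≫
        A.cap 1 Z = (k + 1).factorial • A.cap (k + 1) Z := by
      rw [Nat.factorial_succ, mul_comm, mul_smul, A.cap_succ h, Functor.map_nsmul,
        Preadditive.nsmul_comp, Preadditive.comp_nsmul, Preadditive.comp_nsmul]
    exact (congrArg (fun t => (A.F (k + 1)).map (A.s rfl Z) ≫ A.s h _ ≫ (A.F 1).map t ≫
      A.cap 1 Z) (ih _)).trans e

theorem act_nestedCup (k : ℕ) (Z : OrthoWeb 𝕜 N) :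
    Tm.act (P := orthoPresentation 𝕜 N) ((SGen.nestedCup k).subst (sameName 𝕜 N)) Z =
      k.factorial • (pivotalAction 𝕜 N).cup k Z := by
  induction k generalizing Z with
  | zero =>
    exact ((cup_zero Z).symm.trans (one_nsmul _).symm)
  | succ k ih =>
    let A := pivotalAction 𝕜 N
    have h : 1 + k = k + 1 := Nat.add_comm _ _
    refine (act_nested_cup (P := orthoPresentation 𝕜 N) (OGen.cupTm 1)
      ((SGen.nestedCup k).subst (sameName 𝕜 N)) (merge OGen.ofA 1 k (k + 1) h)
      (merge OGen.ofA k 1 (k + 1) rfl) Z).trans ?_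
    have e : A.cup 1 Z ≫ (A.F 1).map (k.factorial • A.cup k _) ≫
        (A.F 1).map ((A.F k).map (A.m rfl Z)) ≫ A.m h _ =
          (k + 1).factorial • A.cup (k + 1) Z := by
      rw [Nat.factorial_succ, mul_comm, mul_smul, A.cup_succ h, Functor.map_nsmul,
        Preadditive.nsmul_comp, Preadditive.comp_nsmul]
    exact (congrArg (fun t => A.cup 1 Z ≫ (A.F 1).map t ≫ (A.F 1).map ((A.F k).map (A.m rfl Z)) ≫
      A.m h _) (ih _)).trans e

theorem eqv_thickCap (k : ℕ) : Eqv (orthoPresentation 𝕜 N)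
    ((SGen.thickCap k).subst (sameName 𝕜 N)) (OGen.capTm k) := by
  refine .of_act_eq (P := orthoPresentation 𝕜 N) fun Z => ?_
  refine (congrArg ((k.factorial : 𝕜)⁻¹ • ·) (act_nestedCap k Z)).trans ?_
  exact inv_smul_nsmul k.factorial_ne_zero _

theorem eqv_thickCup (k : ℕ) : Eqv (orthoPresentation 𝕜 N)
    ((SGen.thickCup k).subst (sameName 𝕜 N)) (OGen.cupTm k) := by
  refine .of_act_eq (P := orthoPresentation 𝕜 N) fun Z => ?_
  refine (congrArg ((k.factorial : 𝕜)⁻¹ • ·) (act_nestedCup k Z)).trans ?_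
  exact inv_smul_nsmul k.factorial_ne_zero _

/-- The identity is known for exploded caps in Sartori's category; the functor induced by `sameName`
carries it over, because it sends exploded caps to thick caps. -/
theorem eqv_cross_cap (k : ℕ) :
    Eqv (orthoPresentation 𝕜 N) (cross OGen.ofA k k ⨟ OGen.capTm k) (OGen.capTm k) := by
  have h : Eqv (sartoriPresentation 𝕜 N) (cross SGen.ofA k k ⨟ SGen.thickCap k)
      (SGen.thickCap k) :=
    .of_act_eq (P := sartoriPresentation 𝕜 N) fun Z => (Sartori.orthoAction 𝕜 N).x_cap k Z
  exact ((Eqv.comp (.refl _) (eqv_thickCap k)).symm.trans ((respects_sameName 𝕜 N).eqv h)).trans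
    (eqv_thickCap k)

end Ortho

/-- Orthogonal webs satisfy the relations of a symmetric ribbon category. -/
theorem ortho_ribbonRelations (𝕜 : Type) [Field 𝕜] [CharZero 𝕜] (N : ℕ) :
    RibbonRelations (P := orthoPresentation 𝕜 N) OGen.ofA OGen.capTm OGen.cupTm where
  cross_cross k l Z := (Ortho.pivotalAction 𝕜 N).x_x k l Z
  gen_natural m X Y g Z := by
    have hA : ∀ ⦃X Y : Ob⦄ {f g : Tm 𝕜 (orthoPresentation 𝕜 N).Gen X Y},
        TypeARel OGen.ofA N f g → (orthoPresentation 𝕜 N).Rel f g := fun _ _ _ _ h => .typeA h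
    cases g with
    | typeA g => exact typeA_natural (P := orthoPresentation 𝕜 N) OGen.ofA hA m g Z
    | cap k =>
      exact cap_natural (P := orthoPresentation 𝕜 N) OGen.ofA hA m (OGen.capTm k) Z
        ((Ortho.pivotalAction 𝕜 N).slide_cap (m + 1) k Z)
    | cup k =>
      exact cup_natural (P := orthoPresentation 𝕜 N) OGen.ofA hA m (OGen.cupTm k) Z
        ((Ortho.pivotalAction 𝕜 N).slide_cup (m + 1) k Z)
  zigzag_left k Z := (Ortho.pivotalAction 𝕜 N).zigzag_left k Z
  zigzag_right k Z := (Ortho.pivotalAction 𝕜 N).zigzag_right k Z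
  cross_cap k Z := Eqv.act_eq (P := orthoPresentation 𝕜 N) (Ortho.eqv_cross_cap k) Z

/-! ### The two functors are inverse and symmetric ribbon -/

section Functors

variable {𝕜 : Type} [CommRing 𝕜] {P Q : Presentation 𝕜}

/-- Assignments on generators that are mutually inverse up to the relations induce mutually
inverse functors. -/
theorem inducedFunctor_comp_eq_id {σ : ∀ ⦃X Y : Ob⦄, P.Gen X Y → Tm 𝕜 Q.Gen X Y}
    {τ : ∀ ⦃X Y : Ob⦄, Q.Gen X Y → Tm 𝕜 P.Gen X Y} (hσ : Respects P Q σ) (hτ : Respects Q P τ)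
    (h : ∀ ⦃X Y : Ob⦄ (g : P.Gen X Y), Eqv P ((σ g).subst τ) (.gen g)) :
    inducedFunctor hσ ⋙ inducedFunctor hτ = 𝟭 (Presented P) := by
  have e : ∀ {X Y : Ob} (f : Tm 𝕜 P.Gen X Y), Eqv P ((f.subst σ).subst τ) f := by
    intro X Y f
    induction f with
    | gen g => exact h g
    | comp _ _ ih₁ ih₂ => exact .comp ih₁ ih₂
    | tensor _ _ ih₁ ih₂ => exact .tensor ih₁ ih₂
    | add _ _ ih₁ ih₂ => exact .add ih₁ ih₂
    | smul c _ ih => exact .smul c ih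
    | _ => exact .refl _
  refine CategoryTheory.Functor.ext (fun X => rfl) ?_
  rintro X Y ⟨f⟩
  refine Eq.trans ?_ ((Category.id_comp _).trans (Category.comp_id _)).symm
  exact Quotient.sound (s := eqvSetoid P X.as Y.as) (e f)

theorem inducedFunctor_isSymmetricRibbonFunctor
    {σ : ∀ ⦃X Y : Ob⦄, P.Gen X Y → Tm 𝕜 Q.Gen X Y} (hσ : Respects P Q σ)
    {ι : ∀ ⦃X Y : Ob⦄, AGen X Y → P.Gen X Y} {ι' : ∀ ⦃X Y : Ob⦄, AGen X Y → Q.Gen X Y}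
    (h : ∀ ⦃X Y : Ob⦄ (g : AGen X Y), σ (ι g) = Tm.gen (ι' g))
    {cap : ∀ k : ℕ, Tm 𝕜 P.Gen (ob k ⊙ ob k) Ob.unit}
    {cup : ∀ k : ℕ, Tm 𝕜 P.Gen Ob.unit (ob k ⊙ ob k)}
    {cap' : ∀ k : ℕ, Tm 𝕜 Q.Gen (ob k ⊙ ob k) Ob.unit}
    {cup' : ∀ k : ℕ, Tm 𝕜 Q.Gen Ob.unit (ob k ⊙ ob k)}
    (R : RibbonRelations ι cap cup) (R' : RibbonRelations ι' cap' cup') :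
    IsSymmetricRibbonFunctor 𝕜 (diagrammaticData P ι cap cup) (diagrammaticData Q ι' cap' cup')
      (inducedFunctor hσ) where
  additive := ⟨by
    rintro X Y ⟨f⟩ ⟨g⟩
    rfl⟩
  linear := ⟨by
    rintro X Y ⟨f⟩ c
    rfl⟩
  map_braid X Y := by
    refine (Category.id_comp _).trans (Eq.trans ?_ (Category.comp_id _).symm)
    exact congrArg (Tm.mk (P := Q)) (subst_braidWord σ ι ι' h X.as Y.as)
  map_twist X := by
    -- Both twists are identities, so no comparison of caps and cups is needed.
    rw [R.twist_eq_id, R'.twist_eq_id]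
    exact (inducedFunctor hσ).map_id X

end Functors

instance : CharZero QI :=
  inferInstanceAs (CharZero (IntermediateField.adjoin ℚ {Complex.I}))

section

variable (𝕜 : Type) [Field 𝕜] [CharZero 𝕜] (N : ℕ)

/-- Only the thin cap and cup need an argument: their explosions are themselves. -/
theorem sameName_comp_explosion :
    inducedFunctor (Ortho.respects_sameName 𝕜 N) ⋙ inducedFunctor (Sartori.respects_explosion 𝕜 N) =
      𝟭 _ := by
  refine inducedFunctor_comp_eq_id _ _ fun X Y g => ?_
  cases g with
  | typeA g => exact .refl _
  | cap => exact .of_act_eq (P := sartoriPresentation 𝕜 N) Sartori.thickCap_one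
  | cup => exact .of_act_eq (P := sartoriPresentation 𝕜 N) Sartori.thickCup_one

theorem explosion_comp_sameName :
    inducedFunctor (Sartori.respects_explosion 𝕜 N) ⋙ inducedFunctor (Ortho.respects_sameName 𝕜 N) =
      𝟭 _ := by
  refine inducedFunctor_comp_eq_id _ _ fun X Y g => ?_
  cases g with
  | typeA g => exact .refl _
  | cap k => exact Ortho.eqv_thickCap k
  | cup k => exact Ortho.eqv_thickCup k

end

end OrthogonalWebs

theorem propositionP (N : ℕ) :
    OrthogonalWebs.IsSymmetricRibbon (OrthogonalWebs.orthoRibbon OrthogonalWebs.QI N) ∧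
    OrthogonalWebs.IsSymmetricRibbon (OrthogonalWebs.sartoriRibbon OrthogonalWebs.QI N) ∧
    ∃ (hF : OrthogonalWebs.Respects (OrthogonalWebs.sartoriPresentation OrthogonalWebs.QI N)
          (OrthogonalWebs.orthoPresentation OrthogonalWebs.QI N) (OrthogonalWebs.sameName OrthogonalWebs.QI N))
      (hG : OrthogonalWebs.Respects (OrthogonalWebs.orthoPresentation OrthogonalWebs.QI N)
          (OrthogonalWebs.sartoriPresentation OrthogonalWebs.QI N) (OrthogonalWebs.explosion OrthogonalWebs.QI N)),
      OrthogonalWebs.IsSymmetricRibbonFunctor OrthogonalWebs.QI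
        (OrthogonalWebs.sartoriRibbon OrthogonalWebs.QI N)
        (OrthogonalWebs.orthoRibbon OrthogonalWebs.QI N)
        (OrthogonalWebs.inducedFunctor hF) ∧
      OrthogonalWebs.IsSymmetricRibbonFunctor OrthogonalWebs.QI
        (OrthogonalWebs.orthoRibbon OrthogonalWebs.QI N)
        (OrthogonalWebs.sartoriRibbon OrthogonalWebs.QI N)
        (OrthogonalWebs.inducedFunctor hG) ∧
      (OrthogonalWebs.inducedFunctor hF).IsEquivalence ∧
      CategoryTheory.Functor.comp (OrthogonalWebs.inducedFunctor hF)
        (OrthogonalWebs.inducedFunctor hG) = CategoryTheory.Functor.id _ ∧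
      CategoryTheory.Functor.comp (OrthogonalWebs.inducedFunctor hG)
        (OrthogonalWebs.inducedFunctor hF) = CategoryTheory.Functor.id _ := by
  have R := OrthogonalWebs.ortho_ribbonRelations OrthogonalWebs.QI N
  have S := OrthogonalWebs.sartori_ribbonRelations OrthogonalWebs.QI N
  have hF := OrthogonalWebs.Ortho.respects_sameName OrthogonalWebs.QI N
  have hG := OrthogonalWebs.Sartori.respects_explosion OrthogonalWebs.QI N
  have hFG := OrthogonalWebs.sameName_comp_explosion OrthogonalWebs.QI N
  have hGF := OrthogonalWebs.explosion_comp_sameName OrthogonalWebs.QI N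
  refine ⟨R.isSymmetricRibbon, S.isSymmetricRibbon, hF, hG,
    OrthogonalWebs.inducedFunctor_isSymmetricRibbonFunctor hF (ι := OrthogonalWebs.SGen.ofA)
      (ι' := OrthogonalWebs.OGen.ofA) (fun _ _ _ => rfl) S R,
    OrthogonalWebs.inducedFunctor_isSymmetricRibbonFunctor hG (ι := OrthogonalWebs.OGen.ofA)
      (ι' := OrthogonalWebs.SGen.ofA) (fun _ _ _ => rfl) R S, ?_, hFG, hGF⟩
  -- Both composites equal the identity functor on the nose, which provides the unit and the counit.
  exact (CategoryTheory.Equivalence.mk _ _ (CategoryTheory.eqToIso hFG.symm)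
    (CategoryTheory.eqToIso hGF)).isEquivalence_functor
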